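/- Let $n\ge 2$ and $\frac{2n}{n-1}<p\le\infty$. Write $B^m_1(0)$ for the open unit ball of $\mathbb R^m$. Consider pairs $(\phi,a)$ of a smooth function $\phi:B^n_1(0)\times B^{n-1}_1(0)\to\mathbb R$ and a non-negative $a\in C_c^\infty(\mathbb R^n\times\mathbb R^{n-1})$ supported in $B^n_1(0)\times B^{n-1}_1(0)$ such that, with $G_0(x,\xi):=\bigwedge_{j=1}^{n-1}\partial_{\xi_j}\partial_x\phi(x,\xi)$ (identified with a vector of $\mathbb R^n$ by Hodge duality) and $G:=G_0/|G_0|$, * (H1) $\operatorname{rank}\partial^2_{\xi x}\phi(x,\xi)=n-1$ for all $(x,\xi)\in B^n_1(0)\times B^{n-1}_1(0)$; * (H2) $\det\partial^2_{\xi\xi}\langle\partial_x\phi(x,\xi),G(x,\xi_0)\rangle|_{\xi=\xi_0}\ne0$ for all $(x,\xi_0)\in\operatorname{supp}a$; * (H3, convex) the eigenvalues of the matrix in (H2) are all positive for all $(x,\xi_0)\in\operatorname{supp}a$; * (H4, straight) for each $\xi\in B_1^{n-1}(0)$, $G(x,\xi)$ does not depend on $x\in B_1^n(0)$. For $\lambda\ge1$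 put $$T^\lambda f(x):=\int_{B^{n-1}_1(0)}e^{2\pi i\lambda\phi(x/\lambda,\xi)}\,a(x/\lambda,\xi)\,f(\xi)\,d\xi .$$ Suppose that for every such pair $(\phi,a)$ there is a constant $C_{\phi,a}$ with $$\|T^\lambda f\|_{L^p(\mathbb R^n)}\le C_{\phi,a}\,\|f\|_{L^p(B^{n-1}_1(0))}\qquad\text{for all }\lambda\ge1,\ f\in L^p(B^{n-1}_1(0)).$$ Then there is a constant $C>0$, depending only on $p$ and $n$, such that for every $z\in\mathbb C\setminus[0,\infty)$ the resolvent $(-\Delta-z)^{-1}$ on $\mathbb R^n$ is bounded on $L^p(\mathbb R^n)$ and $$\|(-\Delta-z)^{-1}\|_{L^p\to L^p}\le C\,|z|^{-1+\gamma_{p,p}}\operatorname{dist}(z,[0,\infty))^{-\gamma_{p,p}},$$ where (with $1/\infty=0$) $$\gamma_{p,q}:=\max\Big\{0,\ 1-\frac{n+1}2\Big(\frac1p-\frac1q\Big),\ \frac{n+1}2-\frac np,\ \frac nq-\frac{n-1}2\Big\}.$$ -/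

import Mathlib

open MeasureTheory Metric
open scoped ENNReal NNReal ContDiff SchwartzMap Laplacian

noncomputable section

namespace HormanderResolvent

/-! ### Hörmander-type operators

Throughout `x` ranges over `ℝⁿ`, `ξ` over `ℝⁿ⁻¹`, and a phase `φ` or an amplitude `a` is a curried
function of `x` and `ξ`.  Only the values of a phase on the product of the open unit balls matter. -/

/-- The product `B₁ⁿ(0) × B₁ⁿ⁻¹(0)` of the open unit balls. -/
def unitBalls (n : ℕ) : Set (EuclideanSpace ℝ (Fin n) × EuclideanSpace ℝ (Fin (n - 1))) :=
  ball 0 1 ×ˢ ball 0 1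

/-- The spatial gradient `∂ₓ φ(x, ξ) ∈ ℝⁿ`. -/
def gradX {n : ℕ} (φ : EuclideanSpace ℝ (Fin n) → EuclideanSpace ℝ (Fin (n - 1)) → ℝ)
    (x : EuclideanSpace ℝ (Fin n)) (ξ : EuclideanSpace ℝ (Fin (n - 1))) :
    EuclideanSpace ℝ (Fin n) :=
  gradient (fun y => φ y ξ) x

/-- The `(n-1) × n` matrix `∂²_{ξ x} φ(x, ξ)`, whose `j`-th row is the vector `∂_{ξ_j} ∂ₓ φ(x, ξ)`. -/
def mixedHessian {n : ℕ} (φ : EuclideanSpace ℝ (Fin n) → EuclideanSpace ℝ (Fin (n - 1)) → ℝ)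
    (x : EuclideanSpace ℝ (Fin n)) (ξ : EuclideanSpace ℝ (Fin (n - 1))) :
    Matrix (Fin (n - 1)) (Fin n) ℝ :=
  Matrix.of fun j i => (fderiv ℝ (fun η => gradX φ x η) ξ (EuclideanSpace.single j 1)) i

/-- The vector `G₀(x, ξ) = ⋀_{j=1}^{n-1} ∂_{ξ_j} ∂ₓ φ(x, ξ)`, where an `(n-1)`-vector
`v₁ ∧ … ∧ v_{n-1}` of `ℝⁿ` is identified, by Hodge duality, with the vector whose `i`-th coordinate
is `det (v₁, …, v_{n-1}, e_i)` (rows). -/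
def gaussVector {n : ℕ} (φ : EuclideanSpace ℝ (Fin n) → EuclideanSpace ℝ (Fin (n - 1)) → ℝ)
    (x : EuclideanSpace ℝ (Fin n)) (ξ : EuclideanSpace ℝ (Fin (n - 1))) :
    EuclideanSpace ℝ (Fin n) :=
  WithLp.toLp 2 fun i => Matrix.det (Matrix.of fun r k : Fin n =>
    if h : (r : ℕ) < n - 1 then mixedHessian φ x ξ ⟨r, h⟩ k else if k = i then (1 : ℝ) else 0)

/-- The Gauss map `G = G₀ / |G₀|`. -/
def gaussMap {n : ℕ} (φ : EuclideanSpace ℝ (Fin n) → EuclideanSpace ℝ (Fin (n - 1)) → ℝ)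
    (x : EuclideanSpace ℝ (Fin n)) (ξ : EuclideanSpace ℝ (Fin (n - 1))) :
    EuclideanSpace ℝ (Fin n) :=
  ‖gaussVector φ x ξ‖⁻¹ • gaussVector φ x ξ

/-- The Hessian matrix `∂²_{ξξ} ⟨∂ₓ φ(x, ξ), G(x, ξ₀)⟩` evaluated at `ξ = ξ₀`. -/
def curvatureHessian {n : ℕ} (φ : EuclideanSpace ℝ (Fin n) → EuclideanSpace ℝ (Fin (n - 1)) → ℝ)
    (x : EuclideanSpace ℝ (Fin n)) (ξ₀ : EuclideanSpace ℝ (Fin (n - 1))) :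
    Matrix (Fin (n - 1)) (Fin (n - 1)) ℝ :=
  Matrix.of fun i j =>
    fderiv ℝ (fun ξ => fderiv ℝ (fun η => inner ℝ (gradX φ x η) (gaussMap φ x ξ₀)) ξ
      (EuclideanSpace.single i 1)) ξ₀ (EuclideanSpace.single j 1)

/-- An amplitude: a non-negative function `a ∈ C_c^∞(ℝⁿ × ℝⁿ⁻¹)` supported in
`B₁ⁿ(0) × B₁ⁿ⁻¹(0)`. -/
structure IsAmplitude {n : ℕ}
    (a : EuclideanSpace ℝ (Fin n) → EuclideanSpace ℝ (Fin (n - 1)) → ℝ) : Prop where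
  smooth : ContDiff ℝ ∞ (Function.uncurry a)
  compact : HasCompactSupport (Function.uncurry a)
  support : tsupport (Function.uncurry a) ⊆ unitBalls n
  nonneg : ∀ x ξ, 0 ≤ a x ξ

/-- The Carleson–Sjölin conditions on a smooth phase `φ` (relative to the amplitude `a`). -/
structure CarlesonSjolin {n : ℕ}
    (φ a : EuclideanSpace ℝ (Fin n) → EuclideanSpace ℝ (Fin (n - 1)) → ℝ) : Prop where
  smooth : ContDiffOn ℝ ∞ (Function.uncurry φ) (unitBalls n)
  rank_eq : ∀ x ξ, (x, ξ) ∈ unitBalls n → (mixedHessian φ x ξ).rank = n - 1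
  curvature : ∀ x ξ₀, (x, ξ₀) ∈ tsupport (Function.uncurry a) → (curvatureHessian φ x ξ₀).det ≠ 0

/-- The convex condition: on the support of `a`, the eigenvalues of the (symmetric) matrix
`curvatureHessian` are all positive. -/
def ConvexCondition {n : ℕ}
    (φ a : EuclideanSpace ℝ (Fin n) → EuclideanSpace ℝ (Fin (n - 1)) → ℝ) : Prop :=
  ∀ x ξ₀, (x, ξ₀) ∈ tsupport (Function.uncurry a) → (curvatureHessian φ x ξ₀).PosDef

/-- The straight condition: for given `ξ`, the Gauss map `G(x, ξ)` does not depend on `x`. -/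
def StraightCondition {n : ℕ}
    (φ : EuclideanSpace ℝ (Fin n) → EuclideanSpace ℝ (Fin (n - 1)) → ℝ) : Prop :=
  ∀ x y ξ, (x, ξ) ∈ unitBalls n → (y, ξ) ∈ unitBalls n → gaussMap φ x ξ = gaussMap φ y ξ

/-- The operator
`T^λ f(x) = ∫_{B₁ⁿ⁻¹(0)} exp(2πi λ φ(x/λ, ξ)) a(x/λ, ξ) f(ξ) dξ`. -/
def oscOp {n : ℕ} (φ a : EuclideanSpace ℝ (Fin n) → EuclideanSpace ℝ (Fin (n - 1)) → ℝ)
    (lam : ℝ) (f : EuclideanSpace ℝ (Fin (n - 1)) → ℂ) (x : EuclideanSpace ℝ (Fin n)) : ℂ :=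
  ∫ ξ in ball (0 : EuclideanSpace ℝ (Fin (n - 1))) 1,
    Complex.exp (2 * Real.pi * Complex.I * ((lam * φ (lam⁻¹ • x) ξ : ℝ) : ℂ)) *
      (a (lam⁻¹ • x) ξ : ℂ) * f ξ

/-- The estimate `‖T^λ f‖_{L^p(ℝⁿ)} ≤ C ‖f‖_{L^p(B₁ⁿ⁻¹(0))}`, with one constant `C` for all
`λ ≥ 1` and all `f ∈ L^p(B₁ⁿ⁻¹(0))`. -/
def UniformLpBound {n : ℕ} (p : ℝ≥0∞)
    (φ a : EuclideanSpace ℝ (Fin n) → EuclideanSpace ℝ (Fin (n - 1)) → ℝ) : Prop :=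
  ∃ C : ℝ≥0, ∀ lam : ℝ, 1 ≤ lam → ∀ f : EuclideanSpace ℝ (Fin (n - 1)) → ℂ,
    MemLp f p (volume.restrict (ball 0 1)) →
      eLpNorm (oscOp φ a lam f) p volume ≤ C * eLpNorm f p (volume.restrict (ball 0 1))

/-! ### The resolvent of the Laplacian -/

/-- The half-line `[0, ∞)` in the complex plane. -/
def posHalfLine : Set ℂ := (fun t : ℝ => (t : ℂ)) '' Set.Ici 0

/-- The symbol `(4π²|ξ|² - z)⁻¹` of `(-Δ - z)⁻¹`, for the Fourier transform normalized by
`e^{-2πi x·ξ}`. -/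
def resolventSymbol (n : ℕ) (z : ℂ) (ξ : EuclideanSpace ℝ (Fin n)) : ℂ :=
  (((4 * Real.pi ^ 2 * ‖ξ‖ ^ 2 : ℝ) : ℂ) - z)⁻¹

/-- The resolvent `(-Δ - z)⁻¹`, `z ∈ ℂ \ [0, ∞)`, on tempered distributions on `ℝⁿ`. -/
def resolvent (n : ℕ) (z : ℂ) :
    𝓢'(EuclideanSpace ℝ (Fin n), ℂ) →L[ℂ] 𝓢'(EuclideanSpace ℝ (Fin n), ℂ) :=
  TemperedDistribution.fourierMultiplierCLM ℂ (resolventSymbol n z)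

/-- For `z ∉ [0, ∞)` the symbol is smooth of temperate growth, so that `resolvent` really is
multiplication by the symbol on the Fourier side. -/
theorem resolventSymbol_hasTemperateGrowth (n : ℕ) {z : ℂ} (hz : z ∉ posHalfLine) :
    (resolventSymbol n z).HasTemperateGrowth := by
  have hs : (fun ξ : EuclideanSpace ℝ (Fin n) =>
      4 * Real.pi ^ 2 * ‖ξ‖ ^ 2).HasTemperateGrowth := by fun_prop
  by_cases hy : z.im = 0
  · have hx : z.re < 0 := by
      by_contra h
      exact hz ⟨z.re, not_lt.mp h, by apply Complex.ext <;> simp [hy]⟩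
    have hb := (Function.hasTemperateGrowth_one_add_norm_sq_rpow ℝ (-1))
    have h1 : (fun ξ : EuclideanSpace ℝ (Fin n) =>
        (1 + ‖((2 * Real.pi / √(-z.re)) • ξ)‖ ^ 2) ^ (-1 : ℝ)).HasTemperateGrowth :=
      (Function.hasTemperateGrowth_one_add_norm_sq_rpow
        (EuclideanSpace ℝ (Fin n)) (-1)).comp (f := fun ξ => (2 * Real.pi / √(-z.re)) • ξ)
        (by fun_prop)
    have h2 : resolventSymbol n z = fun ξ => (((-z.re)⁻¹ *
        (1 + ‖((2 * Real.pi / √(-z.re)) • ξ)‖ ^ 2) ^ (-1 : ℝ) : ℝ) : ℂ) := by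
      funext ξ
      have hz' : z = (z.re : ℂ) := by apply Complex.ext <;> simp [hy]
      rw [resolventSymbol]
      conv_lhs => rw [hz']
      rw [← Complex.ofReal_sub, ← Complex.ofReal_inv, Real.rpow_neg_one, ← mul_inv, norm_smul,
        mul_pow, Real.norm_eq_abs, sq_abs, div_pow, Real.sq_sqrt (by linarith)]
      congr 2
      have : z.re ≠ 0 := hx.ne
      field_simp
      ring
    rw [h2]
    fun_prop
  · have h1 : (fun ξ : EuclideanSpace ℝ (Fin n) =>
        (1 + ‖(4 * Real.pi ^ 2 * ‖ξ‖ ^ 2 - z.re) * z.im⁻¹‖ ^ 2) ^ (-1 : ℝ)).HasTemperateGrowth :=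
      (Function.hasTemperateGrowth_one_add_norm_sq_rpow ℝ (-1)).comp
        (f := fun ξ : EuclideanSpace ℝ (Fin n) =>
          (4 * Real.pi ^ 2 * ‖ξ‖ ^ 2 - z.re) * z.im⁻¹) (by fun_prop)
    have h2 : resolventSymbol n z = fun ξ =>
        (((4 * Real.pi ^ 2 * ‖ξ‖ ^ 2 : ℝ) : ℂ) - (starRingEnd ℂ) z) * (((z.im ^ 2)⁻¹ *
        (1 + ‖(4 * Real.pi ^ 2 * ‖ξ‖ ^ 2 - z.re) * z.im⁻¹‖ ^ 2) ^ (-1 : ℝ) : ℝ) : ℂ) := by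
      funext ξ
      rw [resolventSymbol, Complex.inv_def, Real.rpow_neg_one, ← mul_inv]
      congr 1
      · rw [map_sub, Complex.conj_ofReal]
      · congr 2
        rw [Complex.normSq_apply, Real.norm_eq_abs, sq_abs]
        simp only [Complex.sub_re, Complex.sub_im, Complex.ofReal_re, Complex.ofReal_im]
        field_simp
        ring
    rw [h2]
    fun_prop

/-- `-Δ - z` is the Fourier multiplier with symbol `4π²|ξ|² - z`. -/
theorem neg_laplacian_sub_eq (n : ℕ) (z : ℂ) (f : 𝓢'(EuclideanSpace ℝ (Fin n), ℂ)) :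
    -Δ f - z • f = TemperedDistribution.fourierMultiplierCLM ℂ
      (fun ξ : EuclideanSpace ℝ (Fin n) => ((4 * Real.pi ^ 2 * ‖ξ‖ ^ 2 : ℝ) : ℂ) - z) f := by
  have h1 : (fun ξ : EuclideanSpace ℝ (Fin n) =>
      Complex.ofReal (‖ξ‖ ^ 2)).HasTemperateGrowth := by fun_prop
  have h2 : (fun _ : EuclideanSpace ℝ (Fin n) => z).HasTemperateGrowth := by fun_prop
  have h3 : (fun ξ : EuclideanSpace ℝ (Fin n) => ((4 * Real.pi ^ 2 * ‖ξ‖ ^ 2 : ℝ) : ℂ) - z) =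
      ((4 * Real.pi ^ 2 : ℝ) : ℂ) • (fun ξ : EuclideanSpace ℝ (Fin n) => Complex.ofReal (‖ξ‖ ^ 2))
        - (fun _ => z) := by
    funext ξ
    simp
  have h4 : (((4 * Real.pi ^ 2 : ℝ) : ℂ) • (fun ξ : EuclideanSpace ℝ (Fin n) =>
      Complex.ofReal (‖ξ‖ ^ 2))).HasTemperateGrowth := (Function.HasTemperateGrowth.const
        ((4 * Real.pi ^ 2 : ℝ) : ℂ)).mul h1
  have h5 : TemperedDistribution.fourierMultiplierCLM ℂ (fun _ => z) f = z • f := by simp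
  have h6 : TemperedDistribution.fourierMultiplierCLM ℂ
      (((4 * Real.pi ^ 2 : ℝ) : ℂ) • (fun ξ : EuclideanSpace ℝ (Fin n) =>
        Complex.ofReal (‖ξ‖ ^ 2)) - (fun _ => z)) =
      TemperedDistribution.fourierMultiplierCLM ℂ (((4 * Real.pi ^ 2 : ℝ) : ℂ) •
        (fun ξ : EuclideanSpace ℝ (Fin n) => Complex.ofReal (‖ξ‖ ^ 2))) -
      TemperedDistribution.fourierMultiplierCLM ℂ (fun _ => z) := by
    simp only [TemperedDistribution.fourierMultiplierCLM,
      TemperedDistribution.smulLeftCLM_sub h4 h2, ContinuousLinearMap.sub_comp,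
      ContinuousLinearMap.comp_sub]
  rw [TemperedDistribution.laplacian_eq_fourierMultiplierCLM, h3, ← h5, h6,
    TemperedDistribution.fourierMultiplierCLM_smul h1]
  change _ = ((4 * Real.pi ^ 2 : ℝ) : ℂ) • TemperedDistribution.fourierMultiplierCLM ℂ
    (fun ξ : EuclideanSpace ℝ (Fin n) => Complex.ofReal (‖ξ‖ ^ 2)) f - _
  congr 1
  generalize TemperedDistribution.fourierMultiplierCLM ℂ
    (fun ξ : EuclideanSpace ℝ (Fin n) => Complex.ofReal (‖ξ‖ ^ 2)) f = g
  ext u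
  change -((-(2 * Real.pi) ^ 2 : ℝ) • g u) = ((4 * Real.pi ^ 2 : ℝ) : ℂ) • g u
  rw [Complex.coe_smul, ← neg_smul]
  congr 1
  ring

/-- For `z ∉ [0, ∞)` the symbol does not degenerate. -/
theorem symbol_sub_ne_zero (n : ℕ) {z : ℂ} (hz : z ∉ posHalfLine)
    (ξ : EuclideanSpace ℝ (Fin n)) : ((4 * Real.pi ^ 2 * ‖ξ‖ ^ 2 : ℝ) : ℂ) - z ≠ 0 := fun h =>
  hz ⟨4 * Real.pi ^ 2 * ‖ξ‖ ^ 2, Set.mem_Ici.mpr (by positivity), sub_eq_zero.mp h⟩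

/-- `resolvent n z` is the two-sided inverse of `-Δ - z` on tempered distributions. -/
theorem resolvent_inverse (n : ℕ) {z : ℂ} (hz : z ∉ posHalfLine)
    (f : 𝓢'(EuclideanSpace ℝ (Fin n), ℂ)) :
    -Δ (resolvent n z f) - z • resolvent n z f = f ∧ resolvent n z (-Δ f - z • f) = f := by
  have h1 := resolventSymbol_hasTemperateGrowth n hz
  have h2 : (fun ξ : EuclideanSpace ℝ (Fin n) =>
      ((4 * Real.pi ^ 2 * ‖ξ‖ ^ 2 : ℝ) : ℂ) - z).HasTemperateGrowth := by fun_prop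
  have h3 : (resolventSymbol n z * fun ξ : EuclideanSpace ℝ (Fin n) =>
      ((4 * Real.pi ^ 2 * ‖ξ‖ ^ 2 : ℝ) : ℂ) - z) = fun _ => 1 := by
    funext ξ
    exact inv_mul_cancel₀ (symbol_sub_ne_zero n hz ξ)
  constructor
  · rw [neg_laplacian_sub_eq, resolvent,
      TemperedDistribution.fourierMultiplierCLM_fourierMultiplierCLM_apply h1 h2, h3]
    simp
  · rw [neg_laplacian_sub_eq, resolvent,
      TemperedDistribution.fourierMultiplierCLM_fourierMultiplierCLM_apply h2 h1, mul_comm, h3]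
    simp

/-- `γ_{p,q} = max {0, 1 - (n+1)/2 (1/p - 1/q), (n+1)/2 - n/p, n/q - (n-1)/2}`
(with `1/∞ = 0`). -/
def gammaExp (n : ℕ) (p q : ℝ≥0∞) : ℝ :=
  max (max 0 (1 - ((n : ℝ) + 1) / 2 * (p⁻¹.toReal - q⁻¹.toReal)))
    (max (((n : ℝ) + 1) / 2 - n * p⁻¹.toReal) (n * q⁻¹.toReal - ((n : ℝ) - 1) / 2))

end HormanderResolvent

end

noncomputable section

namespace HormanderResolvent

/-! ### Splitting off the last coordinate -/

/-! Put α = n/p. The condition on p says that α < (n-1)/2, and then γ_{p,p} = (n+1)/2 - α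
(`gammaExp_eq`). The resolvent is convolution with a radial kernel. Its norm on L^p is read off from
the pairings of that kernel with a class of test functions c: for p < ∞ the correlations of the unit
balls of L^p and of its dual (`corrClass`), for p = ∞ all measurable functions bounded by 1. Both
classes are invariant under dilations and conjugation, and pairings are scalars, so kernels may be
decomposed into integrals of simpler ones by Fubini.

Oscillating kernels. If A is supported in a half-space {xₙ ≥ c} and f lives on the hyperplane xₙ =
0, then f ↦ ∫ e^{2πiλ|X-(y,0)|} A(X-(y,0)) f(y) dy is an operator T^{Mλ} in disguise. The phase
|X-(y,0)| is not straight in the variable X, but it becomes so in the projective coordinates X =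
M(x', δ)/(1+xₙ), y = -Mξ: it is then M√(|x'+(1+xₙ)ξ|²+δ²)/(1+xₙ), whose Gauss map is the direction
of (-ξ, 1). Geometrically, the lines through (y,0) have become parallel. `projPhase_conditions`
checks the hypotheses, and `exists_slice_bound` undoes the dilation by Mλ, which gains λ^{-n/p}.
Integrating over slices, localizing, and cutting a spherical shell into half-space pieces gives
decay (1+|μ|)^{-α} for the pairings of e^{iμ|x|}χ(|x|) with the class. For p = ∞ one has α = 0 and
this is trivial.

Exponential kernels. For Re β > 0, e^{-β|x|} is an absolutely convergent superposition of dilates of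
e^{iμ|x|}χ(|x|), with μ concentrated where the phases match. This yields pairings of size
|β|^{-α}(Re β)^{α-n} (`exists_exp_kernel_bound`).

The resolvent. The Fourier transform of e^{-β|x|} is a multiple of β(β²+4π²|ξ|²)^{-(n+1)/2}. Taking
β² = -(z+iv) with Im z ≥ 0 and integrating against v^{(n-3)/2}β^{-1} dv over v > 0 lowers the power
(n+1)/2 to 1, and so produces (4π²|ξ|²-z)^{-1} (`exists_fourier_resolventKernel`). Along this path
Re β·|β| is at least a multiple of d+v, where d = dist(z, [0,∞)), and |β|² ≤ |z|+v. A beta integral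
then gives |z|^{(n-1)/2-α} d^{α-(n+1)/2}, the claimed bound. The lower half-plane follows by
conjugation. -/

/-- The identification `ℝᵐ × ℝ ≃ ℝᵐ⁺¹` by appending the last coordinate. -/
def snocL (m : ℕ) : (EuclideanSpace ℝ (Fin m) × ℝ) ≃L[ℝ] EuclideanSpace ℝ (Fin (m + 1)) :=
  LinearEquiv.toContinuousLinearEquiv
  { toFun := fun p => WithLp.toLp 2 (Fin.snoc (α := fun _ => ℝ) p.1 p.2)
    invFun := fun x => (WithLp.toLp 2 fun i => x i.castSucc, x (Fin.last m))
    map_add' := fun p r => by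
      ext i
      refine Fin.lastCases ?_ (fun j => ?_) i <;> simp
    map_smul' := fun c p => by
      ext i
      refine Fin.lastCases ?_ (fun j => ?_) i <;> simp
    left_inv := fun p => by ext <;> simp
    right_inv := fun x => by
      ext i
      refine Fin.lastCases ?_ (fun j => ?_) i <;> simp }

@[simp] theorem snocL_castSucc {m : ℕ} (p : EuclideanSpace ℝ (Fin m) × ℝ) (i : Fin m) :
    snocL m p i.castSucc = p.1 i := by
  change Fin.snoc (α := fun _ => ℝ) p.1 p.2 i.castSucc = _
  simp

@[simp] theorem snocL_last {m : ℕ} (p : EuclideanSpace ℝ (Fin m) × ℝ) :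
    snocL m p (Fin.last m) = p.2 := by
  change Fin.snoc (α := fun _ => ℝ) p.1 p.2 (Fin.last m) = _
  simp

@[simp] theorem snocL_symm_snd {m : ℕ} (x : EuclideanSpace ℝ (Fin (m + 1))) :
    ((snocL m).symm x).2 = x (Fin.last m) := rfl

@[simp] theorem snocL_symm_fst {m : ℕ} (x : EuclideanSpace ℝ (Fin (m + 1))) (i : Fin m) :
    ((snocL m).symm x).1 i = x i.castSucc := rfl

theorem inner_snocL {m : ℕ} (p r : EuclideanSpace ℝ (Fin m) × ℝ) :
    inner ℝ (snocL m p) (snocL m r) = inner ℝ p.1 r.1 + p.2 * r.2 := by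
  simp [PiLp.inner_apply, Fin.sum_univ_castSucc, mul_comm]

theorem norm_snocL_sq {m : ℕ} (p : EuclideanSpace ℝ (Fin m) × ℝ) :
    ‖snocL m p‖ ^ 2 = ‖p.1‖ ^ 2 + p.2 ^ 2 := by
  rw [← real_inner_self_eq_norm_sq, inner_snocL, real_inner_self_eq_norm_sq]
  ring

theorem abs_last_le_norm {m : ℕ} (x : EuclideanSpace ℝ (Fin (m + 1))) :
    |x (Fin.last m)| ≤ ‖x‖ := by
  simpa using PiLp.norm_apply_le x (Fin.last m)

/-! ### The regularized norm -/

section RegNorm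

/-- The regularized norm `√(|v|² + δ²)`. -/
def regNorm {V : Type*} [NormedAddCommGroup V] (δ : ℝ) (v : V) : ℝ := √(‖v‖ ^ 2 + δ ^ 2)

theorem regNorm_sq {V : Type*} [NormedAddCommGroup V] (δ : ℝ) (v : V) :
    regNorm δ v ^ 2 = ‖v‖ ^ 2 + δ ^ 2 :=
  Real.sq_sqrt (by positivity)

theorem regNorm_pos {V : Type*} [NormedAddCommGroup V] {δ : ℝ} (hδ : 0 < δ) (v : V) :
    0 < regNorm δ v :=
  Real.sqrt_pos.mpr (by positivity)

variable {V : Type*} [NormedAddCommGroup V] [InnerProductSpace ℝ V]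

/-- The derivative of `v ↦ v / √(|v|² + δ²)`. -/
def unitDeriv (δ : ℝ) (v : V) : V →L[ℝ] V :=
  (regNorm δ v)⁻¹ • ContinuousLinearMap.id ℝ V -
    ((regNorm δ v ^ 3)⁻¹ • (innerSL ℝ v)).smulRight v

theorem contDiff_regNorm {δ : ℝ} (hδ : 0 < δ) : ContDiff ℝ ∞ (regNorm (V := V) δ) := by
  unfold regNorm
  refine ContDiff.sqrt ((contDiff_norm_sq ℝ).add contDiff_const) fun v => ?_
  positivity

theorem hasFDerivAt_regNorm {δ : ℝ} (hδ : 0 < δ) (v : V) :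
    HasFDerivAt (regNorm δ) ((regNorm δ v)⁻¹ • innerSL ℝ v) v := by
  have h := ((hasStrictFDerivAt_norm_sq v).hasFDerivAt.add_const (δ ^ 2)).sqrt
    (by positivity : ‖v‖ ^ 2 + δ ^ 2 ≠ 0)
  refine HasFDerivAt.congr_fderiv (f := regNorm δ) h ?_
  ext w
  simp [regNorm]
  ring

theorem hasFDerivAt_inv_regNorm_smul {δ : ℝ} (hδ : 0 < δ) (v : V) :
    HasFDerivAt (fun w : V => (regNorm δ w)⁻¹ • w) (unitDeriv δ v) v := by
  have hq := (regNorm_pos hδ v).ne'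
  have h := (((hasDerivAt_inv hq).comp_hasFDerivAt v (hasFDerivAt_regNorm hδ v)).smul
    (hasFDerivAt_id v))
  refine HasFDerivAt.congr_fderiv (f := fun w : V => (regNorm δ w)⁻¹ • w) h ?_
  ext w
  simp only [unitDeriv, sub_apply, add_apply, Function.comp_apply,
    ContinuousLinearMap.smulRight_apply, smul_apply, smul_eq_mul,
    ContinuousLinearMap.id_apply, innerSL_apply_apply, id]
  rw [sub_eq_add_neg, ← neg_smul]
  congr 2
  field_simp

theorem inner_unitDeriv (δ : ℝ) (v h w : V) : inner ℝ (unitDeriv δ v h) w =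
    (regNorm δ v)⁻¹ * inner ℝ h w - (regNorm δ v ^ 3)⁻¹ * inner ℝ v h * inner ℝ v w := by
  simp [unitDeriv, inner_sub_left, inner_smul_left]

/-- By Cauchy–Schwarz, q²|h|² - ⟨v,h⟩² ≥ δ²|h|² with q² = |v|²+δ². The regularization δ > 0 supplies
the convexity that the norm itself lacks in the radial direction. -/
theorem inner_unitDeriv_pos {δ : ℝ} (hδ : 0 < δ) (v : V) {h : V} (hh : h ≠ 0) :
    0 < inner ℝ (unitDeriv δ v h) h := by
  have hq := regNorm_pos hδ v
  have h1 : inner ℝ v h * inner ℝ v h ≤ (‖v‖ * ‖h‖) * (‖v‖ * ‖h‖) := by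
    have := abs_real_inner_le_norm v h
    nlinarith [abs_nonneg (inner ℝ v h : ℝ), abs_mul_abs_self (inner ℝ v h : ℝ)]
  have h2 : 0 < ‖h‖ := norm_pos_iff.mpr hh
  have h3 : inner ℝ (unitDeriv δ v h) h = (regNorm δ v ^ 3)⁻¹ *
      (regNorm δ v ^ 2 * ‖h‖ ^ 2 - inner ℝ v h * inner ℝ v h) := by
    rw [inner_unitDeriv, real_inner_self_eq_norm_sq]
    field_simp
  rw [h3, regNorm_sq]
  refine mul_pos (by positivity) ?_
  nlinarith [mul_pos (pow_pos hδ 2) (pow_pos h2 2)]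

end RegNorm

/-! ### The straight phase attached to the distance function -/

/-- The phase `√(|x' + (1 + xₙ) ξ|² + δ²) / (1 + xₙ)`. -/
def projPhase {m : ℕ} (δ : ℝ) (x : EuclideanSpace ℝ (Fin (m + 1)))
    (ξ : EuclideanSpace ℝ (Fin m)) : ℝ :=
  regNorm δ (((snocL m).symm x).1 + (1 + x (Fin.last m)) • ξ) / (1 + x (Fin.last m))

/-- The spatial gradient of `projPhase`. -/
def projGrad {m : ℕ} (δ : ℝ) (x : EuclideanSpace ℝ (Fin (m + 1)))
    (ξ : EuclideanSpace ℝ (Fin m)) : EuclideanSpace ℝ (Fin (m + 1)) :=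
  let s := 1 + x (Fin.last m)
  let v := ((snocL m).symm x).1 + s • ξ
  snocL m (s⁻¹ • (regNorm δ v)⁻¹ • v,
    s⁻¹ * inner ℝ ((regNorm δ v)⁻¹ • v) ξ - (s ^ 2)⁻¹ * regNorm δ v)

theorem one_add_last_pos {m : ℕ} {x : EuclideanSpace ℝ (Fin (m + 1))}
    (hx : x ∈ ball (0 : EuclideanSpace ℝ (Fin (m + 1))) 1) : 0 < 1 + x (Fin.last m) := by
  have h := abs_last_le_norm x
  rw [mem_ball_zero_iff] at hx
  have := (abs_lt.mp (h.trans_lt hx)).1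
  linarith

theorem contDiffOn_projPhase {m : ℕ} {δ : ℝ} (hδ : 0 < δ) :
    ContDiffOn ℝ ∞ (Function.uncurry (projPhase (m := m) δ))
      (ball 0 1 ×ˢ ball 0 1) := by
  unfold projPhase Function.uncurry
  have h1 : ContDiff ℝ ∞ fun z : EuclideanSpace ℝ (Fin (m + 1)) × EuclideanSpace ℝ (Fin m) =>
      1 + z.1 (Fin.last m) := by fun_prop
  have h2 : ContDiff ℝ ∞ fun z : EuclideanSpace ℝ (Fin (m + 1)) × EuclideanSpace ℝ (Fin m) =>
      ((snocL m).symm z.1).1 + (1 + z.1 (Fin.last m)) • z.2 :=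
    (contDiff_fst.comp ((snocL m).symm.contDiff.comp contDiff_fst)).add (h1.smul contDiff_snd)
  exact ((contDiff_regNorm hδ).comp h2).contDiffOn.div h1.contDiffOn
    fun z hz => (one_add_last_pos hz.1).ne'

theorem gradX_projPhase {m : ℕ} {δ : ℝ} (hδ : 0 < δ) {x : EuclideanSpace ℝ (Fin (m + 1))}
    (hx : 0 < 1 + x (Fin.last m)) (ξ : EuclideanSpace ℝ (Fin m)) :
    gradient (fun y => projPhase δ y ξ) x = projGrad δ x ξ := by
  apply HasGradientAt.gradient
  rw [hasGradientAt_iff_hasFDerivAt]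
  have hs : HasFDerivAt (fun y : EuclideanSpace ℝ (Fin (m + 1)) => 1 + y (Fin.last m))
      (EuclideanSpace.proj (𝕜 := ℝ) (Fin.last m : Fin (m + 1))) x :=
    (EuclideanSpace.proj (𝕜 := ℝ) (Fin.last m : Fin (m + 1))).hasFDerivAt.const_add 1
  have hy : HasFDerivAt (fun y : EuclideanSpace ℝ (Fin (m + 1)) => ((snocL m).symm y).1)
      ((ContinuousLinearMap.fst ℝ _ _).comp ((snocL m).symm :
        EuclideanSpace ℝ (Fin (m + 1)) →L[ℝ] EuclideanSpace ℝ (Fin m) × ℝ)) x :=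
    (snocL m).symm.hasFDerivAt.fst
  have hv := hy.add (hs.smul_const ξ)
  have h := ((hasFDerivAt_regNorm hδ _).comp x hv).mul
    ((hasDerivAt_inv hx.ne').comp_hasFDerivAt x hs)
  unfold projPhase
  simp only [div_eq_mul_inv]
  refine HasFDerivAt.congr_fderiv (f := fun y : EuclideanSpace ℝ (Fin (m + 1)) =>
    regNorm δ (((snocL m).symm y).1 + (1 + y (Fin.last m)) • ξ) * (1 + y (Fin.last m))⁻¹) h ?_
  ext w
  have hw : w = snocL m ((snocL m).symm w) := by simp
  have hq := (regNorm_pos hδ (((snocL m).symm x).1 + (1 + x (Fin.last m)) • ξ)).ne'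
  simp only [InnerProductSpace.toDual_apply_apply, projGrad]
  conv_rhs => rw [hw]
  rw [inner_snocL]
  simp only [Pi.add_apply, Function.comp_apply, add_apply, smul_apply,
    ContinuousLinearMap.comp_apply]
  generalize ((snocL m).symm x).1 + (1 + x (Fin.last m)) • ξ = v at *
  generalize 1 + x (Fin.last m) = s at *
  simp [inner_smul_left, inner_add_right, inner_smul_right]
  field_simp
  ring

/-- In the last coordinate the terms s⁻¹⟨v/q, h⟩ and -s⁻²·s⟨v, h⟩/q cancel. Hence every mixed
derivative has the form (u, ⟨u, ξ⟩), which is orthogonal to (-ξ, 1), a vector that does not involve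
x. This is the source of straightness. -/
theorem hasFDerivAt_projGrad {m : ℕ} {δ : ℝ} (hδ : 0 < δ) {x : EuclideanSpace ℝ (Fin (m + 1))}
    (hx : 0 < 1 + x (Fin.last m)) (ξ : EuclideanSpace ℝ (Fin m)) :
    ∃ L : EuclideanSpace ℝ (Fin m) →L[ℝ] EuclideanSpace ℝ (Fin (m + 1)),
      HasFDerivAt (fun η => projGrad δ x η) L ξ ∧ ∀ h, L h =
        snocL m (unitDeriv δ (((snocL m).symm x).1 + (1 + x (Fin.last m)) • ξ) h,
          inner ℝ (unitDeriv δ (((snocL m).symm x).1 + (1 + x (Fin.last m)) • ξ) h) ξ) := by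
  set s := 1 + x (Fin.last m) with hs
  have hv : HasFDerivAt (fun η : EuclideanSpace ℝ (Fin m) => ((snocL m).symm x).1 + s • η)
      (s • ContinuousLinearMap.id ℝ _) ξ := ((hasFDerivAt_id ξ).const_smul s).const_add _
  have h1 := (hasFDerivAt_inv_regNorm_smul hδ _).comp ξ hv
  have h2 := (hasFDerivAt_regNorm hδ _).comp ξ hv
  have h3 := (h1.inner ℝ (hasFDerivAt_id ξ)).const_mul s⁻¹
  have h4 := h3.sub (h2.const_mul (s ^ 2)⁻¹)
  have h5 := ((snocL m : (EuclideanSpace ℝ (Fin m) × ℝ) →L[ℝ]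
    EuclideanSpace ℝ (Fin (m + 1))).hasFDerivAt).comp ξ ((h1.const_smul s⁻¹).prodMk h4)
  refine ⟨_, h5, fun h => ?_⟩
  simp only [ContinuousLinearMap.comp_apply, ContinuousLinearEquiv.coe_coe]
  congr 1
  ext1
  · simp [smul_smul, hx.ne']
  · simp only [sub_apply, smul_apply, ContinuousLinearMap.comp_apply,
      ContinuousLinearMap.prod_apply, fderivInnerCLM_apply, Function.comp_apply, smul_eq_mul,
      ContinuousLinearMap.id_apply, innerSL_apply_apply, map_smul, inner_smul_left,
      id, RCLike.conj_to_real]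
    field_simp
    ring

/-- The matrix of `unitDeriv` at `x' + (1 + xₙ) ξ`. -/
def projCurv {m : ℕ} (δ : ℝ) (x : EuclideanSpace ℝ (Fin (m + 1)))
    (ξ : EuclideanSpace ℝ (Fin m)) : Matrix (Fin m) (Fin m) ℝ :=
  Matrix.of fun i j => inner ℝ
    (unitDeriv δ (((snocL m).symm x).1 + (1 + x (Fin.last m)) • ξ) (EuclideanSpace.single i 1))
    (EuclideanSpace.single j 1)

theorem inner_eq_projCurv_sum {m : ℕ} (δ : ℝ) (x : EuclideanSpace ℝ (Fin (m + 1)))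
    (ξ w : EuclideanSpace ℝ (Fin m)) (i : Fin m) : inner ℝ
    (unitDeriv δ (((snocL m).symm x).1 + (1 + x (Fin.last m)) • ξ) (EuclideanSpace.single i 1)) w
      = ∑ k, w k * projCurv δ x ξ i k := by
  simp [PiLp.inner_apply, projCurv]

theorem projCurv_posDef {m : ℕ} {δ : ℝ} (hδ : 0 < δ) (x : EuclideanSpace ℝ (Fin (m + 1)))
    (ξ : EuclideanSpace ℝ (Fin m)) : (projCurv δ x ξ).PosDef := by
  refine Matrix.PosDef.of_dotProduct_mulVec_pos ?_ fun w hw => ?_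
  · ext i j
    simp only [projCurv, Matrix.conjTranspose_apply, Matrix.of_apply, star_trivial,
      inner_unitDeriv, real_inner_comm (EuclideanSpace.single i (1 : ℝ))
        (EuclideanSpace.single j (1 : ℝ))]
    ring
  · have hw' : (WithLp.toLp 2 w : EuclideanSpace ℝ (Fin m)) ≠ 0 := by simpa using hw
    refine (inner_unitDeriv_pos hδ (((snocL m).symm x).1 + (1 + x (Fin.last m)) • ξ) hw').trans_eq
      ?_
    have h : (WithLp.toLp 2 w : EuclideanSpace ℝ (Fin m)) =
        ∑ i, w i • (EuclideanSpace.single i (1 : ℝ) : EuclideanSpace ℝ (Fin m)) := by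
      ext j
      simp [Pi.single_apply]
    have h2 : inner ℝ (unitDeriv δ (((snocL m).symm x).1 + (1 + x (Fin.last m)) • ξ)
        (WithLp.toLp 2 w : EuclideanSpace ℝ (Fin m))) (WithLp.toLp 2 w) = ∑ i, w i * inner ℝ
        (unitDeriv δ (((snocL m).symm x).1 + (1 + x (Fin.last m)) • ξ)
          (EuclideanSpace.single i 1)) (WithLp.toLp 2 w) := by
      conv_lhs => rw [h, map_sum, sum_inner, ← h]
      simp only [map_smul, inner_smul_left, RCLike.conj_to_real]
    rw [h2]
    simp only [inner_eq_projCurv_sum, dotProduct, Matrix.mulVec, star_trivial, mul_comm]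

/-! ### Rank, curvature, convexity and straightness of `projPhase` -/

section Conditions

variable {m : ℕ} {δ : ℝ}

theorem mixedHessian_projPhase (hδ : 0 < δ) {x : EuclideanSpace ℝ (Fin (m + 1))}
    (hx : x ∈ ball (0 : EuclideanSpace ℝ (Fin (m + 1))) 1) (ξ : EuclideanSpace ℝ (Fin m))
    (j : Fin m) (i : Fin (m + 1)) :
    mixedHessian (n := m + 1) (projPhase δ) x ξ j i =
      snocL m (WithLp.toLp 2 (projCurv δ x ξ j), ∑ k, ξ k * projCurv δ x ξ j k) i := by
  have hs := one_add_last_pos hx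
  obtain ⟨L, hL, hL'⟩ := hasFDerivAt_projGrad hδ hs ξ
  have h1 : (fun η : EuclideanSpace ℝ (Fin (m + 1 - 1)) => gradX (n := m + 1) (projPhase δ) x η) =
      fun η => projGrad δ x η := by
    funext η
    exact gradX_projPhase hδ hs η
  change (fderiv ℝ (fun η : EuclideanSpace ℝ (Fin (m + 1 - 1)) =>
    gradX (n := m + 1) (projPhase δ) x η) ξ (EuclideanSpace.single j 1)) i = _
  rw [h1]
  change (fderiv ℝ (fun η : EuclideanSpace ℝ (Fin m) => projGrad δ x η) ξ
    (EuclideanSpace.single j 1)) i = _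
  rw [hL.fderiv, hL', inner_eq_projCurv_sum]
  have h2 : unitDeriv δ (((snocL m).symm x).1 + (1 + x (Fin.last m)) • ξ)
      (EuclideanSpace.single j 1) = WithLp.toLp 2 (projCurv δ x ξ j) := by
    ext k
    simp [projCurv, PiLp.inner_apply]
  rw [h2]

/-- All rows of the mixed Hessian are orthogonal to c = (-ξ, 1). Replacing the last column of the
defining determinant by the combination of columns with coefficients c does not change its value,
since the last coefficient is 1. It makes that column zero except for its bottom entry cᵢ, and
expanding along it leaves the determinant of `projCurv`. -/
theorem gaussVector_projPhase (hδ : 0 < δ) {x : EuclideanSpace ℝ (Fin (m + 1))}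
    (hx : x ∈ ball (0 : EuclideanSpace ℝ (Fin (m + 1))) 1) (ξ : EuclideanSpace ℝ (Fin m)) :
    gaussVector (n := m + 1) (projPhase δ) x ξ = (projCurv δ x ξ).det • snocL m (-ξ, 1) := by
  ext i
  set c : Fin (m + 1) → ℝ := fun i => snocL m (-ξ, 1) i with hc
  change Matrix.det _ = (projCurv δ x ξ).det * c i
  set M : Matrix (Fin (m + 1)) (Fin (m + 1)) ℝ := Matrix.of fun r k : Fin (m + 1) =>
    if h : (r : ℕ) < m + 1 - 1 then mixedHessian (n := m + 1) (projPhase δ) x ξ ⟨r, h⟩ k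
      else if k = i then (1 : ℝ) else 0 with hM
  have hM1 : ∀ (r : Fin m) k, M r.castSucc k =
      snocL m (WithLp.toLp 2 (projCurv δ x ξ r), ∑ k, ξ k * projCurv δ x ξ r k) k := by
    intro r k
    rw [hM, Matrix.of_apply, dif_pos (by simp), ← mixedHessian_projPhase hδ hx]
    rfl
  have hM2 : ∀ k, M (Fin.last m) k = if k = i then 1 else 0 := by
    intro k
    rw [hM, Matrix.of_apply, dif_neg (by simp)]
  have h1 := Matrix.det_updateCol_sum M (Fin.last m) c
  have h2 : c (Fin.last m) = 1 := by simp [hc]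
  rw [h2, one_smul] at h1
  rw [← h1, Matrix.det_succ_column _ (Fin.last m), Fin.sum_univ_castSucc]
  have h3 : ∀ r : Fin m, (M.updateCol (Fin.last m) fun k => ∑ i, c i • M k i)
      r.castSucc (Fin.last m) = 0 := by
    intro r
    rw [Matrix.updateCol_self, Fin.sum_univ_castSucc]
    simp [hM1, hc]
  have h4 : (M.updateCol (Fin.last m) fun k => ∑ i, c i • M k i)
      (Fin.last m) (Fin.last m) = c i := by
    rw [Matrix.updateCol_self]
    simp [hM2]
  have h5 : (M.updateCol (Fin.last m) fun k => ∑ i, c i • M k i).submatrix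
      (Fin.last m).succAbove (Fin.last m).succAbove = projCurv δ x ξ := by
    ext r k
    rw [Matrix.submatrix_apply, Matrix.updateCol_ne (by simp), Fin.succAbove_last, hM1,
      snocL_castSucc]
  rw [h4, h5]
  simp only [h3]
  simp [← two_mul, mul_comm]

theorem gaussMap_projPhase (hδ : 0 < δ) {x : EuclideanSpace ℝ (Fin (m + 1))}
    (hx : x ∈ ball (0 : EuclideanSpace ℝ (Fin (m + 1))) 1) (ξ : EuclideanSpace ℝ (Fin m)) :
    gaussMap (n := m + 1) (projPhase δ) x ξ =
      ‖snocL m (-ξ, 1)‖⁻¹ • snocL m (-ξ, 1) := by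
  have hd := (projCurv_posDef hδ x ξ).det_pos
  rw [gaussMap, gaussVector_projPhase hδ hx, norm_smul, Real.norm_eq_abs, abs_of_pos hd, smul_smul,
    mul_inv, mul_right_comm, inv_mul_cancel₀ hd.ne', one_mul]

/-- Paired with the direction of (-ξ, 1), the first derivative in η is a multiple of ⟨D(η)eᵢ, η-ξ⟩,
where D(η) is the matrix of `unitDeriv`. The second factor vanishes at η = ξ, so only its derivative
survives there; of the first factor one needs differentiability but not the derivative. -/
theorem curvatureHessian_projPhase (hδ : 0 < δ) {x : EuclideanSpace ℝ (Fin (m + 1))}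
    (hx : x ∈ ball (0 : EuclideanSpace ℝ (Fin (m + 1))) 1) (ξ : EuclideanSpace ℝ (Fin m)) :
    curvatureHessian (n := m + 1) (projPhase δ) x ξ =
      (‖snocL m (-ξ, 1)‖⁻¹ • projCurv δ x ξ : Matrix (Fin m) (Fin m) ℝ) := by
  have hs := one_add_last_pos hx
  set g := ‖snocL m (-ξ, 1)‖⁻¹
  set V : EuclideanSpace ℝ (Fin m) → EuclideanSpace ℝ (Fin m) := fun η =>
    ((snocL m).symm x).1 + (1 + x (Fin.last m)) • η with hV
  have h1 : ∀ (i : Fin m) (η : EuclideanSpace ℝ (Fin m)),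
      fderiv ℝ (fun η : EuclideanSpace ℝ (Fin m) => inner ℝ (projGrad δ x η)
        (g • snocL m (-ξ, 1))) η (EuclideanSpace.single i 1) =
      g * inner ℝ (unitDeriv δ (V η) (EuclideanSpace.single i 1)) (η - ξ) := by
    intro i η
    obtain ⟨L, hL, hL'⟩ := hasFDerivAt_projGrad hδ hs η
    rw [(hL.inner ℝ (hasFDerivAt_const (g • snocL m (-ξ, 1)) η)).fderiv]
    simp [inner_smul_right, hL', inner_snocL, inner_sub_right, hV]
    left
    ring
  have hVd : ∀ η, HasFDerivAt V ((1 + x (Fin.last m)) • ContinuousLinearMap.id ℝ _) η :=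
    fun η => ((hasFDerivAt_id η).const_smul (1 + x (Fin.last m))).const_add
      ((snocL m).symm x).1
  ext i j
  have hreg : DifferentiableAt ℝ (fun η => (regNorm δ (V η))) ξ :=
    ((hasFDerivAt_regNorm hδ _).comp ξ (hVd ξ)).differentiableAt
  have hq := (regNorm_pos hδ (V ξ)).ne'
  have h2 : DifferentiableAt ℝ (fun η => unitDeriv δ (V η) (EuclideanSpace.single i (1 : ℝ))) ξ := by
    simp only [unitDeriv, sub_apply, ContinuousLinearMap.smulRight_apply, smul_apply,
      innerSL_apply_apply, ContinuousLinearMap.id_apply]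
    exact ((hreg.inv hq).smul_const _).sub ((((hreg.pow 3).inv (pow_ne_zero 3 hq)).smul
      ((hVd ξ).differentiableAt.inner ℝ (differentiableAt_const _))).smul (hVd ξ).differentiableAt)
  have h3 := ((h2.hasFDerivAt.inner ℝ ((hasFDerivAt_id ξ).sub_const ξ)).const_mul g)
  have h4 : (fun η : EuclideanSpace ℝ (Fin (m + 1 - 1)) =>
      inner ℝ (gradX (n := m + 1) (projPhase δ) x η) (gaussMap (n := m + 1) (projPhase δ) x ξ)) =
      fun η : EuclideanSpace ℝ (Fin m) => inner ℝ (projGrad δ x η) (g • snocL m (-ξ, 1)) := by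
    funext η
    rw [gaussMap_projPhase hδ hx]
    congr 1
    exact gradX_projPhase hδ hs η
  change fderiv ℝ (fun ζ : EuclideanSpace ℝ (Fin (m + 1 - 1)) => fderiv ℝ
    (fun η : EuclideanSpace ℝ (Fin (m + 1 - 1)) => inner ℝ (gradX (n := m + 1) (projPhase δ) x η)
      (gaussMap (n := m + 1) (projPhase δ) x ξ)) ζ (EuclideanSpace.single i 1)) ξ
      (EuclideanSpace.single j 1) = g * projCurv δ x ξ i j
  rw [h4]
  change fderiv ℝ (fun ζ : EuclideanSpace ℝ (Fin m) => fderiv ℝ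
    (fun η : EuclideanSpace ℝ (Fin m) => inner ℝ (projGrad δ x η)
      (g • snocL m (-ξ, 1))) ζ (EuclideanSpace.single i 1)) ξ
      (EuclideanSpace.single j 1) = g * projCurv δ x ξ i j
  rw [funext (h1 i)]
  have h5 : HasFDerivAt (fun η => g * inner ℝ (unitDeriv δ (V η)
    (EuclideanSpace.single i (1 : ℝ))) (η - ξ)) _ ξ := h3
  rw [h5.fderiv]
  simp [projCurv, hV,]

/-- The first m columns already form the invertible matrix `projCurv`; they are selected by
multiplying on the right with a coordinate inclusion. -/
theorem rank_mixedHessian_projPhase (hδ : 0 < δ) {x : EuclideanSpace ℝ (Fin (m + 1))}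
    (hx : x ∈ ball (0 : EuclideanSpace ℝ (Fin (m + 1))) 1) (ξ : EuclideanSpace ℝ (Fin m)) :
    (mixedHessian (n := m + 1) (projPhase δ) x ξ).rank = m := by
  apply le_antisymm
  · exact (Matrix.rank_le_height _)
  · have h1 : ((mixedHessian (n := m + 1) (projPhase δ) x ξ : Matrix (Fin m) (Fin (m + 1)) ℝ) *
        (Matrix.of fun i j => if i = j.castSucc then 1 else 0 : Matrix (Fin (m + 1)) (Fin m) ℝ)) =
        projCurv δ x ξ := by
      ext j k
      rw [Matrix.mul_apply]
      simp [mixedHessian_projPhase hδ hx]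
    have h2 : (projCurv δ x ξ).rank = m := by
      rw [Matrix.rank_of_isUnit _ (projCurv_posDef hδ x ξ).isUnit, Fintype.card_fin]
    calc m = (projCurv δ x ξ).rank := h2.symm
      _ ≤ _ := by
        rw [← h1]
        exact Matrix.rank_mul_le_left _ _

/-- The phase `projPhase` satisfies all the hypotheses on phases. -/
theorem projPhase_conditions (hδ : 0 < δ)
    {a : EuclideanSpace ℝ (Fin (m + 1)) → EuclideanSpace ℝ (Fin (m + 1 - 1)) → ℝ}
    (ha : IsAmplitude (n := m + 1) a) :
    CarlesonSjolin (n := m + 1) (projPhase δ) a ∧ ConvexCondition (n := m + 1) (projPhase δ) a ∧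
      StraightCondition (n := m + 1) (projPhase δ) := by
  have hpos : ConvexCondition (n := m + 1) (projPhase δ) a := by
    intro x ξ hx
    have hx' := (ha.support hx).1
    rw [curvatureHessian_projPhase hδ hx']
    refine (projCurv_posDef hδ x ξ).smul (inv_pos.mpr (norm_pos_iff.mpr fun h => ?_))
    have := congrArg (fun y : EuclideanSpace ℝ (Fin (m + 1)) => y (Fin.last m)) h
    simp at this
  refine ⟨⟨contDiffOn_projPhase hδ, fun x ξ hx => rank_mixedHessian_projPhase hδ hx.1 ξ,
    fun x ξ hx => (hpos x ξ hx).det_pos.ne'⟩, hpos, fun x y ξ hx hy => ?_⟩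
  rw [gaussMap_projPhase hδ hx.1, gaussMap_projPhase hδ hy.1]

end Conditions

/-! ### The Fourier transform of `e^{-β|x|}` -/

/-- The Cauchy–Schlömilch substitution. -/
theorem integral_exp_neg_sq_sub_div {a r : ℝ} (ha : 0 < a) (hr : 0 < r) :
    IntegrableOn (fun x : ℝ => Real.exp (-(a * x - r / x) ^ 2)) (Set.Ioi 0) ∧
    ∫ x in Set.Ioi (0 : ℝ), Real.exp (-(a * x - r / x) ^ 2) = √Real.pi / (2 * a) := by
  have hd : ∀ x ∈ Set.Ioi (0 : ℝ), HasDerivWithinAt (fun x => a * x - r / x) (a + r / x ^ 2)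
      (Set.Ioi 0) x := by
    intro x hx
    have hx' : x ≠ 0 := (Set.mem_Ioi.mp hx).ne'
    have h := ((hasDerivAt_id x).const_mul a).sub ((hasDerivAt_inv hx').const_mul r)
    have he : (fun x : ℝ => a * x - r / x) = (fun y => a * id y) - fun y => r * y⁻¹ := by
      funext y
      simp [div_eq_mul_inv]
    rw [he]
    refine (h.congr_deriv ?_).hasDerivWithinAt
    field_simp
    ring
  have hmono : StrictMonoOn (fun x => a * x - r / x) (Set.Ioi 0) := by
    intro x hx y hy hxy
    have h1 : r / y < r / x := div_lt_div_of_pos_left hr hx hxy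
    have h2 : a * x < a * y := mul_lt_mul_of_pos_left hxy ha
    change a * x - r / x < a * y - r / y
    linarith
  have himg : (fun x => a * x - r / x) '' Set.Ioi 0 = Set.univ := by
    refine Set.eq_univ_of_forall fun y => ?_
    have hD : 0 < y ^ 2 + 4 * a * r := by positivity
    have h1 : √(y ^ 2 + 4 * a * r) ^ 2 = y ^ 2 + 4 * a * r := Real.sq_sqrt hD.le
    have h2 : |y| < √(y ^ 2 + 4 * a * r) := by
      apply Real.lt_sqrt_of_sq_lt
      rw [sq_abs]
      have := mul_pos ha hr
      linarith
    have h3 : 0 < y + √(y ^ 2 + 4 * a * r) := by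
      have := neg_abs_le y
      linarith
    generalize √(y ^ 2 + 4 * a * r) = S at h1 h2 h3
    -- The positive root of ax² - yx - r = 0.
    refine ⟨(y + S) / (2 * a), Set.mem_Ioi.mpr (by positivity), ?_⟩
    change a * ((y + S) / (2 * a)) - r / ((y + S) / (2 * a)) = y
    field_simp
    nlinarith
  have h1 := integral_image_eq_integral_abs_deriv_smul measurableSet_Ioi hd hmono.injOn
    (fun y => Real.exp (-y ^ 2))
  have h2 := (integrableOn_image_iff_integrableOn_abs_deriv_smul measurableSet_Ioi hd hmono.injOn
    (fun y => Real.exp (-y ^ 2)))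
  have hg := integral_gaussian 1
  have hgi := integrable_exp_neg_mul_sq one_pos
  simp only [neg_mul, one_mul, div_one] at hg hgi
  rw [himg, setIntegral_univ, hg] at h1
  rw [himg, integrableOn_univ] at h2
  have h3 := h2.mp hgi
  have habs : ∀ x ∈ Set.Ioi (0 : ℝ), |a + r / x ^ 2| = a + r / x ^ 2 := by
    intro x hx
    have : (0 : ℝ) < x := hx
    exact abs_of_pos (by positivity)
  have hint : IntegrableOn (fun x : ℝ => Real.exp (-(a * x - r / x) ^ 2)) (Set.Ioi 0) := by
    refine Integrable.mono' (h3.const_mul a⁻¹) (by fun_prop) ?_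
    filter_upwards [ae_restrict_mem measurableSet_Ioi] with x hx
    rw [habs x hx, smul_eq_mul, Real.norm_eq_abs, Real.abs_exp, ← mul_assoc]
    have hx0 : (0 : ℝ) < x := hx
    have : 1 ≤ a⁻¹ * (a + r / x ^ 2) := by
      rw [mul_add, inv_mul_cancel₀ ha.ne']
      have : 0 < a⁻¹ * (r / x ^ 2) := by positivity
      linarith
    exact le_mul_of_one_le_left (Real.exp_pos _).le this
  refine ⟨hint, ?_⟩
  -- the involution `x ↦ r / (a x)`
  have hd' : ∀ x ∈ Set.Ioi (0 : ℝ), HasDerivWithinAt (fun x => r / (a * x)) (-(r / (a * x ^ 2)))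
      (Set.Ioi 0) x := by
    intro x hx
    have hx' : x ≠ 0 := (Set.mem_Ioi.mp hx).ne'
    have h := (hasDerivAt_inv hx').const_mul (r / a)
    have he : (fun x : ℝ => r / (a * x)) = fun x => r / a * x⁻¹ := by
      funext y
      rw [div_mul_eq_div_div, div_eq_mul_inv (r / a)]
    rw [he]
    refine (h.congr_deriv ?_).hasDerivWithinAt
    field_simp
  have hinj : Set.InjOn (fun x => r / (a * x)) (Set.Ioi 0) := by
    intro x hx y hy hxy
    have hx' : (0 : ℝ) < x := hx
    have hy' : (0 : ℝ) < y := hy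
    change r / (a * x) = r / (a * y) at hxy
    field_simp at hxy
    exact hxy.symm
  have himg' : (fun x => r / (a * x)) '' Set.Ioi 0 = Set.Ioi 0 := by
    ext y
    constructor
    · rintro ⟨x, hx, rfl⟩
      have hx' : (0 : ℝ) < x := hx
      exact Set.mem_Ioi.mpr (by positivity)
    · intro hy
      have hy' : (0 : ℝ) < y := hy
      refine ⟨r / (a * y), Set.mem_Ioi.mpr (by positivity), ?_⟩
      change r / (a * (r / (a * y))) = y
      field_simp
  have h4 := integral_image_eq_integral_abs_deriv_smul measurableSet_Ioi hd' hinj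
    (fun x => Real.exp (-(a * x - r / x) ^ 2))
  rw [himg'] at h4
  -- Since r/(ax²) = a⁻¹(a + r/x²) - 1 and the involution preserves (ax - r/x)², the integral I
  -- satisfies I = √π/a - I.
  have h5 : ∫ x in Set.Ioi (0 : ℝ), |-(r / (a * x ^ 2))| •
      Real.exp (-(a * (r / (a * x)) - r / (r / (a * x))) ^ 2) =
      ∫ x in Set.Ioi (0 : ℝ), a⁻¹ * (|a + r / x ^ 2| • Real.exp (-(a * x - r / x) ^ 2)) -
        Real.exp (-(a * x - r / x) ^ 2) := by
    refine setIntegral_congr_fun measurableSet_Ioi fun x hx => ?_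
    have hx' : (0 : ℝ) < x := hx
    have e1 : (a * (r / (a * x)) - r / (r / (a * x))) ^ 2 = (a * x - r / x) ^ 2 := by
      field_simp
      ring
    simp only [habs x hx, e1, abs_neg, smul_eq_mul]
    rw [abs_of_pos (by positivity)]
    field_simp
    ring
  rw [h5, integral_sub (h3.const_mul _) hint, integral_const_mul, ← h1] at h4
  field_simp at h4 ⊢
  linarith

/-- The subordination identity. -/
theorem integral_exp_subordination {b r : ℝ} (hb : 0 < b) (hr : 0 < r) :
    ∫ u in Set.Ioi (0 : ℝ), Real.exp (-(b ^ 2 / 4 * u ^ 2)) * Real.exp (-((u ^ 2)⁻¹ * r ^ 2)) =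
      √Real.pi / b * Real.exp (-(b * r)) := by
  have h := (integral_exp_neg_sq_sub_div (half_pos hb) hr).2
  -- Completing the square: b²u²/4 + r²/u² = (bu/2 - r/u)² + br.
  have h1 : ∫ u in Set.Ioi (0 : ℝ), Real.exp (-(b ^ 2 / 4 * u ^ 2)) *
      Real.exp (-((u ^ 2)⁻¹ * r ^ 2)) = ∫ u in Set.Ioi (0 : ℝ), Real.exp (-(b * r)) *
        Real.exp (-(b / 2 * u - r / u) ^ 2) := by
    refine setIntegral_congr_fun measurableSet_Ioi fun u hu => ?_
    have hu' : (0 : ℝ) < u := hu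
    simp only [← Real.exp_add]
    congr 1
    field_simp
    ring
  rw [h1, integral_const_mul, h]
  field_simp

variable {n : ℕ}

/-- Subordination writes e^{-b|x|} as an integral of Gaussians. Each Gaussian has an explicit
transform, and the remaining integral in u is a Gamma integral. -/
theorem fourier_exp_neg_mul_norm_real (hn : 1 ≤ n) {b : ℝ} (hb : 0 < b)
    (ξ : EuclideanSpace ℝ (Fin n)) :
    FourierTransform.fourier (fun x : EuclideanSpace ℝ (Fin n) => Complex.exp (-(b : ℂ) * ‖x‖)) ξ =
      ((b / √Real.pi * Real.pi ^ ((n : ℝ) / 2) * (2⁻¹ * Real.Gamma (((n : ℝ) + 1) / 2)) *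
        (b ^ 2 / 4 + Real.pi ^ 2 * ‖ξ‖ ^ 2) ^ (-((n : ℝ) + 1) / 2) : ℝ) : ℂ) := by
  have : Nonempty (Fin n) := ⟨⟨0, hn⟩⟩
  set F : EuclideanSpace ℝ (Fin n) → ℝ → ℂ := fun x u =>
    Complex.exp (((-2 * Real.pi * inner ℝ x ξ : ℝ) : ℂ) * Complex.I) *
      ((Real.exp (-(b ^ 2 / 4 * u ^ 2)) * Real.exp (-((u ^ 2)⁻¹ * ‖x‖ ^ 2)) : ℝ) : ℂ) with hF
  have hFm : Measurable (Function.uncurry F) := by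
    rw [hF]
    unfold Function.uncurry
    fun_prop
  have hFn : ∀ x u, ‖F x u‖ = Real.exp (-(b ^ 2 / 4 * u ^ 2)) *
      Real.exp (-((u ^ 2)⁻¹ * ‖x‖ ^ 2)) := by
    intro x u
    rw [hF]
    simp only [norm_mul, Complex.norm_exp_ofReal_mul_I, one_mul, Complex.norm_real]
    rw [Real.norm_of_nonneg (by positivity), Real.norm_of_nonneg (by positivity)]
  have hD : 0 < b ^ 2 / 4 + Real.pi ^ 2 * ‖ξ‖ ^ 2 := by positivity
  have hpow : ∀ u : ℝ, 0 < u → (Real.pi / (u ^ 2)⁻¹) ^ ((n : ℝ) / 2) =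
      Real.pi ^ ((n : ℝ) / 2) * u ^ (n : ℝ) := by
    intro u hu
    rw [div_inv_eq_mul, Real.mul_rpow Real.pi_pos.le (by positivity), ← Real.rpow_natCast u 2,
      ← Real.rpow_mul hu.le]
    congr 2
    push_cast
    ring
  have hFint : Integrable (Function.uncurry F)
      ((volume : Measure (EuclideanSpace ℝ (Fin n))).prod (volume.restrict (Set.Ioi 0))) := by
    rw [integrable_prod_iff' hFm.aestronglyMeasurable]
    constructor
    · filter_upwards [ae_restrict_mem measurableSet_Ioi] with u hu
      have hu' : (0 : ℝ) < u := hu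
      have hi := GaussianFourier.integrable_cexp_neg_mul_sq_norm_add
        (b := (((u ^ 2)⁻¹ : ℝ) : ℂ)) (V := EuclideanSpace ℝ (Fin n))
        (by rw [Complex.ofReal_re]; positivity) 0 0
      refine Integrable.mono' (hi.norm.const_mul (Real.exp (-(b ^ 2 / 4 * u ^ 2))))
        (hFm.comp (measurable_id.prodMk measurable_const)).aestronglyMeasurable ?_
      refine Filter.Eventually.of_forall fun x => ?_
      simp only [Function.uncurry, hFn]
      rw [Complex.norm_exp]
      simp only [zero_mul, add_zero]
      rw [← Complex.ofReal_pow, ← Complex.ofReal_neg, ← Complex.ofReal_mul, Complex.ofReal_re,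
        neg_mul]
    · have hi := (integrable_rpow_mul_exp_neg_mul_sq (b := b ^ 2 / 4) (by positivity)
        (s := n) (by have : (0 : ℝ) ≤ n := n.cast_nonneg
                     linarith)).integrableOn (s := Set.Ioi 0)
      refine Integrable.congr (hi.const_mul (Real.pi ^ ((n : ℝ) / 2))) ?_
      filter_upwards [ae_restrict_mem measurableSet_Ioi] with u hu
      have hu' : (0 : ℝ) < u := hu
      simp only [Function.uncurry, hFn]
      rw [integral_const_mul]
      have := GaussianFourier.integral_rexp_neg_mul_sq_norm (V := EuclideanSpace ℝ (Fin n))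
        (b := (u ^ 2)⁻¹) (by positivity)
      simp only [neg_mul, finrank_euclideanSpace, Fintype.card_fin] at this
      rw [this, hpow u hu']
      ring_nf
  have h1 : FourierTransform.fourier
      (fun x : EuclideanSpace ℝ (Fin n) => Complex.exp (-(b : ℂ) * ‖x‖)) ξ =
      ((b / √Real.pi : ℝ) : ℂ) * ∫ x, ∫ u in Set.Ioi (0 : ℝ), F x u := by
    rw [Real.fourier_eq', ← integral_const_mul]
    refine integral_congr_ae ?_
    filter_upwards [compl_mem_ae_iff.mpr (measure_singleton (0 : EuclideanSpace ℝ (Fin n)))]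
      with x hx
    have hx' : 0 < ‖x‖ := norm_pos_iff.mpr hx
    rw [hF]
    simp only
    rw [integral_const_mul, integral_complex_ofReal, integral_exp_subordination hb hx', smul_eq_mul]
    push_cast
    rw [neg_mul]
    have hb' : (b : ℂ) ≠ 0 := by exact_mod_cast hb.ne'
    have hpi : ((√Real.pi : ℝ) : ℂ) ≠ 0 := by
      exact_mod_cast (Real.sqrt_pos.mpr Real.pi_pos).ne'
    field_simp
  rw [h1, integral_integral_swap hFint]
  have h2 : ∫ u in Set.Ioi (0 : ℝ), ∫ x, F x u = ∫ u in Set.Ioi (0 : ℝ),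
      ((Real.pi ^ ((n : ℝ) / 2) * (u ^ (n : ℝ) *
        Real.exp (-(b ^ 2 / 4 + Real.pi ^ 2 * ‖ξ‖ ^ 2) * u ^ (2 : ℝ))) : ℝ) : ℂ) := by
    refine setIntegral_congr_fun measurableSet_Ioi fun u hu => ?_
    have hu' : (0 : ℝ) < u := hu
    have hg := fourier_gaussian_innerProductSpace (V := EuclideanSpace ℝ (Fin n))
      (b := (((u ^ 2)⁻¹ : ℝ) : ℂ)) (by rw [Complex.ofReal_re]; positivity) ξ
    rw [Real.fourier_eq'] at hg
    have e1 : ∫ x, F x u = ((Real.exp (-(b ^ 2 / 4 * u ^ 2)) : ℝ) : ℂ) *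
        ∫ v : EuclideanSpace ℝ (Fin n), Complex.exp (((-2 * Real.pi * inner ℝ v ξ : ℝ) : ℂ) *
          Complex.I) • Complex.exp (-(((u ^ 2)⁻¹ : ℝ) : ℂ) * (‖v‖ : ℂ) ^ 2) := by
      rw [← integral_const_mul]
      refine integral_congr_ae (Filter.Eventually.of_forall fun x => ?_)
      simp only [hF, smul_eq_mul]
      push_cast
      rw [neg_mul]
      ring_nf
    change ∫ x, F x u = _
    rw [e1, hg]
    have e2 : ((Real.pi : ℂ) / (((u ^ 2)⁻¹ : ℝ) : ℂ)) ^
        ((Module.finrank ℝ (EuclideanSpace ℝ (Fin n)) : ℂ) / 2) =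
        ((Real.pi ^ ((n : ℝ) / 2) * u ^ (n : ℝ) : ℝ) : ℂ) := by
      rw [← hpow u hu', Complex.ofReal_cpow (by positivity)]
      simp
    rw [e2]
    have e3 : Complex.exp (-(Real.pi : ℂ) ^ 2 * (‖ξ‖ : ℂ) ^ 2 / (((u ^ 2)⁻¹ : ℝ) : ℂ)) =
        ((Real.exp (-(Real.pi ^ 2 * ‖ξ‖ ^ 2 * u ^ 2)) : ℝ) : ℂ) := by
      push_cast
      congr 1
      field_simp
    rw [e3, ← Complex.ofReal_mul, ← Complex.ofReal_mul]
    congr 1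
    have e4 : Real.exp (-(b ^ 2 / 4 + Real.pi ^ 2 * ‖ξ‖ ^ 2) * u ^ (2 : ℝ)) =
        Real.exp (-(b ^ 2 / 4 * u ^ 2)) * Real.exp (-(Real.pi ^ 2 * ‖ξ‖ ^ 2 * u ^ 2)) := by
      rw [← Real.exp_add]
      congr 1
      rw [Real.rpow_two]
      ring
    rw [e4]
    ring
  rw [h2, integral_complex_ofReal, integral_const_mul, integral_rpow_mul_exp_neg_mul_rpow two_pos
    (by have : (0 : ℝ) ≤ n := n.cast_nonneg
        linarith) hD, ← Complex.ofReal_mul]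
  congr 1
  have e5 : -((n : ℝ) + 1) / 2 = -(n + 1) / 2 := rfl
  rw [e5]
  ring

/-! ### Complex β by analytic continuation -/

variable {n : ℕ}

theorem integrable_exp_neg_mul_norm (hn : 1 ≤ n) {b : ℝ} (hb : 0 < b) :
    Integrable (fun x : EuclideanSpace ℝ (Fin n) => Real.exp (-(b * ‖x‖))) := by
  have : Nonempty (Fin n) := ⟨⟨0, hn⟩⟩
  rw [integrable_fun_norm_addHaar volume (f := fun r => Real.exp (-(b * r)))]
  have h := integrableOn_rpow_mul_exp_neg_mul_rpow (p := 1) (s := ((n - 1 : ℕ) : ℝ)) (b := b)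
    (by have : (0 : ℝ) ≤ ((n - 1 : ℕ) : ℝ) := Nat.cast_nonneg _
        linarith) one_pos hb
  refine h.congr_fun (fun x _ => ?_) measurableSet_Ioi
  simp [finrank_euclideanSpace]

theorem norm_cexp_neg_mul_norm (β : ℂ) (x : EuclideanSpace ℝ (Fin n)) :
    ‖Complex.exp (-β * ‖x‖)‖ = Real.exp (-(β.re * ‖x‖)) := by
  rw [Complex.norm_exp]
  simp

theorem measurable_cexp_neg_mul_norm (β : ℂ) :
    Measurable fun x : EuclideanSpace ℝ (Fin n) => Complex.exp (-β * ‖x‖) := by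
  fun_prop

theorem integrable_cexp_neg_mul_norm (hn : 1 ≤ n) {β : ℂ} (hβ : 0 < β.re) :
    Integrable (fun x : EuclideanSpace ℝ (Fin n) => Complex.exp (-β * ‖x‖)) := by
  refine (integrable_exp_neg_mul_norm hn hβ).mono'
    (measurable_cexp_neg_mul_norm β).aestronglyMeasurable (Filter.Eventually.of_forall fun x => ?_)
  rw [norm_cexp_neg_mul_norm]

/-- This keeps the principal power of β² + 4π²|ξ|² holomorphic in β on the right half-plane: the
number is positive for real β, and otherwise its imaginary part 2 Re β Im β is nonzero. -/
theorem sq_add_mem_slitPlane {β : ℂ} (hβ : 0 < β.re) {t : ℝ} (ht : 0 ≤ t) :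
    β ^ 2 + (t : ℂ) ∈ Complex.slitPlane := by
  rw [Complex.mem_slitPlane_iff]
  by_cases him : β.im = 0
  · left
    simp only [pow_two, Complex.add_re, Complex.mul_re, Complex.ofReal_re, him]
    nlinarith
  · right
    simp only [pow_two, Complex.add_im, Complex.mul_im, Complex.ofReal_im]
    have : β.re * β.im ≠ 0 := mul_ne_zero hβ.ne' him
    intro h
    apply this
    linarith

theorem differentiableOn_fourier_exp_neg_mul_norm (hn : 1 ≤ n) (ξ : EuclideanSpace ℝ (Fin n)) :
    DifferentiableOn ℂ (fun β : ℂ => FourierTransform.fourier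
      (fun x : EuclideanSpace ℝ (Fin n) => Complex.exp (-β * ‖x‖)) ξ) {β | 0 < β.re} := by
  intro β₀ hβ₀
  have hβ₀' : 0 < β₀.re := hβ₀
  apply DifferentiableAt.differentiableWithinAt
  simp only [Real.fourier_eq']
  set e : EuclideanSpace ℝ (Fin n) → ℂ := fun x =>
    Complex.exp (((-2 * Real.pi * inner ℝ x ξ : ℝ) : ℂ) * Complex.I) with he
  have hem : Measurable e := by
    rw [he]
    fun_prop
  have hen : ∀ x, ‖e x‖ = 1 := fun x => Complex.norm_exp_ofReal_mul_I _
  have hball : ∀ β ∈ ball β₀ (β₀.re / 2), β₀.re / 2 ≤ β.re := by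
    intro β hβ
    have h1 := (Complex.abs_re_le_norm (β - β₀)).trans (mem_ball_iff_norm.mp hβ).le
    rw [Complex.sub_re] at h1
    have := (abs_le.mp h1).1
    linarith
  -- On the ball Re β ≥ Re β₀/2. Half of the resulting decay absorbs the factor |x| from
  -- differentiation, at the price 4/Re β₀; the other half is integrable.
  have key := hasDerivAt_integral_of_dominated_loc_of_deriv_le (μ := volume) (𝕜 := ℂ)
    (F := fun β x => e x • Complex.exp (-β * ‖x‖))
    (F' := fun β x => e x • (Complex.exp (-β * ‖x‖) * -‖x‖)) (x₀ := β₀)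
    (s := ball β₀ (β₀.re / 2))
    (bound := fun x => (4 / β₀.re) * Real.exp (-(β₀.re / 4 * ‖x‖)))
    (ball_mem_nhds _ (half_pos hβ₀'))
    (Filter.Eventually.of_forall fun β =>
      (hem.smul (measurable_cexp_neg_mul_norm β)).aestronglyMeasurable)
    ?_ ?_ ?_ ?_ ?_
  · exact key.2.differentiableAt
  · refine (integrable_exp_neg_mul_norm hn hβ₀').mono'
      (hem.smul (measurable_cexp_neg_mul_norm β₀)).aestronglyMeasurable
      (Filter.Eventually.of_forall fun x => ?_)
    rw [norm_smul, hen, one_mul, norm_cexp_neg_mul_norm]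
  · refine (hem.smul (Measurable.mul (measurable_cexp_neg_mul_norm β₀) ?_)).aestronglyMeasurable
    fun_prop
  · refine Filter.Eventually.of_forall fun x β hβ => ?_
    rw [norm_smul, hen, one_mul, norm_mul, norm_cexp_neg_mul_norm, norm_neg, Complex.norm_real,
      norm_norm]
    have h1 := hball β hβ
    have h2 : Real.exp (-(β.re * ‖x‖)) ≤ Real.exp (-(β₀.re / 4 * ‖x‖)) *
        Real.exp (-(β₀.re / 4 * ‖x‖)) := by
      rw [← Real.exp_add]
      apply Real.exp_le_exp.mpr
      nlinarith [mul_le_mul_of_nonneg_right h1 (norm_nonneg x)]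
    have h3 : Real.exp (-(β₀.re / 4 * ‖x‖)) * ‖x‖ ≤ 4 / β₀.re := by
      have h4 : β₀.re / 4 * ‖x‖ ≤ Real.exp (β₀.re / 4 * ‖x‖) := by
        have := Real.add_one_le_exp (β₀.re / 4 * ‖x‖)
        linarith
      rw [Real.exp_neg, inv_mul_le_iff₀ (Real.exp_pos _), mul_div_assoc', le_div_iff₀ hβ₀']
      linarith
    calc _ ≤ Real.exp (-(β₀.re / 4 * ‖x‖)) * Real.exp (-(β₀.re / 4 * ‖x‖)) * ‖x‖ := by gcongr
      _ = (Real.exp (-(β₀.re / 4 * ‖x‖)) * ‖x‖) * Real.exp (-(β₀.re / 4 * ‖x‖)) := by ring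
      _ ≤ _ := by gcongr
  · exact (integrable_exp_neg_mul_norm hn (by positivity)).const_mul _
  · refine Filter.Eventually.of_forall fun x β hβ => ?_
    refine HasDerivAt.const_smul (e x) ?_
    have h := ((hasDerivAt_id β).neg.mul_const (‖x‖ : ℂ)).cexp
    simpa using h

/-- The Fourier transform of `e^{-β|x|}` for complex `β` with positive real part. -/
theorem exists_fourier_exp_neg_mul_norm (hn : 1 ≤ n) : ∃ c : ℂ, c ≠ 0 ∧ ∀ β : ℂ, 0 < β.re →
    ∀ ξ : EuclideanSpace ℝ (Fin n), FourierTransform.fourier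
      (fun x : EuclideanSpace ℝ (Fin n) => Complex.exp (-β * ‖x‖)) ξ =
      c * (β * (β ^ 2 + ((4 * Real.pi ^ 2 * ‖ξ‖ ^ 2 : ℝ) : ℂ)) ^ (-(((n : ℂ) + 1) / 2))) := by
  have hn0 : (0 : ℝ) ≤ n := n.cast_nonneg
  set c : ℝ := (√Real.pi)⁻¹ * Real.pi ^ ((n : ℝ) / 2) * (2⁻¹ * Real.Gamma (((n : ℝ) + 1) / 2)) *
    4 ^ (((n : ℝ) + 1) / 2) with hc
  have hc0 : c ≠ 0 := by
    have := Real.Gamma_pos_of_pos (by positivity : 0 < ((n : ℝ) + 1) / 2)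
    have := Real.pi_pos
    positivity
  refine ⟨(c : ℂ), by exact_mod_cast hc0, fun β hβ ξ => ?_⟩
  have hopen : IsOpen {β : ℂ | 0 < β.re} := isOpen_lt continuous_const Complex.continuous_re
  have hf := (differentiableOn_fourier_exp_neg_mul_norm hn ξ).analyticOnNhd hopen
  have hg : AnalyticOnNhd ℂ (fun β : ℂ => (c : ℂ) * (β * (β ^ 2 +
      ((4 * Real.pi ^ 2 * ‖ξ‖ ^ 2 : ℝ) : ℂ)) ^ (-(((n : ℂ) + 1) / 2)))) {β | 0 < β.re} := by
    refine DifferentiableOn.analyticOnNhd (fun w hw => ?_) hopen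
    have hw' : 0 < w.re := hw
    refine DifferentiableAt.differentiableWithinAt ?_
    refine DifferentiableAt.const_mul (DifferentiableAt.mul differentiableAt_id ?_) _
    exact DifferentiableAt.cpow_const (by fun_prop)
      (sq_add_mem_slitPlane hw' (by positivity))
  -- Identity theorem: both sides are analytic in β on the right half-plane, and they agree for real
  -- β near 1.
  refine hf.eqOn_of_preconnected_of_frequently_eq hg
    (convex_halfSpace_re_gt 0).isPreconnected (z₀ := 1) (by simp) ?_ hβ
  have ht : Filter.Tendsto (fun t : ℝ => (t : ℂ)) (nhdsWithin 1 {1}ᶜ) (nhdsWithin 1 {1}ᶜ) := by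
    refine tendsto_nhdsWithin_of_tendsto_nhds_of_eventually_within _ ?_ ?_
    · have := (Complex.continuous_ofReal.tendsto 1)
      rw [Complex.ofReal_one] at this
      exact this.mono_left nhdsWithin_le_nhds
    · filter_upwards [self_mem_nhdsWithin] with t h
      simpa using h
  refine ht.frequently (Filter.Eventually.frequently ?_)
  filter_upwards [nhdsWithin_le_nhds (lt_mem_nhds (zero_lt_one (α := ℝ)))] with b hb
  rw [fourier_exp_neg_mul_norm_real hn hb]
  have e1 : (b : ℂ) ^ 2 + ((4 * Real.pi ^ 2 * ‖ξ‖ ^ 2 : ℝ) : ℂ) =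
      ((b ^ 2 + 4 * Real.pi ^ 2 * ‖ξ‖ ^ 2 : ℝ) : ℂ) := by push_cast; ring
  have e2 : -(((n : ℂ) + 1) / 2) = ((-(((n : ℝ) + 1) / 2) : ℝ) : ℂ) := by push_cast; ring
  rw [e1, e2, ← Complex.ofReal_cpow (by positivity), ← Complex.ofReal_mul, ← Complex.ofReal_mul]
  congr 1
  have e3 : b ^ 2 / 4 + Real.pi ^ 2 * ‖ξ‖ ^ 2 = 4⁻¹ * (b ^ 2 + 4 * Real.pi ^ 2 * ‖ξ‖ ^ 2) := by ring
  rw [e3, Real.mul_rpow (by norm_num) (by positivity), neg_div, hc,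
    Real.inv_rpow (by norm_num), Real.rpow_neg (by norm_num : (0 : ℝ) ≤ 4), inv_inv]
  ring

/-! ### A beta integral -/

/-- With a = (n-1)/2 the integrand is v^{a-1}(d+v)^{-a-1}, whose antiderivative is
(ad)⁻¹(v/(d+v))^a. The condition n ≥ 2 makes a positive, so the antiderivative vanishes at 0. -/
theorem integral_rpow_mul_add_rpow {n : ℕ} (hn : 2 ≤ n) {d : ℝ} (hd : 0 < d) :
    IntegrableOn (fun v : ℝ => v ^ (((n : ℝ) - 3) / 2) * (d + v) ^ (-(((n : ℝ) + 1) / 2)))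
      (Set.Ioi 0) ∧
    ∫ v in Set.Ioi (0 : ℝ), v ^ (((n : ℝ) - 3) / 2) * (d + v) ^ (-(((n : ℝ) + 1) / 2)) =
      2 / (((n : ℝ) - 1) * d) := by
  have hn' : (2 : ℝ) ≤ n := by exact_mod_cast hn
  set a : ℝ := ((n : ℝ) - 1) / 2 with ha
  have ha0 : 0 < a := by rw [ha]; linarith
  have e1 : ((n : ℝ) - 3) / 2 = a - 1 := by rw [ha]; ring
  have e2 : ((n : ℝ) + 1) / 2 = a + 1 := by rw [ha]; ring
  rw [e1, e2]
  have hder : ∀ v ∈ Set.Ioi (0 : ℝ), HasDerivAt (fun v : ℝ => (a * d)⁻¹ * (v / (d + v)) ^ a)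
      (v ^ (a - 1) * (d + v) ^ (-(a + 1))) v := by
    intro v hv
    have hv' : 0 < v := hv
    have hdv : 0 < d + v := by positivity
    have h1 : HasDerivAt (fun v : ℝ => v / (d + v)) (d / (d + v) ^ 2) v := by
      have := (hasDerivAt_id v).div ((hasDerivAt_id v).const_add d) hdv.ne'
      refine this.congr_deriv ?_
      simp
    have h2 := (h1.rpow_const (p := a) (Or.inl (by positivity))).const_mul (a * d)⁻¹
    refine h2.congr_deriv ?_
    rw [Real.div_rpow hv'.le hdv.le, Real.rpow_neg hdv.le, Real.rpow_add hdv, Real.rpow_sub hdv,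
      Real.rpow_one]
    have := Real.rpow_pos_of_pos hdv a
    field_simp
  have hcont : ContinuousWithinAt (fun v : ℝ => (a * d)⁻¹ * (v / (d + v)) ^ a) (Set.Ici 0) 0 := by
    refine ContinuousAt.continuousWithinAt ?_
    refine continuousAt_const.mul (ContinuousAt.rpow_const ?_ (Or.inr ha0.le))
    exact continuousAt_id.div (by fun_prop) (by simpa using hd.ne')
  have hlim : Filter.Tendsto (fun v : ℝ => (a * d)⁻¹ * (v / (d + v)) ^ a) Filter.atTop
      (nhds ((a * d)⁻¹ * 1 ^ a)) := by
    refine Filter.Tendsto.const_mul _ (Filter.Tendsto.rpow_const ?_ (Or.inl one_ne_zero))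
    have h1 : Filter.Tendsto (fun v : ℝ => 1 - d / (d + v)) Filter.atTop (nhds (1 - 0)) := by
      refine tendsto_const_nhds.sub (Filter.Tendsto.div_atTop tendsto_const_nhds ?_)
      exact Filter.tendsto_atTop_add_const_left _ _ Filter.tendsto_id
    rw [sub_zero] at h1
    refine h1.congr' ?_
    filter_upwards [Filter.eventually_gt_atTop 0] with v hv
    have : d + v ≠ 0 := by positivity
    field_simp
    ring
  have hint := integrableOn_Ioi_deriv_of_nonneg hcont hder
    (fun v hv => by
      have hv' : 0 < v := hv
      positivity) hlim
  refine ⟨hint, ?_⟩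
  rw [integral_Ioi_of_hasDerivAt_of_tendsto hcont hder hint hlim, zero_div,
    Real.zero_rpow ha0.ne', Real.one_rpow, ha]
  field_simp
  ring

/-- The sign of Im B makes the cross term favourable: |B-iv|² ≥ |B|² + v². -/
theorem norm_add_le_two_mul_norm_sub_mul_I {B : ℂ} (hB : B.im ≤ 0) {v : ℝ} (hv : 0 ≤ v) :
    ‖B‖ + v ≤ 2 * ‖B - v * Complex.I‖ := by
  have h1 : ‖B‖ ^ 2 + v ^ 2 ≤ ‖B - v * Complex.I‖ ^ 2 := by
    rw [← Complex.normSq_eq_norm_sq, ← Complex.normSq_eq_norm_sq, Complex.normSq_apply,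
      Complex.normSq_apply]
    simp
    nlinarith [mul_nonneg (neg_nonneg.mpr hB) hv]
  have h2 := norm_nonneg B
  have h3 := norm_nonneg (B - v * Complex.I)
  nlinarith [sq_nonneg (‖B‖ - v)]

/-- This fractional integration turns the power (n+1)/2 of the symbol into the power 1 of the
resolvent. The antiderivative is (aB)⁻¹v^a(B-iv)^{-a} with a = (n-1)/2, and the constant is its
limit at infinity. The condition Im B ≤ 0 keeps B-iv off the branch cut for v > 0. -/
theorem integral_rpow_mul_sub_mul_I_cpow {n : ℕ} (hn : 2 ≤ n) {B : ℂ} (hB : B ≠ 0)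
    (hBim : B.im ≤ 0) :
    ∫ v in Set.Ioi (0 : ℝ), ((v ^ (((n : ℝ) - 3) / 2) : ℝ) : ℂ) *
      (B - v * Complex.I) ^ (-(((n : ℂ) + 1) / 2)) =
      2 / ((n : ℂ) - 1) * (-Complex.I) ^ (-(((n : ℂ) - 1) / 2)) * B⁻¹ := by
  have hn' : (2 : ℝ) ≤ n := by exact_mod_cast hn
  set a : ℝ := ((n : ℝ) - 1) / 2 with ha
  have ha0 : 0 < a := by rw [ha]; linarith
  have e1 : ((n : ℝ) - 3) / 2 = a - 1 := by rw [ha]; ring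
  have e2 : ((n : ℂ) + 1) / 2 = a + 1 := by rw [ha]; push_cast; ring
  have e3 : ((n : ℂ) - 1) / 2 = a := by rw [ha]; push_cast; ring
  have haC : (a : ℂ) ≠ 0 := by exact_mod_cast ha0.ne'
  have e4 : 2 / ((n : ℂ) - 1) = (a : ℂ)⁻¹ := by
    rw [← e3, inv_div]
  have hslit : ∀ v : ℝ, 0 < v → B - v * Complex.I ∈ Complex.slitPlane := by
    intro v hv
    rw [Complex.mem_slitPlane_iff]
    right
    simp
    intro h
    linarith
  have hBn : 0 < ‖B‖ := norm_pos_iff.mpr hB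
  have hbase := (integral_rpow_mul_add_rpow hn hBn).1
  rw [e1, e2, e3, e4]
  rw [e1, show ((n : ℝ) + 1) / 2 = a + 1 by rw [ha]; ring] at hbase
  set f : ℝ → ℂ := fun v => (a * B)⁻¹ * (((v ^ a : ℝ) : ℂ) * (B - v * Complex.I) ^ (-(a : ℂ)))
    with hf
  have hder : ∀ v ∈ Set.Ioi (0 : ℝ), HasDerivAt f
      (((v ^ (a - 1) : ℝ) : ℂ) * (B - v * Complex.I) ^ (-((a : ℂ) + 1))) v := by
    intro v hv
    have hv' : 0 < v := hv
    have hs := hslit v hv'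
    have hne : B - v * Complex.I ≠ 0 := Complex.slitPlane_ne_zero hs
    have h1 : HasDerivAt (fun v : ℝ => ((v ^ a : ℝ) : ℂ)) ((a * v ^ (a - 1) : ℝ) : ℂ) v :=
      (Real.hasDerivAt_rpow_const (Or.inl hv'.ne')).ofReal_comp
    have h2 : HasDerivAt (fun v : ℝ => B - v * Complex.I) (-Complex.I) v := by
      have := ((hasDerivAt_id v).ofReal_comp.mul_const Complex.I).const_sub B
      simpa using this
    have h3 : HasDerivAt (fun v : ℝ => (B - v * Complex.I) ^ (-(a : ℂ)))
        (-(a : ℂ) * (B - v * Complex.I) ^ (-(a : ℂ) - 1) * -Complex.I) v := by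
      have h0 : HasDerivAt (fun w : ℂ => w ^ (-(a : ℂ)))
          (-(a : ℂ) * (B - v * Complex.I) ^ (-(a : ℂ) - 1) * 1) (B - v * Complex.I) :=
        (hasDerivAt_id _).cpow_const hs
      refine (h0.scomp v h2).congr_deriv ?_
      simp only [smul_eq_mul]
      ring
    have h4 := (h1.mul h3).const_mul (a * B)⁻¹
    refine h4.congr_deriv ?_
    have e5 : (B - v * Complex.I) ^ (-(a : ℂ)) =
        (B - v * Complex.I) ^ (-(a : ℂ) - 1) * (B - v * Complex.I) := by
      rw [Complex.cpow_sub _ _ hne, Complex.cpow_one]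
      field_simp
    have e6 : ((v ^ a : ℝ) : ℂ) = ((v ^ (a - 1) : ℝ) : ℂ) * v := by
      rw [← Complex.ofReal_mul, Real.rpow_sub hv', Real.rpow_one]
      congr 1
      field_simp
    rw [e5, e6, show -((a : ℂ) + 1) = -(a : ℂ) - 1 by ring]
    push_cast
    field_simp
    ring
  have hnorm : ∀ v : ℝ, 0 < v → ∀ t : ℝ, 0 ≤ t →
      ‖(B - v * Complex.I) ^ (-(t : ℂ))‖ ≤ 2 ^ t * (‖B‖ + v) ^ (-t) := by
    intro v hv t ht
    rw [← Complex.ofReal_neg, Complex.norm_cpow_real]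
    have h1 := norm_add_le_two_mul_norm_sub_mul_I hBim hv.le
    have h2 : (‖B‖ + v) / 2 ≤ ‖B - v * Complex.I‖ := by linarith
    calc ‖B - v * Complex.I‖ ^ (-t) ≤ ((‖B‖ + v) / 2) ^ (-t) :=
          Real.rpow_le_rpow_of_nonpos (by positivity) h2 (by linarith)
      _ = 2 ^ t * (‖B‖ + v) ^ (-t) := by
          rw [Real.div_rpow (by positivity) (by norm_num), Real.rpow_neg (by norm_num : (0:ℝ) ≤ 2)]
          field_simp
  have hf0 : f 0 = 0 := by
    simp [hf, Real.zero_rpow ha0.ne']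
  -- B itself may lie on the branch cut, so the power need not be continuous at v = 0. The bound for
  -- its modulus and the factor v^a suffice.
  have hcont : ContinuousWithinAt f (Set.Ici 0) 0 := by
    rw [ContinuousWithinAt, hf0]
    have h1 : Filter.Tendsto (fun v : ℝ => ‖(a * B)⁻¹‖ * (v ^ a * (2 ^ a * ‖B‖ ^ (-a))))
        (nhdsWithin 0 (Set.Ici 0)) (nhds (‖(a * B)⁻¹‖ * (0 ^ a * (2 ^ a * ‖B‖ ^ (-a))))) :=
      (((Real.continuousAt_rpow_const 0 a (Or.inr ha0.le)).tendsto.mono_left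
        nhdsWithin_le_nhds).mul_const _).const_mul _
    rw [Real.zero_rpow ha0.ne', zero_mul, mul_zero] at h1
    refine squeeze_zero_norm' ?_ h1
    filter_upwards [self_mem_nhdsWithin] with v hv
    rcases (Set.mem_Ici.mp hv).eq_or_lt with h0 | h0
    · rw [← h0, hf0, norm_zero]
      positivity
    · rw [hf, norm_mul, norm_mul, Complex.norm_real, Real.norm_of_nonneg (by positivity)]
      have h2 := hnorm v h0 a ha0.le
      have h3 : (‖B‖ + v) ^ (-a) ≤ ‖B‖ ^ (-a) :=
        Real.rpow_le_rpow_of_nonpos hBn (by linarith) (by linarith)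
      gcongr
      exact h2.trans (by gcongr)
  have hint : IntegrableOn (fun v : ℝ => ((v ^ (a - 1) : ℝ) : ℂ) *
      (B - v * Complex.I) ^ (-((a : ℂ) + 1))) (Set.Ioi 0) := by
    refine Integrable.mono' (hbase.const_mul (2 ^ (a + 1))) (by fun_prop) ?_
    filter_upwards [ae_restrict_mem measurableSet_Ioi] with v hv
    have hv' : 0 < v := hv
    have h1 := hnorm v hv' (a + 1) (by positivity)
    push_cast at h1
    rw [norm_mul, Complex.norm_real, Real.norm_of_nonneg (by positivity)]
    calc _ ≤ v ^ (a - 1) * (2 ^ (a + 1) * (‖B‖ + v) ^ (-(a + 1))) := by gcongr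
      _ = _ := by ring
  have hlim : Filter.Tendsto f Filter.atTop
      (nhds ((a * B)⁻¹ * (0 - Complex.I) ^ (-(a : ℂ)))) := by
    have h1 : Filter.Tendsto (fun v : ℝ => ((v⁻¹ : ℝ) : ℂ) * B - Complex.I) Filter.atTop
        (nhds (((0 : ℝ) : ℂ) * B - Complex.I)) :=
      (((Complex.continuous_ofReal.tendsto 0).comp tendsto_inv_atTop_zero).mul_const B).sub_const _
    rw [Complex.ofReal_zero, zero_mul] at h1
    have h2 : ContinuousAt (fun w : ℂ => w ^ (-(a : ℂ))) (0 - Complex.I) :=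
      continuousAt_cpow_const (by simp [Complex.mem_slitPlane_iff])
    refine Filter.Tendsto.const_mul _ ((h2.tendsto.comp h1).congr' ?_)
    filter_upwards [Filter.eventually_gt_atTop 0] with v hv
    have e7 : B - v * Complex.I = (v : ℂ) * (((v⁻¹ : ℝ) : ℂ) * B - Complex.I) := by
      have : (v : ℂ) ≠ 0 := by exact_mod_cast hv.ne'
      push_cast
      field_simp
    have e8 : ((v : ℂ) * (((v⁻¹ : ℝ) : ℂ) * B - Complex.I)) ^ (-(a : ℂ)) =
        (v : ℂ) ^ (-(a : ℂ)) * (((v⁻¹ : ℝ) : ℂ) * B - Complex.I) ^ (-(a : ℂ)) := by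
      have h5 : (((v⁻¹ : ℝ) : ℂ) * B - Complex.I) ≠ 0 := by
        intro h
        rw [h, mul_zero] at e7
        exact Complex.slitPlane_ne_zero (hslit v hv) e7
      have hv0 : (v : ℂ) ≠ 0 := by exact_mod_cast hv.ne'
      rw [Complex.cpow_def_of_ne_zero (mul_ne_zero hv0 h5), Complex.cpow_def_of_ne_zero hv0,
        Complex.cpow_def_of_ne_zero h5, Complex.log_ofReal_mul hv h5, ← Complex.exp_add,
        Complex.ofReal_log hv.le]
      ring_nf
    have h6 : (v : ℂ) ^ (a : ℂ) ≠ 0 := by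
      rw [Complex.cpow_ne_zero_iff]
      left
      exact_mod_cast hv.ne'
    rw [Function.comp_apply, e7, e8, ← mul_assoc, Complex.cpow_neg (v : ℂ),
      Complex.ofReal_cpow hv.le, mul_inv_cancel₀ h6, one_mul]
  have key := integral_Ioi_of_hasDerivAt_of_tendsto hcont hder hint hlim
  rw [key, hf0, sub_zero, zero_sub, mul_inv]
  ring

/-! ### The kernel of the resolvent -/

/-- The square root of `-(z + iv)` with positive real part. -/
def rootNeg (z : ℂ) (v : ℝ) : ℂ := (-(z + v * Complex.I)) ^ (2⁻¹ : ℂ)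

theorem rootNeg_sq (z : ℂ) (v : ℝ) : rootNeg z v ^ 2 = -(z + v * Complex.I) := by
  simp [rootNeg]

theorem measurable_rootNeg (z : ℂ) : Measurable (rootNeg z) := by
  unfold rootNeg
  fun_prop

theorem isClosed_posHalfLine : IsClosed posHalfLine :=
  Complex.isometry_ofReal.isClosedEmbedding.isClosedMap _ isClosed_Ici

theorem posHalfLine_nonempty : posHalfLine.Nonempty := ⟨0, 0, by simp, by simp⟩

theorem infDist_posHalfLine_pos {z : ℂ} (hz : z ∉ posHalfLine) : 0 < infDist z posHalfLine :=
  (isClosed_posHalfLine.notMem_iff_infDist_pos posHalfLine_nonempty).mp hz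

theorem infDist_posHalfLine_le_norm (z : ℂ) : infDist z posHalfLine ≤ ‖z‖ := by
  have h : (0 : ℂ) ∈ posHalfLine := ⟨0, by simp, by simp⟩
  simpa using infDist_le_dist_of_mem (x := z) h

/-! ### Size of the square root β of -(z+iv) -/

section Root

variable {z : ℂ} {v : ℝ}

/-- For Im z ≥ 0, moving up by v only increases the distance to real points: |z+iv-t|² ≥ |z-t|² +
v². -/
theorem infDist_add_le (him : 0 ≤ z.im) (hv : 0 ≤ v) {t : ℝ} (ht : 0 ≤ t) :
    infDist z posHalfLine + v ≤ 2 * ‖z + v * Complex.I - t‖ := by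
  have h1 : infDist z posHalfLine ≤ ‖z - t‖ := by
    have h : (t : ℂ) ∈ posHalfLine := ⟨t, ht, rfl⟩
    simpa [dist_eq_norm] using infDist_le_dist_of_mem (x := z) h
  have h2 : ‖z - t‖ ^ 2 + v ^ 2 ≤ ‖z + v * Complex.I - t‖ ^ 2 := by
    rw [← Complex.normSq_eq_norm_sq, ← Complex.normSq_eq_norm_sq, Complex.normSq_apply,
      Complex.normSq_apply]
    simp
    nlinarith [mul_nonneg him hv]
  have h3 := norm_nonneg (z + v * Complex.I - t)
  have h4 : ‖z - t‖ + v ≤ 2 * ‖z + v * Complex.I - t‖ := by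
    nlinarith [sq_nonneg (‖z - t‖ - v), norm_nonneg (z - t)]
  linarith

theorem rootNeg_re_nonneg : 0 ≤ (rootNeg z v).re := by
  rw [rootNeg, Complex.cpow_inv_two_re]
  positivity

/-- Compare z+iv = -β² with the point (Im β)² of the half-line. The difference is -Re β(Re β + 2i Im
β), of modulus at most 2 Re β·|β|. This gives the lower bound for Re β that governs the decay of
e^{-β|x|}. -/
theorem infDist_add_le_rootNeg (him : 0 ≤ z.im) (hv : 0 ≤ v) :
    infDist z posHalfLine + v ≤ 4 * ((rootNeg z v).re * ‖rootNeg z v‖) := by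
  set β := rootNeg z v with hβ
  have h1 := infDist_add_le him hv (sq_nonneg β.im)
  have h2 : z + v * Complex.I - ((β.im ^ 2 : ℝ) : ℂ) =
      -(β.re * (β.re + 2 * β.im * Complex.I)) := by
    have h3 := rootNeg_sq z v
    rw [← hβ] at h3
    have h4 : z + v * Complex.I = -β ^ 2 := by rw [h3]; ring
    rw [h4]
    conv_lhs => rw [← Complex.re_add_im β]
    push_cast
    ring_nf
    simp
  have h5 : ‖(β.re : ℂ) + 2 * β.im * Complex.I‖ ≤ 2 * ‖β‖ := by
    have h6 : ‖(β.re : ℂ) + 2 * β.im * Complex.I‖ ^ 2 ≤ (2 * ‖β‖) ^ 2 := by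
      rw [mul_pow, ← Complex.normSq_eq_norm_sq, ← Complex.normSq_eq_norm_sq, Complex.normSq_apply,
        Complex.normSq_apply]
      simp
      nlinarith [sq_nonneg β.re]
    exact le_of_sq_le_sq h6 (by positivity)
  rw [h2, norm_neg, norm_mul, Complex.norm_real, Real.norm_of_nonneg rootNeg_re_nonneg] at h1
  have h7 : 0 ≤ β.re := rootNeg_re_nonneg
  nlinarith [mul_le_mul_of_nonneg_left h5 h7]

theorem norm_rootNeg_sq_le (hv : 0 ≤ v) : ‖rootNeg z v‖ ^ 2 ≤ ‖z‖ + v := by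
  rw [← norm_pow, rootNeg_sq, norm_neg]
  refine (norm_add_le _ _).trans ?_
  simp [abs_of_nonneg hv]

theorem rootNeg_re_pos (hz : z ∉ posHalfLine) (him : 0 ≤ z.im) (hv : 0 ≤ v) :
    0 < (rootNeg z v).re := by
  have h1 := infDist_add_le_rootNeg him hv
  have h2 := infDist_posHalfLine_pos hz
  refine lt_of_le_of_ne rootNeg_re_nonneg fun h => ?_
  rw [← h] at h1
  linarith

end Root

/-- The weight in the representation of the kernel of the resolvent. -/
theorem weight_le {n : ℕ} {α : ℝ} (hα : α ≤ ((n : ℝ) - 1) / 2) {z : ℂ}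
    (hz : z ∉ posHalfLine) (him : 0 ≤ z.im) {v : ℝ} (hv : 0 < v) (hα0 : 0 ≤ α) :
    v ^ (((n : ℝ) - 3) / 2) * ‖rootNeg z v‖⁻¹ *
      (‖rootNeg z v‖ ^ (-α) * (rootNeg z v).re ^ (α - n)) ≤
    4 ^ (n : ℝ) * (‖z‖ / infDist z posHalfLine) ^ (((n : ℝ) - 1) / 2 - α) *
      (v ^ (((n : ℝ) - 3) / 2) *
        (infDist z posHalfLine + v) ^ (-(((n : ℝ) + 1) / 2))) := by
  set d := infDist z posHalfLine with hd
  set β := rootNeg z v with hβ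
  have hd0 : 0 < d := infDist_posHalfLine_pos hz
  have hre : 0 < β.re := rootNeg_re_pos hz him hv.le
  have hβ0 : 0 < ‖β‖ := hre.trans_le (Complex.re_le_norm β)
  have h1 : d + v ≤ 4 * (β.re * ‖β‖) := infDist_add_le_rootNeg him hv.le
  have h2 : ‖β‖ ^ 2 ≤ ‖z‖ + v := norm_rootNeg_sq_le hv.le
  have hdz : d ≤ ‖z‖ := infDist_posHalfLine_le_norm z
  have hz0 : 0 < ‖z‖ := hd0.trans_le hdz
  have hdv : 0 < d + v := by positivity
  -- The lower bound for Re β is inserted into a power with negative exponent α-n.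
  have h3 : (d + v) / (4 * ‖β‖) ≤ β.re := by
    rw [div_le_iff₀ (by positivity)]
    linarith
  have hαn : α - n ≤ 0 := by
    have : (0 : ℝ) ≤ n := n.cast_nonneg
    linarith
  have h4 : β.re ^ (α - n) ≤ ((d + v) / (4 * ‖β‖)) ^ (α - n) :=
    Real.rpow_le_rpow_of_nonpos (by positivity) h3 hαn
  have h5 : ((d + v) / (4 * ‖β‖)) ^ (α - n) = (d + v) ^ (α - n) * 4 ^ (n - α) * ‖β‖ ^ (n - α) := by
    rw [Real.div_rpow (by positivity) (by positivity), Real.mul_rpow (by norm_num) hβ0.le,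
      show α - n = -(n - α) by ring, Real.rpow_neg (by positivity), Real.rpow_neg (by norm_num),
      Real.rpow_neg hβ0.le]
    field_simp
  have h6 : ‖β‖⁻¹ * (‖β‖ ^ (-α) * ‖β‖ ^ (n - α)) = (‖β‖ ^ 2) ^ (((n : ℝ) - 1) / 2 - α) := by
    rw [← Real.rpow_natCast ‖β‖ 2, ← Real.rpow_mul hβ0.le, ← Real.rpow_neg_one,
      ← Real.rpow_add hβ0, ← Real.rpow_add hβ0]
    congr 1
    push_cast
    ring
  -- The collected power of |β|² has exponent (n-1)/2-α ≥ 0; this is where the upper bound on α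
  -- enters. As d ≤ |z|, one has |β|² ≤ |z|+v ≤ (|z|/d)(d+v).
  have h7 : (‖β‖ ^ 2) ^ (((n : ℝ) - 1) / 2 - α) ≤
      (‖z‖ / d) ^ (((n : ℝ) - 1) / 2 - α) * (d + v) ^ (((n : ℝ) - 1) / 2 - α) := by
    rw [← Real.mul_rpow (by positivity) hdv.le]
    refine Real.rpow_le_rpow (by positivity) (h2.trans ?_) (by linarith)
    rw [mul_add, div_mul_cancel₀ _ hd0.ne']
    have : 1 ≤ ‖z‖ / d := (one_le_div hd0).mpr hdz
    nlinarith
  have h8 : (4 : ℝ) ^ (n - α) ≤ 4 ^ (n : ℝ) :=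
    Real.rpow_le_rpow_of_exponent_le (by norm_num) (by linarith)
  have h9 : (d + v) ^ (α - n) * (d + v) ^ (((n : ℝ) - 1) / 2 - α) =
      (d + v) ^ (-(((n : ℝ) + 1) / 2)) := by
    rw [← Real.rpow_add hdv]
    congr 1
    ring
  calc v ^ (((n : ℝ) - 3) / 2) * ‖β‖⁻¹ * (‖β‖ ^ (-α) * β.re ^ (α - n))
      ≤ v ^ (((n : ℝ) - 3) / 2) * ‖β‖⁻¹ * (‖β‖ ^ (-α) *
        ((d + v) ^ (α - n) * 4 ^ (n - α) * ‖β‖ ^ (n - α))) := by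
        rw [← h5]
        gcongr
    _ = v ^ (((n : ℝ) - 3) / 2) * (d + v) ^ (α - n) * 4 ^ (n - α) *
        (‖β‖⁻¹ * (‖β‖ ^ (-α) * ‖β‖ ^ (n - α))) := by ring
    _ ≤ v ^ (((n : ℝ) - 3) / 2) * (d + v) ^ (α - n) * 4 ^ (n : ℝ) *
        ((‖z‖ / d) ^ (((n : ℝ) - 1) / 2 - α) * (d + v) ^ (((n : ℝ) - 1) / 2 - α)) := by
        rw [h6]
        gcongr
    _ = 4 ^ (n : ℝ) * (‖z‖ / d) ^ (((n : ℝ) - 1) / 2 - α) * (v ^ (((n : ℝ) - 3) / 2) *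
        ((d + v) ^ (α - n) * (d + v) ^ (((n : ℝ) - 1) / 2 - α))) := by ring
    _ = _ := by rw [h9]

/-- Up to a constant, the kernel of `(-Δ - z)⁻¹` (for `0 ≤ Im z`). -/
def resolventKernel (n : ℕ) (z : ℂ) (x : EuclideanSpace ℝ (Fin n)) : ℂ :=
  ∫ v in Set.Ioi (0 : ℝ), ((v ^ (((n : ℝ) - 3) / 2) : ℝ) : ℂ) * (rootNeg z v)⁻¹ *
    Complex.exp (-rootNeg z v * ‖x‖)

/-! ### Integrability, pairings and Fourier transform of the kernel -/

section Kernel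

variable {n : ℕ} {z : ℂ}

theorem integral_exp_neg_mul_norm {b : ℝ} (hb : 0 < b) :
    ∫ x : EuclideanSpace ℝ (Fin n), Real.exp (-(b * ‖x‖)) =
      b ^ (-(n : ℝ)) * ∫ x : EuclideanSpace ℝ (Fin n), Real.exp (-‖x‖) := by
  have h := Measure.integral_comp_smul (volume : Measure (EuclideanSpace ℝ (Fin n)))
    (fun x => Real.exp (-‖x‖)) b
  simp only [norm_smul, Real.norm_eq_abs, abs_of_pos hb, finrank_euclideanSpace,
    Fintype.card_fin, smul_eq_mul] at h
  rw [h, abs_of_pos (by positivity), Real.rpow_neg hb.le, Real.rpow_natCast]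

theorem measurable_resolventKernel_integrand :
    Measurable fun q : EuclideanSpace ℝ (Fin n) × ℝ =>
      ((q.2 ^ (((n : ℝ) - 3) / 2) : ℝ) : ℂ) * (rootNeg z q.2)⁻¹ *
        Complex.exp (-rootNeg z q.2 * ‖q.1‖) := by
  have := measurable_rootNeg z
  fun_prop

/-- The L¹ norm of e^{-β|x|} is a multiple of (Re β)^{-n}, so `weight_le` with α = 0 dominates the
v-integrand by the beta integrand. This justifies all later uses of Fubini for the kernel. -/
theorem integrable_resolventKernel_integrand (hn : 2 ≤ n) (hz : z ∉ posHalfLine)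
    (him : 0 ≤ z.im) :
    Integrable (fun q : EuclideanSpace ℝ (Fin n) × ℝ =>
      ((q.2 ^ (((n : ℝ) - 3) / 2) : ℝ) : ℂ) * (rootNeg z q.2)⁻¹ *
        Complex.exp (-rootNeg z q.2 * ‖q.1‖)) (volume.prod (volume.restrict (Set.Ioi 0))) := by
  have hn1 : 1 ≤ n := by omega
  have hn' : (2 : ℝ) ≤ n := by exact_mod_cast hn
  rw [integrable_prod_iff' measurable_resolventKernel_integrand.aestronglyMeasurable]
  constructor
  · filter_upwards [ae_restrict_mem measurableSet_Ioi] with v hv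
    exact (integrable_cexp_neg_mul_norm hn1 (rootNeg_re_pos hz him (Set.mem_Ioi.mp hv).le)).const_mul _
  · have h1 := (integral_rpow_mul_add_rpow hn (infDist_posHalfLine_pos hz)).1
    refine Integrable.mono' (h1.const_mul ((∫ x : EuclideanSpace ℝ (Fin n), Real.exp (-‖x‖)) *
      (4 ^ (n : ℝ) * (‖z‖ / infDist z posHalfLine) ^ (((n : ℝ) - 1) / 2 - 0)))) ?_ ?_
    · exact (measurable_resolventKernel_integrand.norm.stronglyMeasurable.integral_prod_left'
        (μ := volume)).aestronglyMeasurable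
    filter_upwards [ae_restrict_mem measurableSet_Ioi] with v hv
    have hv' : 0 < v := hv
    have hre := rootNeg_re_pos hz him hv'.le
    have h2 := weight_le (n := n) (α := 0) (by linarith) hz him hv' le_rfl
    have h3 : 0 ≤ ∫ x : EuclideanSpace ℝ (Fin n), Real.exp (-‖x‖) :=
      integral_nonneg fun x => (Real.exp_pos _).le
    rw [Real.norm_of_nonneg (integral_nonneg fun x => norm_nonneg _)]
    simp only [norm_mul, norm_cexp_neg_mul_norm, norm_inv, Complex.norm_real]
    rw [integral_const_mul, integral_exp_neg_mul_norm hre, Real.norm_of_nonneg (by positivity)]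
    rw [neg_zero, Real.rpow_zero, one_mul, zero_sub] at h2
    calc _ = (∫ x : EuclideanSpace ℝ (Fin n), Real.exp (-‖x‖)) *
        (v ^ (((n : ℝ) - 3) / 2) * ‖rootNeg z v‖⁻¹ * (rootNeg z v).re ^ (-(n : ℝ))) := by ring
      _ ≤ _ := by
        rw [mul_assoc (∫ x : EuclideanSpace ℝ (Fin n), Real.exp (-‖x‖))]
        gcongr

theorem integrable_resolventKernel (hn : 2 ≤ n) (hz : z ∉ posHalfLine) (him : 0 ≤ z.im) :
    Integrable (resolventKernel n z) :=
  (integrable_resolventKernel_integrand hn hz him).integral_prod_left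

/-- The pairing of the kernel with a bounded function `c`, estimated through the pairings of
the functions `e^{-β|x|}` with `c`. -/
theorem norm_integral_resolventKernel_mul_le (hn : 2 ≤ n) (hz : z ∉ posHalfLine)
    (him : 0 ≤ z.im) {α M : ℝ} (hα0 : 0 ≤ α) (hα : α ≤ ((n : ℝ) - 1) / 2)
    {c : EuclideanSpace ℝ (Fin n) → ℂ} (hc : AEStronglyMeasurable c) (hc1 : ∀ x, ‖c x‖ ≤ 1)
    (hM0 : 0 ≤ M)
    (hM : ∀ β : ℂ, 0 < β.re → ‖∫ x, Complex.exp (-β * ‖x‖) * c x‖ ≤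
      M * (‖β‖ ^ (-α) * β.re ^ (α - n))) :
    ‖∫ x, resolventKernel n z x * c x‖ ≤ M * (4 ^ (n : ℝ) * (2 / ((n : ℝ) - 1))) *
      (‖z‖ ^ (((n : ℝ) - 1) / 2 - α) *
        infDist z posHalfLine ^ (α - ((n : ℝ) + 1) / 2)) := by
  have hd0 := infDist_posHalfLine_pos hz
  have hn' : (2 : ℝ) ≤ n := by exact_mod_cast hn
  set F : EuclideanSpace ℝ (Fin n) → ℝ → ℂ := fun x v =>
    ((v ^ (((n : ℝ) - 3) / 2) : ℝ) : ℂ) * (rootNeg z v)⁻¹ *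
      Complex.exp (-rootNeg z v * ‖x‖) * c x with hF
  have hint : Integrable (Function.uncurry F) (volume.prod (volume.restrict (Set.Ioi 0))) := by
    refine (integrable_resolventKernel_integrand hn hz him).mul_bdd (c := 1) hc.comp_fst ?_
    exact Filter.Eventually.of_forall fun q => hc1 q.1
  have h1 : ∫ x, resolventKernel n z x * c x = ∫ v in Set.Ioi (0 : ℝ), ∫ x, F x v := by
    rw [← integral_integral_swap hint]
    refine integral_congr_ae (Filter.Eventually.of_forall fun x => ?_)
    simp only [hF, resolventKernel]
    rw [integral_mul_const]
  obtain ⟨h2, h3⟩ := integral_rpow_mul_add_rpow hn hd0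
  set d := infDist z posHalfLine with hd
  rw [h1]
  calc ‖∫ v in Set.Ioi (0 : ℝ), ∫ x, F x v‖
      ≤ ∫ v in Set.Ioi (0 : ℝ), M * (4 ^ (n : ℝ) * (‖z‖ / d) ^ (((n : ℝ) - 1) / 2 - α)) *
        (v ^ (((n : ℝ) - 3) / 2) * (d + v) ^ (-(((n : ℝ) + 1) / 2))) := by
        refine norm_integral_le_of_norm_le (h2.const_mul _) ?_
        filter_upwards [ae_restrict_mem measurableSet_Ioi] with v hv
        have hv' : 0 < v := hv
        have h4 := hM _ (rootNeg_re_pos hz him hv'.le)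
        have h5 : ∫ x, F x v = ((v ^ (((n : ℝ) - 3) / 2) : ℝ) : ℂ) * (rootNeg z v)⁻¹ *
            ∫ x, Complex.exp (-rootNeg z v * ‖x‖) * c x := by
          rw [← integral_const_mul]
          simp only [hF, mul_assoc]
        rw [h5, norm_mul, norm_mul, norm_inv, Complex.norm_real,
          Real.norm_of_nonneg (by positivity)]
        calc _ ≤ v ^ (((n : ℝ) - 3) / 2) * ‖rootNeg z v‖⁻¹ *
              (M * (‖rootNeg z v‖ ^ (-α) * (rootNeg z v).re ^ (α - n))) := by gcongr
          _ = M * (v ^ (((n : ℝ) - 3) / 2) * ‖rootNeg z v‖⁻¹ *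
              (‖rootNeg z v‖ ^ (-α) * (rootNeg z v).re ^ (α - n))) := by ring
          _ ≤ M * _ := mul_le_mul_of_nonneg_left (weight_le hα hz him hv' hα0) hM0
          _ = _ := by ring
    _ = _ := by
        rw [integral_const_mul, h3, Real.div_rpow (norm_nonneg _) hd0.le]
        -- The beta integral contributes 2/((n-1)d); together with d^{-((n-1)/2-α)} this is the
        -- power d^{α-(n+1)/2}.
        have e : d ^ (α - ((n : ℝ) + 1) / 2) = (d ^ (((n : ℝ) - 1) / 2 - α))⁻¹ * d⁻¹ := by
          rw [← Real.rpow_neg hd0.le, ← Real.rpow_neg_one d, ← Real.rpow_add hd0]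
          congr 1
          ring
        rw [e]
        field_simp

/-- The factor β⁻¹ in the kernel cancels the β in the transform of e^{-β|x|}, and β² = -(z+iv) turns
β²+4π²|ξ|² into B-iv with B = 4π²|ξ|²-z. Integration in v then gives a multiple of B⁻¹. The
condition Im z ≥ 0 means Im B ≤ 0. -/
theorem exists_fourier_resolventKernel (hn : 2 ≤ n) : ∃ c : ℂ, c ≠ 0 ∧ ∀ z : ℂ,
    z ∉ posHalfLine → 0 ≤ z.im → ∀ ξ : EuclideanSpace ℝ (Fin n),
      FourierTransform.fourier (resolventKernel n z) ξ = c * resolventSymbol n z ξ := by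
  obtain ⟨c, hc, hcβ⟩ := exists_fourier_exp_neg_mul_norm (n := n) (by omega)
  have hn' : (n : ℂ) - 1 ≠ 0 := by
    have : (n : ℝ) - 1 ≠ 0 := by
      have : (2 : ℝ) ≤ n := by exact_mod_cast hn
      linarith
    exact_mod_cast this
  refine ⟨c * (2 / ((n : ℂ) - 1) * (-Complex.I) ^ (-(((n : ℂ) - 1) / 2))), ?_, ?_⟩
  · refine mul_ne_zero hc (mul_ne_zero (div_ne_zero two_ne_zero hn') ?_)
    rw [Complex.cpow_ne_zero_iff]
    left
    simp
  intro z hz him ξ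
  set e : EuclideanSpace ℝ (Fin n) → ℂ := fun x =>
    Complex.exp (((-2 * Real.pi * inner ℝ x ξ : ℝ) : ℂ) * Complex.I) with he
  have hem : Measurable e := by
    rw [he]
    fun_prop
  have hen : ∀ x, ‖e x‖ = 1 := fun x => Complex.norm_exp_ofReal_mul_I _
  set F : EuclideanSpace ℝ (Fin n) → ℝ → ℂ := fun x v => e x *
    (((v ^ (((n : ℝ) - 3) / 2) : ℝ) : ℂ) * (rootNeg z v)⁻¹ *
      Complex.exp (-rootNeg z v * ‖x‖)) with hF
  have hint : Integrable (Function.uncurry F) (volume.prod (volume.restrict (Set.Ioi 0))) := by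
    refine (integrable_resolventKernel_integrand hn hz him).bdd_mul (c := 1)
      hem.aestronglyMeasurable.comp_fst ?_
    exact Filter.Eventually.of_forall fun q => (hen q.1).le
  have h1 : FourierTransform.fourier (resolventKernel n z) ξ =
      ∫ v in Set.Ioi (0 : ℝ), ∫ x, F x v := by
    rw [Real.fourier_eq', ← integral_integral_swap hint]
    refine integral_congr_ae (Filter.Eventually.of_forall fun x => ?_)
    simp only [hF, resolventKernel]
    rw [integral_const_mul, smul_eq_mul]
  set B : ℂ := ((4 * Real.pi ^ 2 * ‖ξ‖ ^ 2 : ℝ) : ℂ) - z with hB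
  have h2 : ∀ v ∈ Set.Ioi (0 : ℝ), ∫ x, F x v = c * (((v ^ (((n : ℝ) - 3) / 2) : ℝ) : ℂ) *
      (B - v * Complex.I) ^ (-(((n : ℂ) + 1) / 2))) := by
    intro v hv
    have hv' : 0 < v := hv
    have hre := rootNeg_re_pos hz him hv'.le
    have h3 := hcβ _ hre ξ
    rw [Real.fourier_eq', rootNeg_sq] at h3
    have h4 : ∫ x, F x v = ((v ^ (((n : ℝ) - 3) / 2) : ℝ) : ℂ) * (rootNeg z v)⁻¹ *
        ∫ x : EuclideanSpace ℝ (Fin n), e x • Complex.exp (-rootNeg z v * ‖x‖) := by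
      rw [← integral_const_mul]
      refine integral_congr_ae (Filter.Eventually.of_forall fun x => ?_)
      simp only [hF, smul_eq_mul]
      ring
    rw [h4, h3]
    have hne : rootNeg z v ≠ 0 := by
      intro h
      rw [h] at hre
      simp at hre
    have e1 : -(z + v * Complex.I) + ((4 * Real.pi ^ 2 * ‖ξ‖ ^ 2 : ℝ) : ℂ) = B - v * Complex.I := by
      rw [hB]
      ring
    rw [e1]
    field_simp
  rw [h1, setIntegral_congr_fun measurableSet_Ioi h2, integral_const_mul,
    integral_rpow_mul_sub_mul_I_cpow hn (symbol_sub_ne_zero n hz ξ)]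
  · rw [resolventSymbol]
    ring
  · simp only [Complex.sub_im, Complex.ofReal_im]
    linarith

end Kernel

/-! ### A Fourier representation of `ρ^N e^{-wρ}` -/

theorem integrableOn_pow_mul_cexp (N : ℕ) {w : ℂ} (hw : 0 < w.re) :
    IntegrableOn (fun ρ : ℝ => (ρ : ℂ) ^ N * Complex.exp (-w * ρ)) (Set.Ioi 0) := by
  have h := integrableOn_rpow_mul_exp_neg_mul_rpow (p := 1) (s := (N : ℝ)) (b := w.re)
    (by have : (0 : ℝ) ≤ N := Nat.cast_nonneg _
        linarith) one_pos hw
  refine Integrable.mono' h (by fun_prop) ?_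
  filter_upwards [ae_restrict_mem measurableSet_Ioi] with ρ hρ
  have hρ' : 0 < ρ := hρ
  rw [norm_mul, norm_pow, Complex.norm_real, Real.norm_of_nonneg hρ'.le, Complex.norm_exp,
    Real.rpow_natCast, Real.rpow_one]
  simp

theorem integral_pow_mul_cexp (N : ℕ) {w : ℂ} (hw : 0 < w.re) :
    ∫ ρ in Set.Ioi (0 : ℝ), (ρ : ℂ) ^ N * Complex.exp (-w * ρ) = (N.factorial : ℂ) / w ^ (N + 1) := by
  have hw0 : w ≠ 0 := by
    intro h
    simp [h] at hw
  have hder : ∀ (k : ℕ) (ρ : ℝ), HasDerivAt (fun ρ : ℝ => (ρ : ℂ) ^ k * Complex.exp (-w * ρ))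
      ((k * (ρ : ℂ) ^ (k - 1)) * Complex.exp (-w * ρ) +
        (ρ : ℂ) ^ k * (Complex.exp (-w * ρ) * -w)) ρ := by
    intro k ρ
    have h1 : HasDerivAt (fun ρ : ℝ => (ρ : ℂ) ^ k) (k * (ρ : ℂ) ^ (k - 1)) ρ := by
      simpa using ((hasDerivAt_id ρ).ofReal_comp.fun_pow k)
    have h2 : HasDerivAt (fun ρ : ℝ => Complex.exp (-w * ρ)) (Complex.exp (-w * ρ) * -w) ρ := by
      simpa using ((hasDerivAt_id ρ).ofReal_comp.const_mul (-w)).cexp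
    exact h1.mul h2
  have hlim : ∀ k : ℕ, Filter.Tendsto (fun ρ : ℝ => (ρ : ℂ) ^ k * Complex.exp (-w * ρ))
      Filter.atTop (nhds 0) := by
    intro k
    rw [tendsto_zero_iff_norm_tendsto_zero]
    refine (tendsto_rpow_mul_exp_neg_mul_atTop_nhds_zero k w.re hw).congr' ?_
    filter_upwards [Filter.eventually_gt_atTop 0] with ρ hρ
    rw [norm_mul, norm_pow, Complex.norm_real, Real.norm_of_nonneg hρ.le, Complex.norm_exp,
      Real.rpow_natCast]
    simp
  have hcont : ∀ k : ℕ, ContinuousWithinAt (fun ρ : ℝ => (ρ : ℂ) ^ k * Complex.exp (-w * ρ))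
      (Set.Ici 0) 0 := fun k => (hder k 0).continuousAt.continuousWithinAt
  induction N with
  | zero =>
    have hi := (integrableOn_pow_mul_cexp 0 hw).const_mul (-w)
    have h := integral_Ioi_of_hasDerivAt_of_tendsto (hcont 0) (fun ρ _ => hder 0 ρ)
      (IntegrableOn.congr_fun hi (fun ρ _ => by simp [mul_comm]) measurableSet_Ioi) (hlim 0)
    simp only [Nat.cast_zero, pow_zero, zero_mul, zero_add, one_mul, Complex.ofReal_zero, mul_zero,
      Complex.exp_zero, integral_mul_const] at h
    simp only [pow_zero, one_mul, Nat.factorial_zero, Nat.cast_one, zero_add, pow_one]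
    rw [eq_div_iff hw0]
    linear_combination -h
  | succ N ih =>
    have hi1 := (integrableOn_pow_mul_cexp N hw).const_mul ((N : ℂ) + 1)
    have hi2 := (integrableOn_pow_mul_cexp (N + 1) hw).const_mul w
    have e : ∀ ρ : ℝ, (((N + 1 : ℕ) : ℂ) * (ρ : ℂ) ^ (N + 1 - 1)) * Complex.exp (-w * ρ) +
        (ρ : ℂ) ^ (N + 1) * (Complex.exp (-w * ρ) * -w) =
        ((N : ℂ) + 1) * ((ρ : ℂ) ^ N * Complex.exp (-w * ρ)) -
          w * ((ρ : ℂ) ^ (N + 1) * Complex.exp (-w * ρ)) := by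
      intro ρ
      simp only [Nat.add_sub_cancel]
      push_cast
      ring
    have h := integral_Ioi_of_hasDerivAt_of_tendsto (hcont (N + 1))
      (fun ρ _ => hder (N + 1) ρ)
      (IntegrableOn.congr_fun (hi1.sub hi2) (fun ρ _ => by simp only [e, Pi.sub_apply]) measurableSet_Ioi)
      (hlim (N + 1))
    simp only [e] at h
    rw [integral_sub hi1 hi2, integral_const_mul, integral_const_mul, ih] at h
    simp only [Complex.ofReal_zero, ne_eq, Nat.add_eq_zero_iff, one_ne_zero, and_false,
      not_false_eq_true, zero_pow, zero_mul, sub_zero] at h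
    rw [Nat.factorial_succ, pow_succ w (N + 1)]
    push_cast
    have h' : w * ∫ ρ in Set.Ioi (0 : ℝ), (ρ : ℂ) ^ (N + 1) * Complex.exp (-w * ρ) =
        ((N : ℂ) + 1) * (N.factorial / w ^ (N + 1)) := by linear_combination -h
    field_simp at h' ⊢
    linear_combination h'

/-- The first bound will provide decay in the scale, the second decay in τ. -/
theorem norm_add_mul_I_ge {s τ : ℝ} (hs : 1 ≤ s) :
    s ≤ ‖(s : ℂ) + 2 * Real.pi * τ * Complex.I‖ ∧
    (1 + |τ|) / 2 ≤ ‖(s : ℂ) + 2 * Real.pi * τ * Complex.I‖ := by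
  have h1 := Complex.abs_re_le_norm ((s : ℂ) + 2 * Real.pi * τ * Complex.I)
  have h2 := Complex.abs_im_le_norm ((s : ℂ) + 2 * Real.pi * τ * Complex.I)
  simp [abs_of_nonneg (zero_le_one.trans hs), abs_mul, abs_of_pos Real.pi_pos] at h1 h2
  have h3 : |τ| ≤ 2 * Real.pi * |τ| := by
    have := Real.pi_gt_three
    nlinarith [abs_nonneg τ]
  exact ⟨h1, by linarith⟩

/-- Fourier inversion for the function equal to ρ^N e^{-wρ} on ρ > 0 and to 0 elsewhere. For N ≥ 1
its transform decays at least quadratically, hence is integrable. -/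
theorem pow_mul_exp_eq_integral {N : ℕ} (hN : 1 ≤ N) {w : ℝ} (hw : 1 ≤ w) {ρ : ℝ} (hρ : 0 < ρ) :
    ∫ τ : ℝ, Complex.exp ((2 * Real.pi * τ * ρ : ℝ) * Complex.I) *
      ((N.factorial : ℂ) / ((w : ℂ) + 2 * Real.pi * τ * Complex.I) ^ (N + 1)) =
      ((ρ ^ N * Real.exp (-(w * ρ)) : ℝ) : ℂ) := by
  have hw0 : 0 < w := by linarith
  set f : ℝ → ℂ := (Set.Ioi (0 : ℝ)).indicator fun ρ => (ρ : ℂ) ^ N * Complex.exp (-(w : ℂ) * ρ)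
    with hf
  have hfi : Integrable f :=
    (integrable_indicator_iff measurableSet_Ioi).mpr (integrableOn_pow_mul_cexp N (w := (w : ℂ)) (by simpa))
  have hF : FourierTransform.fourier f = fun τ : ℝ =>
      (N.factorial : ℂ) / ((w : ℂ) + 2 * Real.pi * τ * Complex.I) ^ (N + 1) := by
    funext τ
    have h1 := integral_pow_mul_cexp N (w := (w : ℂ) + 2 * Real.pi * τ * Complex.I) (by simpa)
    rw [← h1, Real.fourier_eq', ← integral_indicator measurableSet_Ioi]
    refine integral_congr_ae (Filter.Eventually.of_forall fun x => ?_)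
    by_cases hx : x ∈ Set.Ioi (0 : ℝ)
    · simp only [hf, Set.indicator_of_mem hx, smul_eq_mul]
      rw [mul_left_comm, ← Complex.exp_add]
      congr 2
      simp
      ring
    · simp [hf, Set.indicator_of_notMem hx]
  have hFi : Integrable (FourierTransform.fourier f) := by
    rw [hF]
    refine Integrable.mono' (integrable_inv_one_add_sq.const_mul
      ((N.factorial : ℝ) * 4)) (Measurable.aestronglyMeasurable (by fun_prop)) ?_
    refine Filter.Eventually.of_forall fun τ => ?_
    obtain ⟨h1, h2⟩ := norm_add_mul_I_ge (τ := τ) hw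
    rw [norm_div, norm_pow, Complex.norm_natCast, div_eq_mul_inv, mul_assoc (N.factorial : ℝ)]
    refine mul_le_mul_of_nonneg_left ?_ (by positivity)
    generalize ‖(w : ℂ) + 2 * Real.pi * τ * Complex.I‖ = y at h1 h2 ⊢
    have hy : 1 ≤ y := hw.trans h1
    rw [← div_eq_mul_inv, ← one_div, div_le_div_iff₀ (by positivity) (by positivity), one_mul]
    have h3 : y ^ 2 ≤ y ^ (N + 1) := pow_le_pow_right₀ hy (by omega)
    have h4 : 0 ≤ |τ| := abs_nonneg τ
    rw [← sq_abs τ]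
    nlinarith
  have hinv := hfi.fourierInv_fourier_eq hFi (v := ρ) (by
    refine ContinuousAt.congr (f := fun ρ : ℝ => (ρ : ℂ) ^ N * Complex.exp (-(w : ℂ) * ρ))
      (by fun_prop) ?_
    filter_upwards [Ioi_mem_nhds hρ] with x hx
    rw [hf, Set.indicator_of_mem hx])
  rw [Real.fourierInv_eq', hF, hf, Set.indicator_of_mem (Set.mem_Ioi.mpr hρ)] at hinv
  push_cast
  rw [neg_mul] at hinv
  rw [← hinv]
  refine integral_congr_ae (Filter.Eventually.of_forall fun τ => ?_)
  simp
  left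
  congr 1
  ring

theorem integral_add_rpow_Ioi {b s : ℝ} (hb : 0 < b) (hs : 0 < s) :
    IntegrableOn (fun u : ℝ => (u + b) ^ (-s - 1)) (Set.Ioi 0) ∧
    ∫ u in Set.Ioi (0 : ℝ), (u + b) ^ (-s - 1) = s⁻¹ * b ^ (-s) := by
  have h1 := integrableOn_add_rpow_Ioi_of_lt (a := -s - 1) (c := 0) (m := b) (by linarith)
    (by linarith)
  refine ⟨h1, ?_⟩
  have hder : ∀ u ∈ Set.Ioi (0 : ℝ), HasDerivAt (fun u : ℝ => -s⁻¹ * (u + b) ^ (-s))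
      ((u + b) ^ (-s - 1)) u := by
    intro u hu
    have hu' : 0 < u := hu
    have := (((hasDerivAt_id u).add_const b).rpow_const (p := -s)
      (Or.inl (by simp only [id]; positivity))).const_mul (-s⁻¹)
    refine this.congr_deriv ?_
    simp only [id]
    field_simp
  have hcont : ContinuousWithinAt (fun u : ℝ => -s⁻¹ * (u + b) ^ (-s)) (Set.Ici 0) 0 := by
    refine ContinuousAt.continuousWithinAt (continuousAt_const.mul
      (ContinuousAt.rpow_const (by fun_prop) (Or.inl ?_)))
    simpa using hb.ne'
  have hlim : Filter.Tendsto (fun u : ℝ => -s⁻¹ * (u + b) ^ (-s)) Filter.atTop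
      (nhds (-s⁻¹ * 0)) :=
    ((tendsto_rpow_neg_atTop hs).comp
      (Filter.tendsto_atTop_add_const_right _ _ Filter.tendsto_id)).const_mul _
  rw [integral_Ioi_of_hasDerivAt_of_tendsto hcont hder h1 hlim]
  simp

/-! ### From oscillating to exponential kernels -/

/-- The density of the superposition. -/
def superWeight (n : ℕ) (b : ℝ) (q : ℝ × ℝ) : ℂ :=
  (q.1 : ℂ)⁻¹ * (((3 * n + 2).factorial : ℂ) /
    (((b / q.1 + 1 : ℝ) : ℂ) + 2 * Real.pi * q.2 * Complex.I) ^ (3 * n + 2 + 1))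

theorem measurable_superWeight (n : ℕ) (b : ℝ) : Measurable (superWeight n b) := by
  unfold superWeight
  fun_prop

/-- Let s = b/u+1, so su = u+b. The exponent 3n+3 of the denominator is spent as (2n+1)+(n+2). Of
the powers of s, n pay for s^n in the comparison below and n+1 combine with u^{-(n+1)} into
(u+b)^{-(n+1)}. Of the powers of 1+|τ|, n pay for (1+|τ|)^n and two remain for integrability in τ.
-/
theorem norm_superWeight_mul_le {n : ℕ} {α : ℝ} (hα0 : 0 ≤ α) (hαn : α ≤ n) {a b : ℝ} (hb : 0 < b)
    {u : ℝ} (hu : 0 < u) (τ : ℝ) :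
    ‖superWeight n b (u, τ)‖ * ((u ^ n)⁻¹ * (1 + |2 * Real.pi * τ - a / u|) ^ (-α)) ≤
      ((3 * n + 2).factorial * 2 ^ (n + 2) * 7 ^ n) * (‖(b : ℂ) + a * Complex.I‖ ^ (-α) *
        ((u + b) ^ (-(n - α) - 1) * (1 + τ ^ 2)⁻¹)) := by
  set s : ℝ := b / u + 1 with hs
  have hs1 : 1 ≤ s := by
    rw [hs]
    have : 0 < b / u := by positivity
    linarith
  have hs0 : 0 < s := by linarith
  have hsu : s * u = u + b := by
    rw [hs]
    field_simp
    ring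
  obtain ⟨h1, h2⟩ := norm_add_mul_I_ge (τ := τ) hs1
  have hy : ‖superWeight n b (u, τ)‖ = u⁻¹ * ((3 * n + 2).factorial *
      (‖(s : ℂ) + 2 * Real.pi * τ * Complex.I‖ ^ (3 * n + 2 + 1))⁻¹) := by
    rw [superWeight, norm_mul, norm_inv, norm_div, norm_pow, Complex.norm_natCast,
      Complex.norm_real, Real.norm_of_nonneg hu.le, div_eq_mul_inv]
  rw [hy]
  set y := ‖(s : ℂ) + 2 * Real.pi * τ * Complex.I‖ with hydef
  set t := |τ| with ht
  have ht0 : 0 ≤ t := abs_nonneg τ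
  have hβ : ‖(b : ℂ) + a * Complex.I‖ ≤ |a| + b := by
    refine (norm_add_le _ _).trans ?_
    simp [abs_of_pos hb, add_comm]
  have hβ0 : 0 < ‖(b : ℂ) + a * Complex.I‖ := by
    rw [norm_pos_iff]
    intro h
    have := congrArg Complex.re h
    simp at this
    linarith
  set B := ‖(b : ℂ) + a * Complex.I‖ with hB
  have hyp : (y ^ (3 * n + 2 + 1))⁻¹ ≤ (s ^ (2 * n + 1))⁻¹ * (2 ^ (n + 2) * ((1 + t) ^ (n + 2))⁻¹) := by
    have e : y ^ (3 * n + 2 + 1) = y ^ (2 * n + 1) * y ^ (n + 2) := by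
      rw [← pow_add]
      congr 1
      ring
    have h3 : s ^ (2 * n + 1) ≤ y ^ (2 * n + 1) := by gcongr
    have h4 : ((1 + t) / 2) ^ (n + 2) ≤ y ^ (n + 2) := by gcongr
    have e2 : 2 ^ (n + 2) * ((1 + t) ^ (n + 2))⁻¹ = (((1 + t) / 2) ^ (n + 2))⁻¹ := by
      rw [div_pow, inv_div]
      rfl
    rw [e, mul_inv, e2]
    gcongr
  have hpee : (1 + |2 * Real.pi * τ - a / u|) ^ (-α) ≤
      (7 ^ n * (1 + t) ^ n) * (s ^ n * (B / u) ^ (-α)) := by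
    set D := 1 + |2 * Real.pi * τ - a / u| with hD
    have hD0 : 0 < D := by positivity
    -- A Peetre-type inequality: |β|/u is at most 7(1+|τ|)·s·(1+|2πτ-a/u|), where 7 ≥ 2π. It trades
    -- decay in the shifted frequency for decay in |β|/u.
    have h5 : B / u ≤ (7 * (1 + t)) * s * D := by
      have h6 : |a| / u ≤ 2 * Real.pi * t + |2 * Real.pi * τ - a / u| := by
        have : |a| / u = |a / u| := by rw [abs_div, abs_of_pos hu]
        rw [this]
        calc |a / u| = |2 * Real.pi * τ - (2 * Real.pi * τ - a / u)| := by ring_nf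
          _ ≤ |2 * Real.pi * τ| + |2 * Real.pi * τ - a / u| := abs_sub _ _
          _ = _ := by rw [abs_mul, abs_of_pos (by positivity)]
      have h7 : B / u ≤ |a| / u + b / u := by
        rw [← add_div]
        gcongr
      have h8 : 2 * Real.pi ≤ 7 := by
        have := Real.pi_lt_d2
        linarith
      have h9 : 2 * Real.pi * t ≤ 7 * t := by gcongr
      have h10 : 0 ≤ |2 * Real.pi * τ - a / u| := abs_nonneg _
      have h11 : b / u = s - 1 := by rw [hs]; ring
      rw [hD]
      have h12 : |a| / u + b / u ≤ 7 * t + (D - 1) + (s - 1) := by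
        rw [h11, hD]
        linarith
      have h13 : 1 ≤ D := by rw [hD]; linarith
      have h14 : 7 * t + D + s ≤ (7 * (1 + t)) * s * D := by
        have : 1 ≤ s * D := by nlinarith
        nlinarith [mul_nonneg ht0 (by linarith : 0 ≤ s * D - 1), mul_nonneg (by linarith : 0 ≤ s - 1) (by linarith : 0 ≤ D - 1)]
      linarith
    have h15 : D ^ (-α) ≤ (B / u / ((7 * (1 + t)) * s)) ^ (-α) := by
      refine Real.rpow_le_rpow_of_nonpos (by positivity) ?_ (by linarith)
      rw [div_le_iff₀ (by positivity)]
      linarith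
    refine h15.trans ?_
    rw [Real.div_rpow (by positivity) (by positivity), div_eq_mul_inv, ← Real.rpow_neg (by positivity),
      neg_neg, Real.mul_rpow (by positivity) hs0.le]
    have h16 : (7 * (1 + t)) ^ α ≤ 7 ^ n * (1 + t) ^ n := by
      rw [← mul_pow, ← Real.rpow_natCast]
      exact Real.rpow_le_rpow_of_exponent_le (by linarith) hαn
    have h17 : s ^ α ≤ s ^ n := by
      rw [← Real.rpow_natCast]
      exact Real.rpow_le_rpow_of_exponent_le hs1 hαn
    calc (B / u) ^ (-α) * ((7 * (1 + t)) ^ α * s ^ α)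
        ≤ (B / u) ^ (-α) * ((7 ^ n * (1 + t) ^ n) * s ^ n) := by gcongr
      _ = _ := by ring
  have hBu : (B / u) ^ (-α) ≤ B ^ (-α) * (u + b) ^ α := by
    rw [Real.div_rpow hβ0.le hu.le, Real.rpow_neg hu.le, div_inv_eq_mul]
    gcongr
    linarith
  have hτ : ((1 + t) ^ 2)⁻¹ ≤ (1 + τ ^ 2)⁻¹ := by
    apply inv_anti₀ (by positivity)
    rw [← sq_abs τ, ← ht]
    nlinarith
  have hub : (u + b) ^ (-(n - α) - 1) = ((u + b) ^ (n + 1))⁻¹ * (u + b) ^ α := by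
    have hub0 : 0 < u + b := by positivity
    rw [← Real.rpow_natCast, ← Real.rpow_neg hub0.le, ← Real.rpow_add hub0]
    congr 1
    push_cast
    ring
  rw [hub]
  calc u⁻¹ * ((3 * n + 2).factorial * (y ^ (3 * n + 2 + 1))⁻¹) *
        ((u ^ n)⁻¹ * (1 + |2 * Real.pi * τ - a / u|) ^ (-α))
      ≤ u⁻¹ * ((3 * n + 2).factorial * ((s ^ (2 * n + 1))⁻¹ * (2 ^ (n + 2) * ((1 + t) ^ (n + 2))⁻¹))) *
        ((u ^ n)⁻¹ * ((7 ^ n * (1 + t) ^ n) * (s ^ n * (B / u) ^ (-α)))) := by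
        gcongr
    _ = ((3 * n + 2).factorial * 2 ^ (n + 2) * 7 ^ n) * ((B / u) ^ (-α) *
        (((u + b) ^ (n + 1))⁻¹ * ((1 + t) ^ 2)⁻¹)) := by
        rw [← hsu, mul_pow, show 2 * n + 1 = n + 1 + n by ring, pow_add s, pow_add (1 + t) n 2,
          pow_succ u]
        field_simp
    _ ≤ ((3 * n + 2).factorial * 2 ^ (n + 2) * 7 ^ n) * ((B ^ (-α) * (u + b) ^ α) *
        (((u + b) ^ (n + 1))⁻¹ * (1 + τ ^ 2)⁻¹)) := by gcongr
    _ = _ := by ring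

/-- A continuous nonnegative nonzero function supported in `[1, 2]`. -/
structure IsRadialBump (χ : ℝ → ℝ) : Prop where
  cont : Continuous χ
  nonneg : ∀ s, 0 ≤ χ s
  zero : ∀ s, s ∉ Set.Icc (1 : ℝ) 2 → χ s = 0
  ne : ∃ s, χ s ≠ 0

/-! ### Superposition of dilated oscillating kernels -/

section Superposition

variable {χ : ℝ → ℝ} {n : ℕ}

theorem IsRadialBump.hasCompactSupport (hχ : IsRadialBump χ) : HasCompactSupport χ :=
  HasCompactSupport.intro isCompact_Icc hχ.zero

theorem IsRadialBump.integrable_norm (hχ : IsRadialBump χ) :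
    Integrable (fun x : EuclideanSpace ℝ (Fin n) => χ ‖x‖) := by
  refine Continuous.integrable_of_hasCompactSupport (hχ.cont.comp continuous_norm) ?_
  refine HasCompactSupport.intro (isCompact_closedBall 0 2) fun x hx => hχ.zero _ fun h => hx ?_
  simpa using h.2

/-- For fixed u, Fourier inversion at ρ = ur with w = b/u+1 evaluates the τ-integral as
(ur)^{3n+2}e^{-br}e^{-ur}, and the phase (a/u)(ur) = ar does not depend on u. What remains is the
integral of u⁻¹(ur)^{3n+2}e^{-ur}χ(ur) over u; it is invariant under scaling, so it is a constant
independent of r. -/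
theorem exists_integral_superWeight (hχ : IsRadialBump χ) (n : ℕ) : ∃ κ : ℝ, 0 < κ ∧ ∀ a b r : ℝ,
    0 < b → 0 < r →
    ∫ u in Set.Ioi (0 : ℝ), ∫ τ, superWeight n b (u, τ) *
      (Complex.exp (((2 * Real.pi * τ - a / u) * (u * r) : ℝ) * Complex.I) * χ (u * r)) =
      κ * Complex.exp (-((b : ℂ) + a * Complex.I) * r) := by
  set g : ℝ → ℝ := fun s => χ s * (Real.exp (-s) * s ^ (3 * n + 1)) with hg
  have hg0 : ∀ s, s ≤ 0 → g s = 0 := by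
    intro s hs
    rw [hg]
    simp only
    rw [hχ.zero s (fun h => by linarith [h.1]), zero_mul]
  have hgnn : 0 ≤ g := by
    intro s
    by_cases hs : s ≤ 0
    · rw [hg0 s hs]
      simp
    · push Not at hs
      exact mul_nonneg (hχ.nonneg s) (by positivity)
  have hgc : Continuous g := by
    have := hχ.cont
    fun_prop
  have hgs : HasCompactSupport g := hχ.hasCompactSupport.mul_right
  have hκ : 0 < ∫ s, g s := by
    obtain ⟨s, hs⟩ := hχ.ne
    refine hgc.integral_pos_of_hasCompactSupport_nonneg_nonzero hgs hgnn (x := s) ?_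
    have h1 : s ∈ Set.Icc (1 : ℝ) 2 := by
      by_contra h
      exact hs (hχ.zero s h)
    have h2 : (0 : ℝ) < s := by linarith [h1.1]
    exact mul_ne_zero hs (by positivity)
  refine ⟨∫ s, g s, hκ, fun a b r hb hr => ?_⟩
  have hset : ∫ s in Set.Ioi (0 : ℝ), g s = ∫ s, g s :=
    setIntegral_eq_integral_of_forall_compl_eq_zero fun s hs => hg0 s (not_lt.mp hs)
  have h1 : ∀ u ∈ Set.Ioi (0 : ℝ), ∫ τ, superWeight n b (u, τ) *
      (Complex.exp (((2 * Real.pi * τ - a / u) * (u * r) : ℝ) * Complex.I) * χ (u * r)) =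
      Complex.exp (-((b : ℂ) + a * Complex.I) * r) * ((r * g (r * u) : ℝ) : ℂ) := by
    intro u hu
    have hu' : 0 < u := hu
    have huC : (u : ℂ) ≠ 0 := by exact_mod_cast hu'.ne'
    have h2 := pow_mul_exp_eq_integral (N := 3 * n + 2) (by omega) (w := b / u + 1)
      (by have : 0 < b / u := by positivity
          linarith) (ρ := u * r) (by positivity)
    have h3 : ∀ τ : ℝ, superWeight n b (u, τ) *
        (Complex.exp (((2 * Real.pi * τ - a / u) * (u * r) : ℝ) * Complex.I) * χ (u * r)) =
        ((u : ℂ)⁻¹ * Complex.exp (-(a * r : ℝ) * Complex.I) * χ (u * r)) *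
        (Complex.exp ((2 * Real.pi * τ * (u * r) : ℝ) * Complex.I) *
          (((3 * n + 2).factorial : ℂ) /
            (((b / u + 1 : ℝ) : ℂ) + 2 * Real.pi * τ * Complex.I) ^ (3 * n + 2 + 1))) := by
      intro τ
      have e1 : (((2 * Real.pi * τ - a / u) * (u * r) : ℝ) : ℂ) * Complex.I =
          -(a * r : ℝ) * Complex.I + (2 * Real.pi * τ * (u * r) : ℝ) * Complex.I := by
        push_cast
        field_simp
        ring
      rw [e1, Complex.exp_add, superWeight]
      ring
    rw [funext h3, integral_const_mul, h2]
    have e2 : Complex.exp (-((b : ℂ) + a * Complex.I) * r) =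
        Complex.exp (-(a * r : ℝ) * Complex.I) * ((Real.exp (-(b * r)) : ℝ) : ℂ) := by
      rw [Complex.ofReal_exp, ← Complex.exp_add]
      congr 1
      push_cast
      ring
    have e3 : Real.exp (-((b / u + 1) * (u * r))) = Real.exp (-(b * r)) * Real.exp (-(r * u)) := by
      rw [← Real.exp_add]
      congr 1
      field_simp
      ring
    rw [e2, e3, hg]
    simp only
    rw [mul_comm u r, pow_succ (r * u) (3 * n + 1)]
    push_cast
    field_simp
  rw [setIntegral_congr_fun measurableSet_Ioi h1, integral_const_mul, integral_complex_ofReal,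
    integral_const_mul, integral_comp_mul_left_Ioi g 0 hr, mul_zero, hset, smul_eq_mul,
    mul_inv_cancel_left₀ hr.ne', mul_comm]

/-- Bounds for oscillating radial kernels imply bounds for exponential kernels. -/
theorem exists_exp_kernel_bound (hχ : IsRadialBump χ) (hn : 1 ≤ n) {α : ℝ} (hα0 : 0 ≤ α)
    (hαn : α < n) {𝒞 : Set (EuclideanSpace ℝ (Fin n) → ℂ)}
    (hmeas : ∀ c ∈ 𝒞, AEStronglyMeasurable c) (hbd : ∀ c ∈ 𝒞, ∀ x, ‖c x‖ ≤ 1)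
    (hdil : ∀ c ∈ 𝒞, ∀ R : ℝ, 0 < R → (fun x => c (R • x)) ∈ 𝒞) {C₀ : ℝ} (hC₀ : 0 ≤ C₀)
    (hosc : ∀ c ∈ 𝒞, ∀ μ : ℝ, ‖∫ x, Complex.exp ((μ * ‖x‖ : ℝ) * Complex.I) * χ ‖x‖ * c x‖ ≤
      C₀ * (1 + |μ|) ^ (-α)) :
    ∃ M : ℝ, 0 ≤ M ∧ ∀ c ∈ 𝒞, ∀ β : ℂ, 0 < β.re →
      ‖∫ x, Complex.exp (-β * ‖x‖) * c x‖ ≤ M * (‖β‖ ^ (-α) * β.re ^ (α - n)) := by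
  have : Nonempty (Fin n) := ⟨⟨0, hn⟩⟩
  obtain ⟨κ, hκ, hrep⟩ := exists_integral_superWeight hχ n
  set C₁ : ℝ := (3 * n + 2).factorial * 2 ^ (n + 2) * 7 ^ n with hC₁
  have hC₁0 : 0 ≤ C₁ := by positivity
  set T : ℝ := ∫ τ : ℝ, (1 + τ ^ 2)⁻¹ with hT
  have hT0 : 0 ≤ T := integral_nonneg fun τ => by positivity
  have hnα : 0 < (n : ℝ) - α := by linarith
  refine ⟨κ⁻¹ * (C₀ * C₁ * ((n - α)⁻¹ * T)), by positivity, fun c hc β hβ => ?_⟩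
  set a := β.im with ha
  set b := β.re with hb
  have hβab : (b : ℂ) + a * Complex.I = β := Complex.re_add_im β
  set ν : Measure (ℝ × ℝ) := (volume.restrict (Set.Ioi 0)).prod volume with hν
  set Φ : EuclideanSpace ℝ (Fin n) → ℝ × ℝ → ℂ := fun x q => superWeight n b q *
    (Complex.exp (((2 * Real.pi * q.2 - a / q.1) * (q.1 * ‖x‖) : ℝ) * Complex.I) *
      χ (q.1 * ‖x‖)) with hΦ
  have hΦm : Measurable (Function.uncurry Φ) := by
    have h1 := measurable_superWeight n b
    have h2 := hχ.cont.measurable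
    rw [hΦ]
    unfold Function.uncurry
    fun_prop
  have hνpos : ∀ᵐ q ∂ν, 0 < q.1 :=
    Measure.quasiMeasurePreserving_fst.ae (ae_restrict_mem measurableSet_Ioi)
  have hΦn : ∀ x q, ‖Φ x q‖ = ‖superWeight n b q‖ * χ ‖q.1 • x‖ * 1 ∨ ¬ 0 < q.1 := by
    intro x q
    by_cases hq : 0 < q.1
    · left
      simp only [hΦ]
      rw [norm_mul, norm_mul, Complex.norm_exp_ofReal_mul_I, one_mul, Complex.norm_real, norm_smul,
        Real.norm_of_nonneg hq.le, Real.norm_of_nonneg (hχ.nonneg _), mul_one]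
    · exact Or.inr hq
  have hdom : Integrable (fun q : ℝ × ℝ => (q.1 + b) ^ (-((n : ℝ) - α) - 1) * (1 + q.2 ^ 2)⁻¹) ν :=
    (integral_add_rpow_Ioi hβ hnα).1.mul_prod integrable_inv_one_add_sq
  -- The instance α = 0 dominates the absolute integral needed for Fubini; the instance above is for
  -- the final estimate.
  have hdom0 : Integrable (fun q : ℝ × ℝ => (q.1 + b) ^ (-((n : ℝ) - 0) - 1) * (1 + q.2 ^ 2)⁻¹) ν :=
    (integral_add_rpow_Ioi hβ (by linarith : 0 < (n : ℝ) - 0)).1.mul_prod integrable_inv_one_add_sq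
  have hΦi : Integrable (Function.uncurry Φ) (volume.prod ν) := by
    rw [integrable_prod_iff' hΦm.aestronglyMeasurable]
    constructor
    · filter_upwards [hνpos] with q hq
      refine Integrable.mono' (((integrable_comp_smul_iff volume
        (fun x : EuclideanSpace ℝ (Fin n) => χ ‖x‖) hq.ne').mpr hχ.integrable_norm).const_mul
        ‖superWeight n b q‖) (hΦm.comp (measurable_id.prodMk measurable_const)).aestronglyMeasurable
        (Filter.Eventually.of_forall fun x => ?_)
      rcases hΦn x q with h | h
      · exact (h.trans (mul_one _)).le
      · exact absurd hq h
    · refine Integrable.mono' (hdom0.const_mul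
        ((∫ x : EuclideanSpace ℝ (Fin n), χ ‖x‖) * (C₁ * ‖β‖ ^ (-(0 : ℝ))))) ?_ ?_
      · exact (hΦm.norm.stronglyMeasurable.integral_prod_left' (μ := volume)).aestronglyMeasurable
      filter_upwards [hνpos] with q hq
      have h1 : ∫ x, ‖Function.uncurry Φ (x, q)‖ =
          ‖superWeight n b q‖ * ((q.1 ^ n)⁻¹ * ∫ x : EuclideanSpace ℝ (Fin n), χ ‖x‖) := by
        have h2 := Measure.integral_comp_smul (volume : Measure (EuclideanSpace ℝ (Fin n)))
          (fun x => χ ‖x‖) q.1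
        rw [finrank_euclideanSpace, Fintype.card_fin, abs_of_pos (by positivity), smul_eq_mul] at h2
        rw [← h2, ← integral_const_mul]
        refine integral_congr_ae (Filter.Eventually.of_forall fun x => ?_)
        rcases hΦn x q with h | h
        · exact h.trans (mul_one _)
        · exact absurd hq h
      have h3 := norm_superWeight_mul_le (n := n) le_rfl (Nat.cast_nonneg n) (a := a) hβ hq q.2
      rw [hβab, neg_zero, Real.rpow_zero, mul_one] at h3
      have h4 : 0 ≤ ∫ x : EuclideanSpace ℝ (Fin n), χ ‖x‖ := integral_nonneg fun x => hχ.nonneg _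
      rw [h1, Real.norm_of_nonneg (by positivity)]
      calc _ = (∫ x : EuclideanSpace ℝ (Fin n), χ ‖x‖) *
            (‖superWeight n b (q.1, q.2)‖ * (q.1 ^ n)⁻¹) := by ring
        _ ≤ _ := mul_le_mul_of_nonneg_left h3 h4
        _ = _ := by
          rw [neg_zero, Real.rpow_zero]
          ring
  have hΦci : Integrable (Function.uncurry fun x q => Φ x q * c x) (volume.prod ν) := by
    refine hΦi.mul_bdd (c := 1) (hmeas c hc).comp_fst ?_
    exact Filter.Eventually.of_forall fun q => hbd c hc q.1
  have h1 : (κ : ℂ) * ∫ x, Complex.exp (-β * ‖x‖) * c x = ∫ q, (∫ x, Φ x q * c x) ∂ν := by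
    rw [← integral_integral_swap hΦci, ← integral_const_mul]
    refine integral_congr_ae ?_
    filter_upwards [compl_mem_ae_iff.mpr (measure_singleton (0 : EuclideanSpace ℝ (Fin n))),
      hΦi.prod_right_ae] with x hx hxi
    have hx' : 0 < ‖x‖ := norm_pos_iff.mpr hx
    rw [integral_mul_const, ← mul_assoc, ← hβab, ← hrep a b ‖x‖ hβ hx']
    congr 1
    exact (integral_prod _ hxi).symm
  have h2 : ‖∫ q, (∫ x, Φ x q * c x) ∂ν‖ ≤ ∫ q : ℝ × ℝ, (C₀ * C₁ * ‖β‖ ^ (-α)) *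
      ((q.1 + b) ^ (-((n : ℝ) - α) - 1) * (1 + q.2 ^ 2)⁻¹) ∂ν := by
    refine norm_integral_le_of_norm_le (hdom.const_mul _) ?_
    filter_upwards [hνpos] with q hq
    -- Rescaling x by u⁻¹ brings the oscillating kernel to unit scale with frequency 2πτ-a/u, and
    -- moves the dilation onto c, which stays in the class.
    have h3 : ∫ x, Φ x q * c x = superWeight n b q * (((q.1 ^ n)⁻¹ : ℝ) *
        ∫ x : EuclideanSpace ℝ (Fin n),
          Complex.exp (((2 * Real.pi * q.2 - a / q.1) * ‖x‖ : ℝ) * Complex.I) * χ ‖x‖ *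
            c (q.1⁻¹ • x)) := by
      have h4 := Measure.integral_comp_smul (volume : Measure (EuclideanSpace ℝ (Fin n)))
        (fun x => Complex.exp (((2 * Real.pi * q.2 - a / q.1) * ‖x‖ : ℝ) * Complex.I) * χ ‖x‖ *
            c (q.1⁻¹ • x)) q.1
      rw [finrank_euclideanSpace, Fintype.card_fin, abs_of_pos (by positivity),
        Complex.real_smul] at h4
      rw [← h4, ← integral_const_mul]
      refine integral_congr_ae (Filter.Eventually.of_forall fun x => ?_)
      simp only [hΦ, norm_smul, Real.norm_of_nonneg hq.le, inv_smul_smul₀ hq.ne']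
      ring
    have h5 := hosc _ (hdil c hc _ (inv_pos.mpr hq)) (2 * Real.pi * q.2 - a / q.1)
    have h6 := norm_superWeight_mul_le (n := n) hα0 hαn.le (a := a) hβ hq q.2
    rw [hβab] at h6
    rw [h3, norm_mul, norm_mul, Complex.norm_real, Real.norm_of_nonneg (by positivity)]
    calc _ ≤ ‖superWeight n b q‖ * ((q.1 ^ n)⁻¹ *
          (C₀ * (1 + |2 * Real.pi * q.2 - a / q.1|) ^ (-α))) := by gcongr
      _ = C₀ * (‖superWeight n b (q.1, q.2)‖ * ((q.1 ^ n)⁻¹ *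
          (1 + |2 * Real.pi * q.2 - a / q.1|) ^ (-α))) := by ring
      _ ≤ C₀ * _ := mul_le_mul_of_nonneg_left h6 hC₀
      _ = _ := by ring
  -- The u-integral equals b^{α-n}/(n-α), which is finite because α < n; it provides the factor (Re
  -- β)^{α-n}.
  rw [integral_const_mul, integral_prod_mul (fun u : ℝ => (u + b) ^ (-((n : ℝ) - α) - 1))
    (fun τ : ℝ => (1 + τ ^ 2)⁻¹), (integral_add_rpow_Ioi hβ hnα).2, ← h1, norm_mul,
    Complex.norm_real, Real.norm_of_nonneg hκ.le] at h2
  rw [mul_assoc κ⁻¹, ← div_eq_inv_mul, le_div_iff₀ hκ, mul_comm]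
  refine h2.trans_eq ?_
  rw [neg_sub]
  ring

end Superposition

/-! ### The chart relating `projPhase` to the distance function -/

section Chart

variable {m : ℕ}

/-- The projective chart `x ↦ M (x', δ) / (1 + xₙ)`. -/
def projChart (M δ : ℝ) (x : EuclideanSpace ℝ (Fin (m + 1))) : EuclideanSpace ℝ (Fin (m + 1)) :=
  (M / (1 + x (Fin.last m))) • snocL m (((snocL m).symm x).1, δ)

theorem projChart_last (M δ : ℝ) (x : EuclideanSpace ℝ (Fin (m + 1))) :
    projChart M δ x (Fin.last m) = M * δ / (1 + x (Fin.last m)) := by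
  simp [projChart]
  ring

theorem projChart_sub {M δ : ℝ} {x : EuclideanSpace ℝ (Fin (m + 1))}
    (hx : 0 < 1 + x (Fin.last m)) (ξ : EuclideanSpace ℝ (Fin m)) :
    projChart M δ x - snocL m ((-M) • ξ, 0) = (M / (1 + x (Fin.last m))) •
      snocL m (((snocL m).symm x).1 + (1 + x (Fin.last m)) • ξ, δ) := by
  rw [projChart, ← map_smul, ← map_smul, ← map_sub]
  congr 1
  ext i
  · simp
    field_simp
  · simp

/-- The identity behind the whole reduction: in the projective chart, with y = -Mξ, the distance
from X to (y, 0) is M times the straight phase. -/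
theorem norm_projChart_sub {M δ : ℝ} (hM : 0 < M) {x : EuclideanSpace ℝ (Fin (m + 1))}
    (hx : 0 < 1 + x (Fin.last m)) (ξ : EuclideanSpace ℝ (Fin m)) :
    ‖projChart M δ x - snocL m ((-M) • ξ, 0)‖ = M * projPhase δ x ξ := by
  rw [projChart_sub hx, norm_smul, Real.norm_of_nonneg (by positivity), projPhase, regNorm]
  have h := norm_snocL_sq (((snocL m).symm x).1 + (1 + x (Fin.last m)) • ξ, δ)
  dsimp only at h
  rw [← h, Real.sqrt_sq (norm_nonneg _)]
  ring

theorem contDiffOn_projChart (M δ : ℝ) :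
    ContDiffOn ℝ ∞ (projChart (m := m) M δ) {x | 0 < 1 + x (Fin.last m)} := by
  unfold projChart
  have h1 : ContDiff ℝ ∞ fun x : EuclideanSpace ℝ (Fin (m + 1)) => 1 + x (Fin.last m) := by
    fun_prop
  have h2 : ContDiff ℝ ∞ fun x : EuclideanSpace ℝ (Fin (m + 1)) =>
      snocL m (((snocL m).symm x).1, δ) :=
    (snocL m).contDiff.comp ((contDiff_fst.comp (snocL m).symm.contDiff).prodMk contDiff_const)
  exact (contDiffOn_const.div h1.contDiffOn fun x hx => ne_of_gt hx).smul h2.contDiffOn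

theorem isOpen_one_add_last_pos :
    IsOpen {x : EuclideanSpace ℝ (Fin (m + 1)) | 0 < 1 + x (Fin.last m)} :=
  isOpen_lt continuous_const (by fun_prop)

theorem injOn_projChart {M δ : ℝ} (hM : 0 < M) (hδ : 0 < δ) :
    Set.InjOn (projChart (m := m) M δ) {x | 0 < 1 + x (Fin.last m)} := by
  intro x hx y hy h
  have hx' : 0 < 1 + x (Fin.last m) := hx
  have hy' : 0 < 1 + y (Fin.last m) := hy
  have h1 : x (Fin.last m) = y (Fin.last m) := by
    have h2 := congrArg (fun z => z (Fin.last m)) h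
    simp only [projChart_last] at h2
    rw [div_eq_div_iff hx'.ne' hy'.ne'] at h2
    have := mul_left_cancel₀ (mul_pos hM hδ).ne' h2
    linarith
  have h3 : snocL m (((snocL m).symm x).1, δ) = snocL m (((snocL m).symm y).1, δ) := by
    have h4 := h
    rw [projChart, projChart, h1] at h4
    exact smul_right_injective _ (div_pos hM hy').ne' h4
  have h5 : ((snocL m).symm x).1 = ((snocL m).symm y).1 :=
    (Prod.mk.inj ((snocL m).injective h3)).1
  exact (snocL m).symm.injective (Prod.ext h5 h1)

theorem image_projChart {M δ : ℝ} (hM : 0 < M) (hδ : 0 < δ) :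
    projChart (m := m) M δ '' {x | 0 < 1 + x (Fin.last m)} = {X | 0 < X (Fin.last m)} := by
  ext X
  constructor
  · rintro ⟨x, hx, rfl⟩
    have hx' : 0 < 1 + x (Fin.last m) := hx
    simp only [Set.mem_ofPred_eq, projChart_last]
    positivity
  · intro hX
    have hX' : 0 < X (Fin.last m) := hX
    refine ⟨snocL m ((δ / X (Fin.last m)) • ((snocL m).symm X).1,
      M * δ / X (Fin.last m) - 1), ?_, ?_⟩
    · simp only [Set.mem_ofPred_eq, snocL_last]
      have : 0 < M * δ / X (Fin.last m) := by positivity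
      linarith
    · rw [projChart, ← map_smul]
      apply (snocL m).symm.injective
      ext i
      · simp
        field_simp
      · simp
        field_simp

/-- The region swept out by the chart: `κ ≤ 1 + xₙ ≤ 1`, `|x'| ≤ 2r`. -/
def chartRegion (m : ℕ) (κ r : ℝ) : Set (EuclideanSpace ℝ (Fin (m + 1))) :=
  {x | (κ ≤ 1 + x (Fin.last m) ∧ 1 + x (Fin.last m) ≤ 1) ∧ ‖((snocL m).symm x).1‖ ≤ 2 * r}

theorem isClosed_chartRegion (κ r : ℝ) : IsClosed (chartRegion m κ r) := by
  have h : Continuous fun x : EuclideanSpace ℝ (Fin (m + 1)) => 1 + x (Fin.last m) := by fun_prop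
  refine IsClosed.inter (IsClosed.inter ?_ ?_) ?_
  · exact isClosed_le continuous_const h
  · exact isClosed_le h continuous_const
  · exact isClosed_le (continuous_norm.comp (continuous_fst.comp (snocL m).symm.continuous))
      continuous_const

/-- There -1 < xₙ ≤ 0, so xₙ² ≤ -xₙ ≤ 1-κ, which leaves room for |x'|² ≤ 4r² < κ. -/
theorem chartRegion_subset_ball {κ r : ℝ} (hκ : 0 < κ) (hr : 4 * r ^ 2 < κ) :
    chartRegion m κ r ⊆ ball 0 1 := by
  rintro x ⟨⟨h1, h2⟩, h3⟩
  rw [mem_ball_zero_iff, ← sq_lt_one_iff₀ (norm_nonneg _)]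
  have h4 := norm_snocL_sq ((snocL m).symm x)
  rw [ContinuousLinearEquiv.apply_symm_apply, snocL_symm_snd] at h4
  rw [h4]
  have h5 : ‖((snocL m).symm x).1‖ ^ 2 ≤ (2 * r) ^ 2 := by gcongr
  nlinarith

theorem isCompact_chartRegion {κ r : ℝ} (hκ : 0 < κ) (hr : 4 * r ^ 2 < κ) :
    IsCompact (chartRegion m κ r) :=
  Metric.isCompact_of_isClosed_isBounded (isClosed_chartRegion κ r)
    (isBounded_ball.subset (chartRegion_subset_ball hκ hr))

/-- The amplitude obtained from `A` in the chart. -/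
def chartAmp (A : EuclideanSpace ℝ (Fin (m + 1)) → ℝ) (w : EuclideanSpace ℝ (Fin m) → ℝ)
    (M δ : ℝ) (x : EuclideanSpace ℝ (Fin (m + 1))) (ξ : EuclideanSpace ℝ (Fin m)) : ℝ :=
  A (projChart M δ x - snocL m ((-M) • ξ, 0)) * w ξ

/-- With Mδ = c the height of X is c/(1+xₙ), so heights between c and ρ mean c/ρ ≤ 1+xₙ ≤ 1. The
bound |X-(y,0)| ≤ ρ ≤ Mr gives |x'+(1+xₙ)ξ| ≤ r, hence |x'| ≤ 2r. A large M thus confines x' to a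
small ball. -/
theorem mem_chartRegion {A : EuclideanSpace ℝ (Fin (m + 1)) → ℝ} {c ρ M r δ : ℝ}
    (hc : 0 < c) (hρ : c ≤ ρ) (hA : ∀ x, A x ≠ 0 → c ≤ x (Fin.last m) ∧ ‖x‖ ≤ ρ)
    (hM : 0 < M) (hδ : M * δ = c) (hMr : ρ ≤ M * r)
    {x : EuclideanSpace ℝ (Fin (m + 1))} {ξ : EuclideanSpace ℝ (Fin m)} (hξ : ‖ξ‖ ≤ r)
    (hx : A (projChart M δ x - snocL m ((-M) • ξ, 0)) ≠ 0) :
    x ∈ chartRegion m (c / ρ) r := by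
  have hρ0 : 0 < ρ := hc.trans_le hρ
  obtain ⟨h1, h2⟩ := hA _ hx
  have h3 := (le_abs_self _).trans ((abs_last_le_norm _).trans h2)
  rw [PiLp.sub_apply, snocL_last, projChart_last, sub_zero, hδ] at h1 h3
  have hs : 0 < 1 + x (Fin.last m) := by
    by_contra hs
    have := div_nonpos_of_nonneg_of_nonpos hc.le (not_lt.mp hs)
    linarith
  rw [le_div_iff₀ hs] at h1
  rw [div_le_iff₀ hs] at h3
  have hs1 : 1 + x (Fin.last m) ≤ 1 := by nlinarith
  refine ⟨⟨?_, hs1⟩, ?_⟩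
  · rw [div_le_iff₀ hρ0]
    linarith
  · rw [projChart_sub hs, norm_smul, Real.norm_of_nonneg (by positivity)] at h2
    have h4 : ‖((snocL m).symm x).1 + (1 + x (Fin.last m)) • ξ‖ ≤
        ‖snocL m (((snocL m).symm x).1 + (1 + x (Fin.last m)) • ξ, δ)‖ := by
      refine le_of_sq_le_sq ?_ (norm_nonneg _)
      rw [norm_snocL_sq]
      have := sq_nonneg δ
      simpa using this
    rw [div_mul_eq_mul_div, div_le_iff₀ hs] at h2
    have h5 : M * ‖((snocL m).symm x).1 + (1 + x (Fin.last m)) • ξ‖ ≤ M * r := by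
      refine (mul_le_mul_of_nonneg_left h4 hM.le).trans (h2.trans (le_trans ?_ hMr))
      nlinarith
    have h6 := le_of_mul_le_mul_left h5 hM
    have h7 : ‖(1 + x (Fin.last m)) • ξ‖ ≤ r := by
      rw [norm_smul, Real.norm_of_nonneg hs.le]
      nlinarith [norm_nonneg ξ]
    have h8 := norm_sub_le (((snocL m).symm x).1 + (1 + x (Fin.last m)) • ξ)
      ((1 + x (Fin.last m)) • ξ)
    rw [add_sub_cancel_right] at h8
    linarith

theorem isAmplitude_chartAmp {A : EuclideanSpace ℝ (Fin (m + 1)) → ℝ} {c ρ M r δ : ℝ}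
    {w : EuclideanSpace ℝ (Fin m) → ℝ} (hAs : ContDiff ℝ ∞ A) (hA0 : ∀ x, 0 ≤ A x)
    (hc : 0 < c) (hρ : c ≤ ρ) (hA : ∀ x, A x ≠ 0 → c ≤ x (Fin.last m) ∧ ‖x‖ ≤ ρ)
    (hM : 0 < M) (hδ : M * δ = c) (hMr : ρ ≤ M * r) (hr1 : r < 1) (hr : 4 * r ^ 2 < c / ρ)
    (hws : ContDiff ℝ ∞ w) (hw0 : ∀ ξ, 0 ≤ w ξ) (hw : ∀ ξ, w ξ ≠ 0 → ‖ξ‖ ≤ r) :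
    IsAmplitude (n := m + 1) (chartAmp A w M δ) := by
  have hκ : 0 < c / ρ := div_pos hc (hc.trans_le hρ)
  have hsub : Function.support (Function.uncurry (chartAmp A w M δ)) ⊆
      chartRegion m (c / ρ) r ×ˢ closedBall 0 r := by
    rintro ⟨x, ξ⟩ hx
    have hx' : A (projChart M δ x - snocL m ((-M) • ξ, 0)) * w ξ ≠ 0 := hx
    have hξ := hw ξ (right_ne_zero_of_mul hx')
    exact ⟨mem_chartRegion hc hρ hA hM hδ hMr hξ (left_ne_zero_of_mul hx'),
      mem_closedBall_zero_iff.mpr hξ⟩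
  have hK : IsCompact (chartRegion m (c / ρ) r ×ˢ
      closedBall (0 : EuclideanSpace ℝ (Fin m)) r) :=
    (isCompact_chartRegion hκ hr).prod (isCompact_closedBall 0 r)
  have hts := closure_minimal hsub hK.isClosed
  refine ⟨?_, hK.of_isClosed_subset isClosed_closure hts, ?_, ?_⟩
  · rw [contDiff_iff_contDiffAt]
    rintro ⟨x, ξ⟩
    by_cases hx : 0 < 1 + x (Fin.last m)
    · have h1 : ContDiffAt ℝ ∞ (projChart M δ) x :=
        (contDiffOn_projChart M δ).contDiffAt (isOpen_one_add_last_pos.mem_nhds hx)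
      have h2 : ContDiffAt ℝ ∞ (fun z : EuclideanSpace ℝ (Fin (m + 1)) ×
          EuclideanSpace ℝ (Fin m) => projChart M δ z.1) (x, ξ) :=
        ContDiffAt.comp (x, ξ) (g := projChart M δ) h1 contDiffAt_fst
      have h3 : ContDiff ℝ ∞ (fun z : EuclideanSpace ℝ (Fin (m + 1)) ×
          EuclideanSpace ℝ (Fin m) => snocL m ((-M) • z.2, 0)) :=
        (snocL m).contDiff.comp ((contDiff_snd.const_smul (-M)).prodMk contDiff_const)
      exact (hAs.contDiffAt.comp (x, ξ) (h2.sub h3.contDiffAt)).mul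
        (hws.contDiffAt.comp (x, ξ) contDiffAt_snd)
    -- Where the chart is singular, the point lies off the closed support, so the amplitude vanishes
    -- near it.
    · have hmem : (x, ξ) ∉ tsupport (Function.uncurry (chartAmp A w M δ)) := fun h =>
        hx (one_add_last_pos (chartRegion_subset_ball hκ hr (hts h).1))
      exact (contDiffAt_const (c := (0 : ℝ))).congr_of_eventuallyEq
        (notMem_tsupport_iff_eventuallyEq.mp hmem)
  · exact hts.trans (Set.prod_mono (chartRegion_subset_ball hκ hr)
      (closedBall_subset_ball hr1))
  · exact fun x ξ => mul_nonneg (hA0 _) (hw0 _)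

end Chart

/-! ### The kernel `e^{2πiλ|s|} A(s)` -/

/-- The oscillating kernel `e^{2πiλ|s|} A(s)`. -/
def oscKernel {V : Type*} [NormedAddCommGroup V] (A : V → ℝ) (lam : ℝ) (s : V) : ℂ :=
  Complex.exp (2 * Real.pi * Complex.I * ((lam * ‖s‖ : ℝ) : ℂ)) * (A s : ℂ)

theorem norm_oscKernel {V : Type*} [NormedAddCommGroup V] (A : V → ℝ) (lam : ℝ) (s : V) :
    ‖oscKernel A lam s‖ = |A s| := by
  rw [oscKernel, norm_mul, Complex.norm_real, Real.norm_eq_abs,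
    show 2 * (Real.pi : ℂ) * Complex.I * ((lam * ‖s‖ : ℝ) : ℂ) =
      ((2 * Real.pi * (lam * ‖s‖) : ℝ) : ℂ) * Complex.I by push_cast; ring,
    Complex.norm_exp_ofReal_mul_I, one_mul]

theorem continuous_oscKernel {V : Type*} [NormedAddCommGroup V] {A : V → ℝ} (hA : Continuous A)
    (lam : ℝ) : Continuous (oscKernel A lam) := by
  unfold oscKernel
  fun_prop

theorem enorm_rpow_eq_zero {a : ℂ} {s : ℝ} (hs : 0 < s) (ha : a = 0) : ‖a‖ₑ ^ s = 0 := by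
  rw [ha, enorm_zero, ENNReal.zero_rpow_of_pos hs]

section Slice

variable {m : ℕ}

theorem lintegral_comp_smul {k : ℕ} {R : ℝ} (hR : R ≠ 0)
    (F : EuclideanSpace ℝ (Fin k) → ℝ≥0∞) :
    ∫⁻ x, F (R • x) = ENNReal.ofReal (|R ^ k|⁻¹) * ∫⁻ x, F x := by
  have h := Measure.map_addHaar_smul (volume : Measure (EuclideanSpace ℝ (Fin k))) hR
  rw [finrank_euclideanSpace, Fintype.card_fin] at h
  have h1 : ∫⁻ x, F (R • x) = ∫⁻ x, F x ∂(Measure.map (R • ·)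
      (volume : Measure (EuclideanSpace ℝ (Fin k)))) :=
    (MeasurableEmbedding.lintegral_map (g := fun x : EuclideanSpace ℝ (Fin k) => R • x)
      (Homeomorph.smulOfNeZero R hR).measurableEmbedding F).symm
  rw [h1, h, lintegral_smul_measure, abs_inv, smul_eq_mul]

/-- The slice operator is a dilate of an operator `oscOp`, in the projective chart. -/
theorem integral_oscKernel_projChart {A : EuclideanSpace ℝ (Fin (m + 1)) → ℝ}
    {w : EuclideanSpace ℝ (Fin m) → ℝ} {M r δ lam L : ℝ} (hM : 0 < M) (hlam : 0 < lam)
    (hr1 : r < 1) (hw : ∀ ξ, ‖ξ‖ ≤ r → w ξ = 1) (hL : L ≤ M * r)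
    {f : EuclideanSpace ℝ (Fin m) → ℂ} (hf : ∀ y, f y ≠ 0 → ‖y‖ ≤ L)
    {x : EuclideanSpace ℝ (Fin (m + 1))} (hx : 0 < 1 + x (Fin.last m)) :
    ∫ y, oscKernel A lam (projChart M δ x - snocL m (y, 0)) * f y =
      (M ^ m : ℝ) * oscOp (n := m + 1) (projPhase δ) (chartAmp A w M δ) (M * lam)
        (fun ξ => f ((-M) • ξ)) ((M * lam) • x) := by
  have h := Measure.integral_comp_smul (volume : Measure (EuclideanSpace ℝ (Fin m)))
    (fun y => oscKernel A lam (projChart M δ x - snocL m (y, 0)) * f y) (-M)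
  have hMl : M * lam ≠ 0 := (mul_pos hM hlam).ne'
  rw [finrank_euclideanSpace, Fintype.card_fin] at h
  have h2 : |((-M) ^ m)⁻¹| = (M ^ m)⁻¹ := by
    rw [abs_inv, abs_pow, abs_neg, abs_of_pos hM]
  rw [h2, Complex.real_smul] at h
  have h3 : ∫ ξ, oscKernel A lam (projChart M δ x - snocL m ((-M) • ξ, 0)) * f ((-M) • ξ) =
      oscOp (n := m + 1) (projPhase δ) (chartAmp A w M δ) (M * lam)
        (fun ξ => f ((-M) • ξ)) ((M * lam) • x) := by
    have hz : ∀ ξ, f ((-M) • ξ) ≠ 0 → ‖ξ‖ ≤ r := by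
      intro ξ hξ
      have h4 := (hf _ hξ).trans hL
      rw [norm_smul, norm_neg, Real.norm_of_nonneg hM.le] at h4
      exact le_of_mul_le_mul_left h4 hM
    rw [oscOp]
    change _ = ∫ ξ in ball (0 : EuclideanSpace ℝ (Fin m)) 1, _
    rw [setIntegral_eq_integral_of_forall_compl_eq_zero]
    · refine integral_congr_ae (Filter.Eventually.of_forall fun ξ => ?_)
      by_cases hξ : f ((-M) • ξ) = 0
      · simp only [hξ, mul_zero]
      · rw [inv_smul_smul₀ hMl]
        simp only [oscKernel, chartAmp, hw ξ (hz ξ hξ), mul_one, norm_projChart_sub hM hx]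
        congr 5
        ring
    · intro ξ hξ
      have : f ((-M) • ξ) = 0 := by
        by_contra h4
        exact hξ (mem_ball_zero_iff.mpr ((hz ξ h4).trans_lt hr1))
      simp only [this, mul_zero]
  rw [← h3, h, ← mul_assoc, ← Complex.ofReal_mul, mul_inv_cancel₀ (by positivity),
    Complex.ofReal_one, one_mul]

/-- The `L^p` bound for the slice operator `f ↦ ∫ e^{2πiλ|X - (y, 0)|} A(X - (y, 0)) f(y) dy`,
for `A` supported in a half-space. -/
theorem exists_slice_bound {p : ℝ≥0∞} (hp0 : p ≠ 0) (hpt : p ≠ ⊤)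
    (hT : ∀ φ a : EuclideanSpace ℝ (Fin (m + 1)) → EuclideanSpace ℝ (Fin (m + 1 - 1)) → ℝ,
      IsAmplitude a → CarlesonSjolin φ a → ConvexCondition φ a → StraightCondition φ →
      UniformLpBound p φ a)
    {A : EuclideanSpace ℝ (Fin (m + 1)) → ℝ} {c ρ : ℝ} (L : ℝ) (hAs : ContDiff ℝ ∞ A)
    (hA0 : ∀ x, 0 ≤ A x) (hc : 0 < c) (hρ : c ≤ ρ)
    (hA : ∀ x, A x ≠ 0 → c ≤ x (Fin.last m) ∧ ‖x‖ ≤ ρ) :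
    ∃ C : ℝ≥0, ∀ lam : ℝ, 1 ≤ lam → ∀ f : EuclideanSpace ℝ (Fin m) → ℂ,
      AEStronglyMeasurable f → (∀ y, f y ≠ 0 → ‖y‖ ≤ L) →
      ∫⁻ X, ‖∫ y, oscKernel A lam (X - snocL m (y, 0)) * f y‖ₑ ^ p.toReal ≤
        C * ENNReal.ofReal ((lam ^ (m + 1))⁻¹) * ∫⁻ y, ‖f y‖ₑ ^ p.toReal := by
  have hρ0 : 0 < ρ := hc.trans_le hρ
  have hκ : 0 < c / ρ := div_pos hc hρ0
  have hκ1 : c / ρ ≤ 1 := (div_le_one hρ0).mpr hρ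
  have hP : 0 < p.toReal := ENNReal.toReal_pos hp0 hpt
  -- With κ = c/ρ ≤ 1 this gives 4r² = κ²/4 < κ, so the chart region fits inside the unit ball.
  set r : ℝ := c / ρ / 4 with hr
  have hr0 : 0 < r := by positivity
  have hr1 : r < 1 := by linarith
  have hr2 : 4 * r ^ 2 < c / ρ := by
    rw [hr]
    nlinarith
  -- Chosen so that Mr ≥ ρ+2|L|. This confines the amplitude to the chart region, and puts the
  -- rescaled support of f in |ξ| ≤ r/2, where the cutoff w is 1.
  set M : ℝ := (ρ + 2 * |L|) / r + 1 with hMdef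
  have hM1 : 1 ≤ M := by
    have : 0 ≤ (ρ + 2 * |L|) / r := by positivity
    linarith
  have hM : 0 < M := by linarith
  have hMr : ρ + 2 * |L| ≤ M * r := by
    rw [hMdef, add_mul, div_mul_cancel₀ _ hr0.ne']
    linarith
  set δ : ℝ := c / M with hδdef
  have hδ : M * δ = c := mul_div_cancel₀ c hM.ne'
  have hδ0 : 0 < δ := by positivity
  let w : ContDiffBump (0 : EuclideanSpace ℝ (Fin m)) := ⟨r / 2, r, by positivity, by linarith⟩
  have hw1 : ∀ ξ, ‖ξ‖ ≤ r / 2 → w ξ = 1 := fun ξ h =>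
    w.one_of_mem_closedBall (mem_closedBall_zero_iff.mpr h)
  have hw : ∀ ξ, w ξ ≠ 0 → ‖ξ‖ ≤ r := by
    intro ξ h
    by_contra h1
    exact h (w.zero_of_le_dist (by rw [dist_zero_right]; exact (not_le.mp h1).le))
  have hL : L ≤ M * (r / 2) := by
    have := le_abs_self L
    nlinarith
  have hamp := isAmplitude_chartAmp hAs hA0 hc hρ hA hM hδ (by linarith [abs_nonneg L]) hr1 hr2
    w.contDiff (fun ξ => w.nonneg) hw
  obtain ⟨h1, h2, h3⟩ := projPhase_conditions hδ0 hamp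
  obtain ⟨C₁, hC₁⟩ := hT _ _ hamp h1 h2 h3
  set U : Set (EuclideanSpace ℝ (Fin (m + 1))) := {x | 0 < 1 + x (Fin.last m)} with hU
  have hUo : IsOpen U := isOpen_one_add_last_pos
  have hsubU : chartRegion m (c / ρ) r ⊆ U := fun x hx =>
    one_add_last_pos (chartRegion_subset_ball hκ hr2 hx)
  -- The Jacobian of the chart is bounded on the compact region that supports the amplitude.
  have hdet : ContinuousOn (fun x => |(fderiv ℝ (projChart (m := m) M δ) x).det|)
      (chartRegion m (c / ρ) r) := by
    have h4 := ((contDiffOn_projChart (m := m) M δ).continuousOn_fderiv_of_isOpen hUo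
      (by simp)).mono hsubU
    exact (ContinuousLinearMap.continuous_det.comp_continuousOn h4).abs
  obtain ⟨D, hD⟩ := ((isCompact_chartRegion hκ hr2).image_of_continuousOn hdet).bddAbove
  -- The summand 1 keeps the constant nonzero, so that the bound holds trivially when f has infinite
  -- norm.
  refine ⟨D.toNNReal * (Real.toNNReal (M ^ m)) ^ p.toReal * C₁ ^ p.toReal + 1,
    fun lam hlam f hfm hf => ?_⟩
  have hlam0 : 0 < lam := by linarith
  rcases eq_or_ne (∫⁻ y, ‖f y‖ₑ ^ p.toReal) ⊤ with htop | htop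
  · rw [htop, ENNReal.mul_top]
    · exact le_top
    · refine mul_ne_zero (by simp) ?_
      rw [ENNReal.ofReal_ne_zero_iff]
      positivity
  set F : EuclideanSpace ℝ (Fin (m + 1)) → ℝ≥0∞ := fun X =>
    ‖∫ y, oscKernel A lam (X - snocL m (y, 0)) * f y‖ₑ ^ p.toReal with hF
  set g : EuclideanSpace ℝ (Fin m) → ℂ := fun ξ => f ((-M) • ξ) with hg
  set T : EuclideanSpace ℝ (Fin (m + 1)) → ℂ :=
    oscOp (n := m + 1) (projPhase δ) (chartAmp A w M δ) (M * lam) g with hTdef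
  have hFne : ∀ X, F X ≠ 0 → ∃ y, f y ≠ 0 ∧ A (X - snocL m (y, 0)) ≠ 0 := by
    intro X hX
    by_contra! hcon
    refine hX (enorm_rpow_eq_zero hP ?_)
    refine (integral_congr_ae (Filter.Eventually.of_forall fun y => ?_)).trans
      (integral_zero _ _)
    by_cases hy : f y = 0
    · simp [hy]
    · simp [oscKernel, hcon y hy]
  have hFs : Function.support F ⊆ {X | 0 < X (Fin.last m)} := by
    intro X hX
    obtain ⟨y, -, hy⟩ := hFne X hX
    have := (hA _ hy).1
    rw [PiLp.sub_apply, snocL_last, sub_zero] at this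
    exact hc.trans_le this
  -- The Jacobian bound is needed only where the operator is nonzero, and there x lies in the chart
  -- region.
  have hFx : ∀ x ∈ U, ENNReal.ofReal |(fderiv ℝ (projChart (m := m) M δ) x).det| *
      F (projChart M δ x) ≤ (D.toNNReal * (Real.toNNReal (M ^ m)) ^ p.toReal : ℝ≥0) *
        ‖T ((M * lam) • x)‖ₑ ^ p.toReal := by
    intro x hx
    by_cases hx0 : F (projChart M δ x) = 0
    · simp [hx0]
    · obtain ⟨y, hy, hAy⟩ := hFne _ hx0
      have hξ : ‖(-M)⁻¹ • y‖ ≤ r := by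
        rw [norm_smul, norm_inv, norm_neg, Real.norm_of_nonneg hM.le,
          inv_mul_le_iff₀ hM]
        nlinarith [hf y hy]
      have hmem : x ∈ chartRegion m (c / ρ) r := by
        refine mem_chartRegion hc hρ hA hM hδ (by linarith [abs_nonneg L]) hξ ?_
        rwa [smul_inv_smul₀ (neg_ne_zero.mpr hM.ne')]
      have h4 : |(fderiv ℝ (projChart (m := m) M δ) x).det| ≤ D :=
        hD (Set.mem_image_of_mem _ hmem)
      have h5 : F (projChart M δ x) = (Real.toNNReal (M ^ m) : ℝ≥0∞) ^ p.toReal *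
          ‖T ((M * lam) • x)‖ₑ ^ p.toReal := by
        simp only [hF]
        rw [integral_oscKernel_projChart (w := w) (r := r / 2) hM hlam0 (by linarith) hw1 hL hf hx,
          enorm_mul, ENNReal.mul_rpow_of_nonneg _ _ hP.le]
        congr 2
        rw [← ofReal_norm, Complex.norm_real, Real.norm_of_nonneg (by positivity)]
        rfl
      rw [h5, ENNReal.coe_mul, mul_assoc, ENNReal.coe_rpow_of_nonneg _ hP.le]
      gcongr
      exact ENNReal.ofReal_le_ofReal h4
  have hgm : AEStronglyMeasurable g := by
    refine hfm.comp_quasiMeasurePreserving ⟨(continuous_const_smul (-M)).measurable, ?_⟩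
    rw [Measure.map_addHaar_smul _ (neg_ne_zero.mpr hM.ne')]
    exact Measure.smul_absolutelyContinuous
  have hgint : ∫⁻ ξ, ‖g ξ‖ₑ ^ p.toReal ≤ ∫⁻ y, ‖f y‖ₑ ^ p.toReal := by
    rw [lintegral_comp_smul (neg_ne_zero.mpr hM.ne') (fun y => ‖f y‖ₑ ^ p.toReal)]
    refine mul_le_of_le_one_left zero_le ?_
    rw [ENNReal.ofReal_le_one, abs_pow, abs_neg, abs_of_pos hM]
    exact inv_le_one_of_one_le₀ (one_le_pow₀ hM1)
  have hgL : MemLp g p (volume.restrict (ball 0 1)) := by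
    refine MemLp.restrict _ ⟨hgm, ?_⟩
    rw [eLpNorm_lt_top_iff_lintegral_rpow_enorm_lt_top hp0 hpt]
    exact hgint.trans_lt htop.lt_top
  have hTb : ∫⁻ x, ‖T x‖ₑ ^ p.toReal ≤ (C₁ : ℝ≥0∞) ^ p.toReal * ∫⁻ y, ‖f y‖ₑ ^ p.toReal := by
    have h4 := hC₁ (M * lam) (by nlinarith) g hgL
    rw [eLpNorm_eq_lintegral_rpow_enorm_toReal hp0 hpt,
      eLpNorm_eq_lintegral_rpow_enorm_toReal hp0 hpt] at h4
    have h5 := ENNReal.rpow_le_rpow h4 hP.le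
    rw [← ENNReal.rpow_mul, one_div_mul_cancel hP.ne', ENNReal.rpow_one,
      ENNReal.mul_rpow_of_nonneg _ _ hP.le, ← ENNReal.rpow_mul, one_div_mul_cancel hP.ne',
      ENNReal.rpow_one] at h5
    refine h5.trans (mul_le_mul_right ?_ _)
    exact (lintegral_mono' Measure.restrict_le_self le_rfl).trans hgint
  have hML : 0 < M * lam := by positivity
  calc ∫⁻ X, F X = ∫⁻ X in {X | 0 < X (Fin.last m)}, F X :=
        (setLIntegral_eq_of_support_subset hFs).symm
    _ = ∫⁻ X in projChart M δ '' U, F X := by rw [image_projChart hM hδ0]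
    _ = ∫⁻ x in U, ENNReal.ofReal |(fderiv ℝ (projChart (m := m) M δ) x).det| *
          F (projChart M δ x) := by
        refine lintegral_image_eq_lintegral_abs_det_fderiv_mul volume hUo.measurableSet
          (fun x hx => ?_) (injOn_projChart hM hδ0) F
        exact (((contDiffOn_projChart M δ).differentiableOn (by simp)).differentiableAt
          (hUo.mem_nhds hx)).hasFDerivAt.hasFDerivWithinAt
    _ ≤ ∫⁻ x in U, (D.toNNReal * (Real.toNNReal (M ^ m)) ^ p.toReal : ℝ≥0) *
        ‖T ((M * lam) • x)‖ₑ ^ p.toReal :=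
        setLIntegral_mono' hUo.measurableSet hFx
    _ ≤ ∫⁻ x, (D.toNNReal * (Real.toNNReal (M ^ m)) ^ p.toReal : ℝ≥0) *
        ‖T ((M * lam) • x)‖ₑ ^ p.toReal := lintegral_mono' Measure.restrict_le_self le_rfl
    -- Undoing the dilation by Mλ in the output variable produces (Mλ)^{-n}, n = m+1; this is the
    -- entire gain in λ.
    _ = (D.toNNReal * (Real.toNNReal (M ^ m)) ^ p.toReal : ℝ≥0) *
        (ENNReal.ofReal (|(M * lam) ^ (m + 1)|⁻¹) * ∫⁻ x, ‖T x‖ₑ ^ p.toReal) := by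
        rw [lintegral_const_mul' _ _ ENNReal.coe_ne_top,
          lintegral_comp_smul hML.ne' (fun x => ‖T x‖ₑ ^ p.toReal)]
    _ ≤ (D.toNNReal * (Real.toNNReal (M ^ m)) ^ p.toReal : ℝ≥0) *
        (ENNReal.ofReal ((lam ^ (m + 1))⁻¹) *
          ((C₁ : ℝ≥0∞) ^ p.toReal * ∫⁻ y, ‖f y‖ₑ ^ p.toReal)) := by
        gcongr
        rw [abs_of_pos (by positivity)]
        gcongr
        nlinarith
    _ = (D.toNNReal * (Real.toNNReal (M ^ m)) ^ p.toReal * C₁ ^ p.toReal : ℝ≥0) *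
        ENNReal.ofReal ((lam ^ (m + 1))⁻¹) * ∫⁻ y, ‖f y‖ₑ ^ p.toReal := by
        rw [ENNReal.coe_mul (_ * _), ENNReal.coe_rpow_of_nonneg C₁ hP.le]
        ring
    _ ≤ _ := by
        gcongr
        exact le_self_add

end Slice

/-! ### From the slice operator to convolution on the whole space -/

theorem measurePreserving_snocL (m : ℕ) : MeasurePreserving (snocL m) := by
  have h1 : MeasurePreserving (Prod.map (@WithLp.ofLp 2 (Fin m → ℝ)) (id : ℝ → ℝ))
      (volume.prod volume) (volume.prod volume) :=
    (PiLp.volume_preserving_ofLp (Fin m)).prod (MeasurePreserving.id _)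
  have h2 := (volume_preserving_piFinSuccAbove (fun _ : Fin (m + 1) => ℝ) (Fin.last m)).symm
  have h := (PiLp.volume_preserving_toLp (Fin (m + 1))).comp
    (h2.comp (Measure.measurePreserving_swap.comp h1))
  have heq : (snocL m : EuclideanSpace ℝ (Fin m) × ℝ → EuclideanSpace ℝ (Fin (m + 1))) =
      WithLp.toLp 2 ∘ (MeasurableEquiv.piFinSuccAbove (fun _ : Fin (m + 1) => ℝ)
        (Fin.last m)).symm ∘ Prod.swap ∘ Prod.map WithLp.ofLp id := by
    funext z
    ext i
    refine Fin.lastCases ?_ (fun j => ?_) i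
    · simp [MeasurableEquiv.piFinSuccAbove_symm_apply]
    · simp [MeasurableEquiv.piFinSuccAbove_symm_apply]
  rw [heq]
  exact h

theorem measurableEmbedding_snocL (m : ℕ) : MeasurableEmbedding (snocL m) :=
  (snocL m).toHomeomorph.measurableEmbedding

/-- Hölder against the constant 1. -/
theorem rpow_lintegral_le {α : Type*} [MeasurableSpace α] (μ : Measure α) {P : ℝ} (hP : 1 ≤ P)
    {φ : α → ℝ≥0∞} (hφ : AEMeasurable φ μ) :
    (∫⁻ x, φ x ∂μ) ^ P ≤ μ Set.univ ^ (P - 1) * ∫⁻ x, φ x ^ P ∂μ := by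
  have hP0 : 0 < P := by linarith
  have h := ENNReal.lintegral_mul_norm_pow_le (μ := μ) (hφ.pow_const P)
    (aemeasurable_const (b := (1 : ℝ≥0∞))) (p := P⁻¹) (q := 1 - P⁻¹) (by positivity)
    (sub_nonneg.mpr (inv_le_one_of_one_le₀ hP)) (by ring)
  simp only [ENNReal.one_rpow, mul_one, lintegral_const, one_mul] at h
  have h1 : ∀ x, (φ x ^ P) ^ P⁻¹ = φ x := fun x => ENNReal.rpow_rpow_inv hP0.ne' _
  simp only [h1] at h
  have h2 := ENNReal.rpow_le_rpow h hP0.le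
  rw [ENNReal.mul_rpow_of_nonneg _ _ hP0.le, ENNReal.rpow_inv_rpow hP0.ne', ← ENNReal.rpow_mul,
    sub_mul, inv_mul_cancel₀ hP0.ne', one_mul, mul_comm] at h2
  exact h2

section Convolution

variable {m : ℕ}

/-- Slice f by its last coordinate t. The convolution is the integral over |t| ≤ L of slice
operators translated in X, so Hölder in t costs only (2L)^{p-1}, and translation invariance bounds
every slice alike. -/
theorem exists_local_bound {p : ℝ≥0∞} (hp1 : 1 ≤ p) (hpt : p ≠ ⊤)
    (hT : ∀ φ a : EuclideanSpace ℝ (Fin (m + 1)) → EuclideanSpace ℝ (Fin (m + 1 - 1)) → ℝ,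
      IsAmplitude a → CarlesonSjolin φ a → ConvexCondition φ a → StraightCondition φ →
      UniformLpBound p φ a)
    {A : EuclideanSpace ℝ (Fin (m + 1)) → ℝ} {c ρ : ℝ} (L : ℝ) (hAs : ContDiff ℝ ∞ A)
    (hA0 : ∀ x, 0 ≤ A x) (hc : 0 < c) (hρ : c ≤ ρ)
    (hA : ∀ x, A x ≠ 0 → c ≤ x (Fin.last m) ∧ ‖x‖ ≤ ρ) :
    ∃ C : ℝ≥0, ∀ lam : ℝ, 1 ≤ lam → ∀ f : EuclideanSpace ℝ (Fin (m + 1)) → ℂ,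
      StronglyMeasurable f → (∀ y, f y ≠ 0 → ‖y‖ ≤ L) →
      ∫⁻ X, ‖∫ y, oscKernel A lam (X - y) * f y‖ₑ ^ p.toReal ≤
        C * ENNReal.ofReal ((lam ^ (m + 1))⁻¹) * ∫⁻ y, ‖f y‖ₑ ^ p.toReal := by
  have hp0 : p ≠ 0 := (zero_lt_one.trans_le hp1).ne'
  have hP : 1 ≤ p.toReal := by
    rwa [← ENNReal.toReal_one, ENNReal.toReal_le_toReal ENNReal.one_ne_top hpt]
  have hP0 : 0 < p.toReal := by linarith
  obtain ⟨C, hC⟩ := exists_slice_bound hp0 hpt hT L hAs hA0 hc hρ hA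
  refine ⟨(Real.toNNReal (2 * L)) ^ (p.toReal - 1) * C, fun lam hlam f hf hfL => ?_⟩
  set F : EuclideanSpace ℝ (Fin (m + 1)) → ℝ → ℂ := fun X t =>
    ∫ y, oscKernel A lam (X - snocL m (y, t)) * f (snocL m (y, t)) with hF
  have hk := continuous_oscKernel hAs.continuous lam
  have hFm : StronglyMeasurable (Function.uncurry F) := by
    refine StronglyMeasurable.integral_prod_right (f := fun (z : EuclideanSpace ℝ (Fin (m + 1)) × ℝ)
      (y : EuclideanSpace ℝ (Fin m)) =>
        oscKernel A lam (z.1 - snocL m (y, z.2)) * f (snocL m (y, z.2))) ?_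
    have h2 : Continuous fun w : (EuclideanSpace ℝ (Fin (m + 1)) × ℝ) ×
        EuclideanSpace ℝ (Fin m) => snocL m (w.2, w.1.2) := by fun_prop
    have h1 : Continuous fun w : (EuclideanSpace ℝ (Fin (m + 1)) × ℝ) ×
        EuclideanSpace ℝ (Fin m) => oscKernel A lam (w.1.1 - snocL m (w.2, w.1.2)) :=
      hk.comp (continuous_fst.fst.sub h2)
    exact h1.stronglyMeasurable.mul (hf.comp_measurable h2.measurable)
  have hsupp : ∀ y t, f (snocL m (y, t)) ≠ 0 → ‖y‖ ≤ L ∧ |t| ≤ L := by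
    intro y t h
    have h1 := hfL _ h
    have h2 := norm_snocL_sq (y, t)
    dsimp only at h2
    have h3 : ‖snocL m (y, t)‖ ^ 2 ≤ L ^ 2 := by gcongr
    have hL : 0 ≤ L := (norm_nonneg _).trans h1
    exact ⟨abs_le_of_sq_le_sq' (by nlinarith [sq_nonneg t]) hL |>.2,
      abs_le_of_sq_le_sq (by nlinarith [sq_nonneg ‖y‖]) hL⟩
  have h1 : ∀ X, ‖∫ y, oscKernel A lam (X - y) * f y‖ₑ ^ p.toReal ≤
      (ENNReal.ofReal (2 * L)) ^ (p.toReal - 1) * ∫⁻ t, ‖F X t‖ₑ ^ p.toReal := by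
    intro X
    have h2 : ‖∫ y, oscKernel A lam (X - y) * f y‖ₑ ≤ ∫⁻ t in Set.Icc (-L) L, ‖F X t‖ₑ := by
      by_cases hi : Integrable (fun y => oscKernel A lam (X - y) * f y)
      · have h3 : ∫ y, oscKernel A lam (X - y) * f y = ∫ t, F X t := by
          rw [← (measurePreserving_snocL m).integral_comp (measurableEmbedding_snocL m)]
          exact integral_prod_symm _
            ((measurePreserving_snocL m).integrable_comp_of_integrable hi)
        rw [h3]
        refine (enorm_integral_le_lintegral_enorm _).trans_eq ?_
        refine (setLIntegral_eq_of_support_subset fun t ht => ?_).symm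
        have ht' : F X t ≠ 0 := fun h => ht (by simp [h])
        by_contra hcon
        refine ht' ((integral_congr_ae (Filter.Eventually.of_forall fun y => ?_)).trans
          (integral_zero _ _))
        have : f (snocL m (y, t)) = 0 := by
          by_contra h
          exact hcon (abs_le.mp (hsupp y t h).2)
        simp only [this, mul_zero]
      · rw [integral_undef hi]
        simp
    refine (ENNReal.rpow_le_rpow h2 hP0.le).trans ((rpow_lintegral_le _ hP ?_).trans ?_)
    · exact ((hFm.comp_measurable measurable_prodMk_left).enorm).aemeasurable
    · rw [Measure.restrict_apply_univ, Real.volume_Icc, sub_neg_eq_add, ← two_mul]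
      gcongr
      exact Measure.restrict_le_self
  have h2 : ∀ t, ∫⁻ X, ‖F X t‖ₑ ^ p.toReal ≤ C * ENNReal.ofReal ((lam ^ (m + 1))⁻¹) *
      ∫⁻ y, ‖f (snocL m (y, t))‖ₑ ^ p.toReal := by
    intro t
    rw [← lintegral_add_right_eq_self (fun X => ‖F X t‖ₑ ^ p.toReal) (snocL m (0, t))]
    have h3 : ∀ X, F (X + snocL m (0, t)) t =
        ∫ y, oscKernel A lam (X - snocL m (y, 0)) * f (snocL m (y, t)) := by
      intro X
      simp only [hF]
      congr 1
      funext y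
      congr 2
      have h4 : snocL m (y, t) = snocL m (y, 0) + snocL m (0, t) := by
        rw [← map_add]
        simp
      rw [h4, add_sub_add_right_eq_sub]
    simp only [h3]
    refine hC lam hlam _ ?_ fun y hy => (hsupp y t hy).1
    have h4 : Continuous fun y : EuclideanSpace ℝ (Fin m) => snocL m (y, t) := by fun_prop
    exact (hf.comp_measurable h4.measurable).aestronglyMeasurable
  have hFm' : Measurable (Function.uncurry fun X t => ‖F X t‖ₑ ^ p.toReal) :=
    hFm.enorm.pow_const _
  calc _ ≤ ∫⁻ X, (ENNReal.ofReal (2 * L)) ^ (p.toReal - 1) * ∫⁻ t, ‖F X t‖ₑ ^ p.toReal :=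
        lintegral_mono h1
    _ = (ENNReal.ofReal (2 * L)) ^ (p.toReal - 1) * ∫⁻ t, ∫⁻ X, ‖F X t‖ₑ ^ p.toReal := by
        rw [lintegral_const_mul _ (Measurable.lintegral_prod_right hFm'),
          lintegral_lintegral_swap hFm'.aemeasurable]
    _ ≤ (ENNReal.ofReal (2 * L)) ^ (p.toReal - 1) * ∫⁻ t, C * ENNReal.ofReal ((lam ^ (m + 1))⁻¹) *
          ∫⁻ y, ‖f (snocL m (y, t))‖ₑ ^ p.toReal := by
        gcongr with t
        exact h2 t
    _ = (ENNReal.ofReal (2 * L)) ^ (p.toReal - 1) * (C * ENNReal.ofReal ((lam ^ (m + 1))⁻¹) *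
          ∫⁻ y, ‖f y‖ₑ ^ p.toReal) := by
        rw [lintegral_const_mul' _ _ (ENNReal.mul_ne_top ENNReal.coe_ne_top ENNReal.ofReal_ne_top),
          ← (measurePreserving_snocL m).lintegral_comp_emb (measurableEmbedding_snocL m)]
        congr 2
        refine (lintegral_prod_symm' (fun z => ‖f (snocL m z)‖ₑ ^ p.toReal) ?_).symm
        exact ((hf.comp_measurable (snocL m).continuous.measurable).enorm).pow_const _
    _ = _ := by
        rw [ENNReal.coe_mul, ENNReal.coe_rpow_of_nonneg _ (by linarith)]
        simp only [ENNReal.ofReal, mul_assoc]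

/-- The kernel lives in |s| ≤ ρ, so on the unit ball around v only the values of f within 1+ρ of v
matter. Integrating the local estimates over all v removes the support condition on f; by Fubini
both sides merely acquire the volume of a ball. -/
theorem exists_convolution_bound {p : ℝ≥0∞} (hp1 : 1 ≤ p) (hpt : p ≠ ⊤)
    (hT : ∀ φ a : EuclideanSpace ℝ (Fin (m + 1)) → EuclideanSpace ℝ (Fin (m + 1 - 1)) → ℝ,
      IsAmplitude a → CarlesonSjolin φ a → ConvexCondition φ a → StraightCondition φ →
      UniformLpBound p φ a)
    {A : EuclideanSpace ℝ (Fin (m + 1)) → ℝ} {c ρ : ℝ} (hAs : ContDiff ℝ ∞ A)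
    (hA0 : ∀ x, 0 ≤ A x) (hc : 0 < c) (hρ : c ≤ ρ)
    (hA : ∀ x, A x ≠ 0 → c ≤ x (Fin.last m) ∧ ‖x‖ ≤ ρ) :
    ∃ C : ℝ≥0, ∀ lam : ℝ, 1 ≤ lam → ∀ f : EuclideanSpace ℝ (Fin (m + 1)) → ℂ,
      StronglyMeasurable f →
      ∫⁻ X, ‖∫ y, oscKernel A lam (X - y) * f y‖ₑ ^ p.toReal ≤
        C * ENNReal.ofReal ((lam ^ (m + 1))⁻¹) * ∫⁻ y, ‖f y‖ₑ ^ p.toReal := by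
  have hp0 : p ≠ 0 := (zero_lt_one.trans_le hp1).ne'
  have hP0 : 0 < p.toReal := ENNReal.toReal_pos hp0 hpt
  obtain ⟨C, hC⟩ := exists_local_bound hp1 hpt hT (1 + ρ) hAs hA0 hc hρ hA
  set B : Set (EuclideanSpace ℝ (Fin (m + 1))) := ball 0 1 with hB
  set B' : Set (EuclideanSpace ℝ (Fin (m + 1))) := closedBall 0 (1 + ρ) with hB'
  have hB0 : volume B ≠ 0 := (measure_ball_pos _ _ one_pos).ne'
  have hBt : volume B ≠ ⊤ := measure_ball_lt_top.ne
  have hBt' : volume B' ≠ ⊤ := measure_closedBall_lt_top.ne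
  refine ⟨((volume B)⁻¹ * volume B').toNNReal * C, fun lam hlam f hf => ?_⟩
  set G : EuclideanSpace ℝ (Fin (m + 1)) → ℝ≥0∞ := fun X =>
    ‖∫ y, oscKernel A lam (X - y) * f y‖ₑ ^ p.toReal with hG
  have hk := continuous_oscKernel hAs.continuous lam
  have hGm : Measurable G := by
    refine (StronglyMeasurable.enorm (StronglyMeasurable.integral_prod_right
      (f := fun X y => oscKernel A lam (X - y) * f y) ?_)).pow_const _
    exact (hk.comp (continuous_fst.sub continuous_snd)).stronglyMeasurable.mul
      (hf.comp_measurable measurable_snd)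
  have h1 : ∀ v, ∫⁻ u in B, G (u + v) ≤ C * ENNReal.ofReal ((lam ^ (m + 1))⁻¹) *
      ∫⁻ y in B', ‖f (y + v)‖ₑ ^ p.toReal := by
    intro v
    have hfv : StronglyMeasurable (B'.indicator fun y => f (y + v)) :=
      (hf.comp_measurable (measurable_id.add_const v)).indicator isClosed_closedBall.measurableSet
    have h2 : ∀ u ∈ B, G (u + v) =
        ‖∫ y, oscKernel A lam (u - y) * B'.indicator (fun y => f (y + v)) y‖ₑ ^ p.toReal := by
      intro u hu
      simp only [hG]
      congr 2
      rw [← integral_add_right_eq_self _ v]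
      congr 1
      funext y
      rw [add_sub_add_right_eq_sub]
      by_cases hy : y ∈ B'
      · rw [Set.indicator_of_mem hy]
      · rw [Set.indicator_of_notMem hy, mul_zero]
        have : A (u - y) = 0 := by
          by_contra h
          have h3 := (hA _ h).2
          have h4 := norm_sub_norm_le y u
          rw [norm_sub_rev] at h4
          rw [hB, mem_ball_zero_iff] at hu
          exact hy (mem_closedBall_zero_iff.mpr (by linarith))
        simp [oscKernel, this]
    calc _ = ∫⁻ u in B, ‖∫ y, oscKernel A lam (u - y) *
            B'.indicator (fun y => f (y + v)) y‖ₑ ^ p.toReal :=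
          setLIntegral_congr_fun measurableSet_ball h2
      _ ≤ ∫⁻ u, ‖∫ y, oscKernel A lam (u - y) *
            B'.indicator (fun y => f (y + v)) y‖ₑ ^ p.toReal :=
          lintegral_mono' Measure.restrict_le_self le_rfl
      _ ≤ _ := hC lam hlam _ hfv fun y hy => by
          by_contra h
          refine hy (Set.indicator_of_notMem (fun h5 => h (mem_closedBall_zero_iff.mp h5)) _)
      _ = _ := by
          congr 1
          rw [← lintegral_indicator isClosed_closedBall.measurableSet]
          congr 1
          funext y
          by_cases hy : y ∈ B'
          · rw [Set.indicator_of_mem hy, Set.indicator_of_mem hy]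
          · rw [Set.indicator_of_notMem hy, Set.indicator_of_notMem hy]
            exact enorm_rpow_eq_zero hP0 rfl
  have h3 : volume B * ∫⁻ X, G X ≤ C * ENNReal.ofReal ((lam ^ (m + 1))⁻¹) *
      (volume B' * ∫⁻ y, ‖f y‖ₑ ^ p.toReal) := by
    calc volume B * ∫⁻ X, G X = ∫⁻ u in B, ∫⁻ v, G (u + v) := by
          simp only [lintegral_add_left_eq_self, setLIntegral_const]
          rw [mul_comm]
      _ = ∫⁻ v, ∫⁻ u in B, G (u + v) :=
          lintegral_lintegral_swap (hGm.comp measurable_add).aemeasurable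
      _ ≤ ∫⁻ v, C * ENNReal.ofReal ((lam ^ (m + 1))⁻¹) *
            ∫⁻ y in B', ‖f (y + v)‖ₑ ^ p.toReal := lintegral_mono h1
      _ = C * ENNReal.ofReal ((lam ^ (m + 1))⁻¹) *
            ∫⁻ y in B', ∫⁻ v, ‖f (y + v)‖ₑ ^ p.toReal := by
          rw [lintegral_const_mul' _ _
            (ENNReal.mul_ne_top ENNReal.coe_ne_top ENNReal.ofReal_ne_top),
            lintegral_lintegral_swap]
          exact ((hf.comp_measurable
            (measurable_snd.add measurable_fst)).enorm.pow_const _).aemeasurable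
      _ = _ := by
          simp only [lintegral_add_left_eq_self (fun v => ‖f v‖ₑ ^ p.toReal), setLIntegral_const]
          rw [mul_comm (volume B')]
  have h4 := mul_le_mul_right h3 (volume B)⁻¹
  rw [← mul_assoc, ENNReal.inv_mul_cancel hB0 hBt, one_mul] at h4
  refine h4.trans_eq ?_
  rw [ENNReal.coe_mul, ENNReal.coe_toNNReal
    (ENNReal.mul_ne_top (ENNReal.inv_ne_top.mpr hB0) hBt')]
  ring

end Convolution

/-! ### Correlations -/

section Correlation

variable {n : ℕ} {P Q : ℝ}

/-- The set of functions `s ↦ ∫ f(x - s) g(x) dx`, with `f`, `g` in the unit balls of `L^P`, `L^Q`. -/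
def corrClass (n : ℕ) (P Q : ℝ) : Set (EuclideanSpace ℝ (Fin n) → ℂ) :=
  {c | ∃ f g : EuclideanSpace ℝ (Fin n) → ℂ, StronglyMeasurable f ∧ StronglyMeasurable g ∧
    ∫⁻ x, ‖f x‖ₑ ^ P ≤ 1 ∧ ∫⁻ x, ‖g x‖ₑ ^ Q ≤ 1 ∧ c = fun s => ∫ x, f (x - s) * g x}

theorem lintegral_mul_enorm_le (hPQ : P.HolderConjugate Q) {f g : EuclideanSpace ℝ (Fin n) → ℂ}
    (hf : AEStronglyMeasurable f) (hg : AEStronglyMeasurable g) (hg1 : ∫⁻ x, ‖g x‖ₑ ^ Q ≤ 1) :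
    ∫⁻ x, ‖f x * g x‖ₑ ≤ (∫⁻ x, ‖f x‖ₑ ^ P) ^ (1 / P) := by
  have h := ENNReal.lintegral_mul_le_Lp_mul_Lq volume hPQ hf.enorm hg.enorm
  have h1 : (∫⁻ x, ‖g x‖ₑ ^ Q) ^ (1 / Q) ≤ 1 :=
    (ENNReal.rpow_le_rpow hg1 (by have := hPQ.symm.pos; positivity)).trans_eq
      (ENNReal.one_rpow _)
  simp only [enorm_mul]
  exact h.trans ((mul_le_mul_right h1 _).trans_eq (mul_one _))

theorem lintegral_corr_le (hPQ : P.HolderConjugate Q) {f g : EuclideanSpace ℝ (Fin n) → ℂ}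
    (hf : StronglyMeasurable f) (hg : StronglyMeasurable g) (hf1 : ∫⁻ x, ‖f x‖ₑ ^ P ≤ 1)
    (hg1 : ∫⁻ x, ‖g x‖ₑ ^ Q ≤ 1) (s : EuclideanSpace ℝ (Fin n)) :
    ∫⁻ x, ‖f (x - s) * g x‖ₑ ≤ 1 := by
  refine (lintegral_mul_enorm_le hPQ (f := fun x => f (x - s))
    (hf.comp_measurable (measurable_id.sub_const s)).aestronglyMeasurable
    hg.aestronglyMeasurable hg1).trans ?_
  rw [lintegral_sub_right_eq_self (fun x => ‖f x‖ₑ ^ P)]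
  exact (ENNReal.rpow_le_rpow hf1 (by have := hPQ.pos; positivity)).trans_eq
    (ENNReal.one_rpow _)

theorem corrClass_norm_le (hPQ : P.HolderConjugate Q) :
    ∀ c ∈ corrClass n P Q, ∀ x, ‖c x‖ ≤ 1 := by
  rintro c ⟨f, g, hf, hg, hf1, hg1, rfl⟩ s
  have h := (enorm_integral_le_lintegral_enorm _).trans (lintegral_corr_le hPQ hf hg hf1 hg1 s)
  rw [← ofReal_norm] at h
  exact ENNReal.ofReal_le_one.mp h

theorem corrClass_aestronglyMeasurable :
    ∀ c ∈ corrClass n P Q, AEStronglyMeasurable c := by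
  rintro c ⟨f, g, hf, hg, -, -, rfl⟩
  refine (StronglyMeasurable.integral_prod_right (f := fun s x => f (x - s) * g x)
    ?_).aestronglyMeasurable
  exact (hf.comp_measurable (measurable_snd.sub measurable_fst)).mul
    (hg.comp_measurable measurable_snd)

theorem corrClass_conj : ∀ c ∈ corrClass n P Q, (fun x => star (c x)) ∈ corrClass n P Q := by
  rintro c ⟨f, g, hf, hg, hf1, hg1, rfl⟩
  refine ⟨fun x => star (f x), fun x => star (g x), hf.star, hg.star, ?_, ?_, ?_⟩
  · have h : ∀ x, ‖star (f x)‖ₑ = ‖f x‖ₑ := fun x => by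
      rw [← ofReal_norm, norm_star, ofReal_norm]
    simpa only [h] using hf1
  · have h : ∀ x, ‖star (g x)‖ₑ = ‖g x‖ₑ := fun x => by
      rw [← ofReal_norm, norm_star, ofReal_norm]
    simpa only [h] using hg1
  · funext s
    have h := integral_conj (μ := (volume : Measure (EuclideanSpace ℝ (Fin n))))
      (f := fun x => f (x - s) * g x)
    rw [← starRingEnd_apply, ← h]
    simp only [map_mul, starRingEnd_apply]

theorem corrClass_isometry (U : EuclideanSpace ℝ (Fin n) ≃ₗᵢ[ℝ] EuclideanSpace ℝ (Fin n)) :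
    ∀ c ∈ corrClass n P Q, (fun x => c (U x)) ∈ corrClass n P Q := by
  rintro c ⟨f, g, hf, hg, hf1, hg1, rfl⟩
  have hU := U.continuous.measurable
  have hUp := U.measurePreserving
  have hUe := U.toHomeomorph.measurableEmbedding
  refine ⟨fun x => f (U x), fun x => g (U x), hf.comp_measurable hU, hg.comp_measurable hU,
    ?_, ?_, ?_⟩
  · exact (hUp.lintegral_comp_emb hUe (fun x => ‖f x‖ₑ ^ P)).trans_le hf1
  · exact (hUp.lintegral_comp_emb hUe (fun x => ‖g x‖ₑ ^ Q)).trans_le hg1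
  · funext s
    have h := hUp.integral_comp hUe (fun x => f (x - U s) * g x)
    dsimp only
    rw [← h]
    simp only [map_sub]

theorem lintegral_dilate_le {R : ℝ} (hR : 0 < R) (hP : 0 < P)
    {f : EuclideanSpace ℝ (Fin n) → ℂ} (hf1 : ∫⁻ x, ‖f x‖ₑ ^ P ≤ 1) :
    ∫⁻ x, ‖(((R ^ n) ^ P⁻¹ : ℝ) : ℂ) * f (R • x)‖ₑ ^ P ≤ 1 := by
  have hRn : 0 < R ^ n := by positivity
  have h1 : ‖(((R ^ n) ^ P⁻¹ : ℝ) : ℂ)‖ₑ ^ P = ENNReal.ofReal (R ^ n) := by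
    rw [← ofReal_norm, Complex.norm_real, Real.norm_of_nonneg (by positivity),
      ENNReal.ofReal_rpow_of_nonneg (by positivity) hP.le, Real.rpow_inv_rpow hRn.le hP.ne']
  simp only [enorm_mul, ENNReal.mul_rpow_of_nonneg _ _ hP.le, h1]
  rw [lintegral_const_mul' _ _ ENNReal.ofReal_ne_top,
    lintegral_comp_smul hR.ne' (fun x => ‖f x‖ₑ ^ P), ← mul_assoc,
    ← ENNReal.ofReal_mul hRn.le, abs_of_pos hRn, mul_inv_cancel₀ hRn.ne', ENNReal.ofReal_one,
    one_mul]
  exact hf1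

/-- Dilate f and g by R and renormalize them by R^{n/P} and R^{n/Q}. As 1/P+1/Q = 1, these factors
multiply to R^n, which is exactly the Jacobian. -/
theorem corrClass_dilate (hPQ : P.HolderConjugate Q) : ∀ c ∈ corrClass n P Q, ∀ R : ℝ, 0 < R →
    (fun x => c (R • x)) ∈ corrClass n P Q := by
  rintro c ⟨f, g, hf, hg, hf1, hg1, rfl⟩ R hR
  have hRn : 0 < R ^ n := by positivity
  have hm : Measurable fun x : EuclideanSpace ℝ (Fin n) => R • x := measurable_const_smul R
  refine ⟨fun x => (((R ^ n) ^ P⁻¹ : ℝ) : ℂ) * f (R • x),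
    fun x => (((R ^ n) ^ Q⁻¹ : ℝ) : ℂ) * g (R • x), (hf.comp_measurable hm).const_mul _,
    (hg.comp_measurable hm).const_mul _, lintegral_dilate_le hR hPQ.pos hf1,
    lintegral_dilate_le hR hPQ.symm.pos hg1, ?_⟩
  funext s
  have h := Measure.integral_comp_smul (volume : Measure (EuclideanSpace ℝ (Fin n)))
    (fun x => f (x - R • s) * g x) R
  rw [finrank_euclideanSpace, Fintype.card_fin, abs_of_pos (by positivity),
    Complex.real_smul] at h
  have h1 : ((R ^ n) ^ P⁻¹ : ℝ) * ((R ^ n) ^ Q⁻¹ : ℝ) = R ^ n := by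
    rw [← Real.rpow_add hRn, hPQ.inv_add_inv_eq_one, Real.rpow_one]
  have h2 : ∀ x, ((((R ^ n) ^ P⁻¹ : ℝ) : ℂ) * f (R • (x - s))) *
      ((((R ^ n) ^ Q⁻¹ : ℝ) : ℂ) * g (R • x)) =
      ((R ^ n : ℝ) : ℂ) * (f (R • x - R • s) * g (R • x)) := by
    intro x
    have h3 := congrArg (fun t : ℝ => (t : ℂ)) h1
    simp only [Complex.ofReal_mul] at h3
    rw [← h3, smul_sub]
    ring
  simp only [h2]
  rw [integral_const_mul, h, ← mul_assoc, ← Complex.ofReal_mul, mul_inv_cancel₀ hRn.ne',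
    Complex.ofReal_one, one_mul]

/-- Pairing a kernel with a correlation is pairing a convolution with a function. -/
theorem integral_mul_corr (hPQ : P.HolderConjugate Q) {k f g : EuclideanSpace ℝ (Fin n) → ℂ}
    (hk : Integrable k) (hf : StronglyMeasurable f) (hg : StronglyMeasurable g)
    (hf1 : ∫⁻ x, ‖f x‖ₑ ^ P ≤ 1) (hg1 : ∫⁻ x, ‖g x‖ₑ ^ Q ≤ 1) :
    ∫ s, k s * ∫ x, f (x - s) * g x = ∫ x, (∫ s, k s * f (x - s)) * g x := by
  have hm : StronglyMeasurable fun z : EuclideanSpace ℝ (Fin n) × EuclideanSpace ℝ (Fin n) =>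
      f (z.2 - z.1) * g z.2 :=
    (hf.comp_measurable (measurable_snd.sub measurable_fst)).mul
      (hg.comp_measurable measurable_snd)
  have hm' : AEStronglyMeasurable (Function.uncurry fun s x => k s * (f (x - s) * g x))
      (volume.prod volume) := hk.aestronglyMeasurable.comp_fst.mul hm.aestronglyMeasurable
  have hint : Integrable (Function.uncurry fun s x => k s * (f (x - s) * g x))
      (volume.prod volume) := by
    refine ⟨hm', ?_⟩
    rw [HasFiniteIntegral, lintegral_prod _ hm'.enorm]
    refine lt_of_le_of_lt (lintegral_mono (g := fun s => ‖k s‖ₑ) fun s => ?_) hk.2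
    simp only [Function.uncurry_apply_pair, enorm_mul (k s)]
    rw [lintegral_const_mul' _ _ enorm_ne_top]
    exact mul_le_of_le_one_right zero_le (lintegral_corr_le hPQ hf hg hf1 hg1 s)
  have h := integral_integral_swap hint
  calc _ = ∫ s, ∫ x, k s * (f (x - s) * g x) := by simp only [integral_const_mul]
    _ = ∫ x, ∫ s, k s * (f (x - s) * g x) := h
    _ = _ := by simp only [← mul_assoc, integral_mul_const]

theorem integral_mul_comp_sub (k f : EuclideanSpace ℝ (Fin n) → ℂ)
    (x : EuclideanSpace ℝ (Fin n)) : ∫ s, k s * f (x - s) = ∫ y, k (x - y) * f y := by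
  rw [← integral_sub_left_eq_self (fun y => k (x - y) * f y) volume x]
  simp only [sub_sub_cancel]

/-- Hölder turns a bound for the convolution operator on L^P into a bound for the pairings. The
converse passage rests on `lintegral_rpow_le_of_forall_pairing`. -/
theorem norm_integral_mul_corr_le (hPQ : P.HolderConjugate Q)
    {k : EuclideanSpace ℝ (Fin n) → ℂ} (hk : Integrable k) (hkc : Continuous k) {N : ℝ}
    (hN : 0 ≤ N) (hkN : ∀ f : EuclideanSpace ℝ (Fin n) → ℂ, StronglyMeasurable f →
      ∫⁻ X, ‖∫ y, k (X - y) * f y‖ₑ ^ P ≤ ENNReal.ofReal (N ^ P) * ∫⁻ y, ‖f y‖ₑ ^ P) :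
    ∀ c ∈ corrClass n P Q, ‖∫ s, k s * c s‖ ≤ N := by
  rintro c ⟨f, g, hf, hg, hf1, hg1, rfl⟩
  have hP := hPQ.pos
  rw [integral_mul_corr hPQ hk hf hg hf1 hg1]
  simp only [integral_mul_comp_sub]
  have hm : StronglyMeasurable fun X => ∫ y, k (X - y) * f y :=
    StronglyMeasurable.integral_prod_right (f := fun X y => k (X - y) * f y)
      ((hkc.comp (continuous_fst.sub continuous_snd)).stronglyMeasurable.mul
        (hf.comp_measurable measurable_snd))
  have h1 := (enorm_integral_le_lintegral_enorm _).trans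
    (lintegral_mul_enorm_le hPQ hm.aestronglyMeasurable hg.aestronglyMeasurable hg1)
  have h2 : ∫⁻ X, ‖∫ y, k (X - y) * f y‖ₑ ^ P ≤ ENNReal.ofReal (N ^ P) :=
    (hkN f hf).trans (mul_le_of_le_one_right zero_le hf1)
  have h3 := h1.trans (ENNReal.rpow_le_rpow h2 (by positivity : 0 ≤ 1 / P))
  rw [ENNReal.ofReal_rpow_of_nonneg (by positivity) (by positivity), one_div,
    Real.rpow_rpow_inv hN hP.ne', ← ofReal_norm, ENNReal.ofReal_le_ofReal_iff hN] at h3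
  exact h3

end Correlation

/-! ### From half-spaces to a radial amplitude -/

section Radial

variable {n : ℕ} {χ : ℝ → ℝ}

theorem contDiff_radial (hχ : IsRadialBump χ) (hs : ContDiff ℝ ∞ χ) :
    ContDiff ℝ ∞ fun x : EuclideanSpace ℝ (Fin n) => χ ‖x‖ := by
  rw [contDiff_iff_contDiffAt]
  intro x
  by_cases hx : x = 0
  · refine (contDiffAt_const (c := (0 : ℝ))).congr_of_eventuallyEq ?_
    filter_upwards [ball_mem_nhds x one_pos] with y hy
    rw [hx, mem_ball_zero_iff] at hy
    exact hχ.zero _ fun h => by linarith [h.1]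
  · exact hs.contDiffAt.comp x (contDiffAt_norm ℝ hx)

/-- The signed basis vectors `±e_i`. -/
def signedBasis (j : Fin n × Bool) : EuclideanSpace ℝ (Fin n) :=
  (if j.2 then (1 : ℝ) else -1) • EuclideanSpace.single j.1 1

theorem norm_signedBasis (j : Fin n × Bool) : ‖signedBasis j‖ = 1 := by
  rw [signedBasis, norm_smul]
  rcases j.2 <;> simp

theorem exists_inner_signedBasis_pos {x : EuclideanSpace ℝ (Fin n)} (hx : x ≠ 0) :
    ∃ j, 0 < inner ℝ (signedBasis j) x := by
  obtain ⟨i, hi⟩ : ∃ i, x i ≠ 0 := by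
    by_contra! h
    exact hx (PiLp.ext h)
  rcases hi.lt_or_gt with h | h
  · exact ⟨(i, false), by simpa [signedBasis, inner_smul_left, EuclideanSpace.inner_single_left]⟩
  · exact ⟨(i, true), by simpa [signedBasis, inner_smul_left, EuclideanSpace.inner_single_left]⟩

/-- The reflection that exchanges the last basis vector and v. -/
theorem exists_isometry_last {m : ℕ} {v : EuclideanSpace ℝ (Fin (m + 1))} (hv : ‖v‖ = 1) :
    ∃ U : EuclideanSpace ℝ (Fin (m + 1)) ≃ₗᵢ[ℝ] EuclideanSpace ℝ (Fin (m + 1)),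
      ∀ x, inner ℝ v (U x) = x (Fin.last m) := by
  have h1 : ‖(EuclideanSpace.single (Fin.last m) (1 : ℝ))‖ = ‖v‖ := by simp [hv]
  refine ⟨Submodule.reflection
    (Submodule.span ℝ {EuclideanSpace.single (Fin.last m) (1 : ℝ) - v})ᗮ, fun x => ?_⟩
  have h2 := LinearIsometryEquiv.inner_map_map (Submodule.reflection
    (Submodule.span ℝ {EuclideanSpace.single (Fin.last m) (1 : ℝ) - v})ᗮ)
    (EuclideanSpace.single (Fin.last m) (1 : ℝ)) x
  rw [Submodule.reflection_sub h1] at h2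
  rw [h2]
  simp [EuclideanSpace.inner_single_left]

theorem integrable_oscKernel {A : EuclideanSpace ℝ (Fin n) → ℝ} (hA : Continuous A)
    (hAc : HasCompactSupport A) (lam : ℝ) : Integrable (oscKernel A lam) := by
  refine (continuous_oscKernel hA lam).integrable_of_hasCompactSupport ?_
  exact (hAc.comp_left (g := fun t : ℝ => (t : ℂ)) Complex.ofReal_zero).mul_left

/-- A partition of unity splits the shell 1 ≤ |x| ≤ 2 among the open half-spaces ⟨±eᵢ, x⟩ > 0. Each
piece is moved to the last coordinate by an isometry, which leaves the radial phase unchanged and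
maps the class into itself. -/
theorem exists_radial_bound_of_halfSpace {m : ℕ} (hχ : IsRadialBump χ) (hs : ContDiff ℝ ∞ χ)
    {α : ℝ} {𝒞 : Set (EuclideanSpace ℝ (Fin (m + 1)) → ℂ)}
    (hmeas : ∀ c ∈ 𝒞, AEStronglyMeasurable c) (hbd : ∀ c ∈ 𝒞, ∀ x, ‖c x‖ ≤ 1)
    (hiso : ∀ U : EuclideanSpace ℝ (Fin (m + 1)) ≃ₗᵢ[ℝ] EuclideanSpace ℝ (Fin (m + 1)),
      ∀ c ∈ 𝒞, (fun x => c (U x)) ∈ 𝒞)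
    (hhalf : ∀ (A : EuclideanSpace ℝ (Fin (m + 1)) → ℝ) (c ρ : ℝ), ContDiff ℝ ∞ A →
      (∀ x, 0 ≤ A x) → 0 < c → c ≤ ρ → (∀ x, A x ≠ 0 → c ≤ x (Fin.last m) ∧ ‖x‖ ≤ ρ) →
      ∃ C : ℝ, ∀ lam : ℝ, 1 ≤ lam → ∀ c ∈ 𝒞,
        ‖∫ s, oscKernel A lam s * c s‖ ≤ C * lam ^ (-α)) :
    ∃ C : ℝ, ∀ lam : ℝ, 1 ≤ lam → ∀ c ∈ 𝒞,
      ‖∫ s, oscKernel (fun x : EuclideanSpace ℝ (Fin (m + 1)) => χ ‖x‖) lam s * c s‖ ≤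
        C * lam ^ (-α) := by
  set S : Set (EuclideanSpace ℝ (Fin (m + 1))) := {x | 1 ≤ ‖x‖ ∧ ‖x‖ ≤ 2} with hS
  have hSc : IsClosed S := (isClosed_le continuous_const continuous_norm).inter
    (isClosed_le continuous_norm continuous_const)
  have hSk : IsCompact S := Metric.isCompact_of_isClosed_isBounded hSc
    (isBounded_closedBall.subset fun x hx => mem_closedBall_zero_iff.mpr hx.2)
  obtain ⟨f, hf⟩ := SmoothPartitionOfUnity.exists_isSubordinate
    (modelWithCornersSelf ℝ (EuclideanSpace ℝ (Fin (m + 1)))) hSc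
    (fun j : Fin (m + 1) × Bool => {x | 0 < inner ℝ (signedBasis j) x})
    (fun j => isOpen_lt continuous_const (by fun_prop)) (fun x hx => by
      have hx0 : x ≠ 0 := by
        rintro rfl
        have := hx.1
        simp at this
        linarith
      exact Set.mem_iUnion.mpr (exists_inner_signedBasis_pos hx0))
  set A : Fin (m + 1) × Bool → EuclideanSpace ℝ (Fin (m + 1)) → ℝ :=
    fun j x => χ ‖x‖ * f j x with hA
  have hχS : ∀ x : EuclideanSpace ℝ (Fin (m + 1)), χ ‖x‖ ≠ 0 → x ∈ S := fun x hx => by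
    by_contra h
    exact hx (hχ.zero _ h)
  have hAs : ∀ j, ContDiff ℝ ∞ (A j) := fun j =>
    (contDiff_radial hχ hs).mul (f j).contMDiff.contDiff
  have hA0 : ∀ j x, 0 ≤ A j x := fun j x => mul_nonneg (hχ.nonneg _) (f.nonneg j x)
  have hAc : ∀ j, HasCompactSupport (A j) := fun j =>
    HasCompactSupport.intro hSk fun x hx => by
      rw [hA]
      simp only
      rw [show χ ‖x‖ = 0 by by_contra h; exact hx (hχS x h), zero_mul]
  have hsum : ∀ x, χ ‖x‖ = ∑ j, A j x := by
    intro x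
    by_cases hx : χ ‖x‖ = 0
    · simp [hA, hx]
    · have h1 := f.sum_eq_one (hχS x hx)
      rw [finsum_eq_sum_of_fintype] at h1
      simp only [hA]
      rw [← Finset.mul_sum, h1, mul_one]
  have hpiece : ∀ j, ∃ C : ℝ, ∀ lam : ℝ, 1 ≤ lam → ∀ c ∈ 𝒞,
      ‖∫ s, oscKernel (A j) lam s * c s‖ ≤ C * lam ^ (-α) := by
    intro j
    obtain ⟨U, hU⟩ := exists_isometry_last (norm_signedBasis j)
    have hK : IsCompact (S ∩ tsupport (f j)) := hSk.inter_right (isClosed_tsupport _)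
    -- Compactness turns positivity of the height on the closed support into a positive lower bound,
    -- as the half-space estimate requires.
    obtain ⟨b, hb, hbK⟩ := hK.exists_forall_le' (f := fun x => inner ℝ (signedBasis j) x) (a := 0)
      (by fun_prop) fun x hx => hf j hx.2
    obtain ⟨C, hC⟩ := hhalf (fun x => A j (U x)) b (max 2 b) ((hAs j).comp U.contDiff)
      (fun x => hA0 j _) hb (le_max_right _ _) (fun x hx => by
        have h1 : χ ‖U x‖ * f j (U x) ≠ 0 := hx
        have h2 := hχS _ (left_ne_zero_of_mul h1)
        have h3 := hbK (U x) ⟨h2, subset_tsupport _ (right_ne_zero_of_mul h1)⟩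
        simp only [hU] at h3
        refine ⟨h3, ?_⟩
        have h4 := h2.2
        rw [U.norm_map] at h4
        exact h4.trans (le_max_left _ _))
    refine ⟨C, fun lam hlam c hc => ?_⟩
    have h1 := hC lam hlam _ (hiso U c hc)
    have h2 := U.measurePreserving.integral_comp U.toHomeomorph.measurableEmbedding
      (fun s => oscKernel (A j) lam s * c s)
    rw [← h2]
    refine le_of_eq_of_le ?_ h1
    simp only [oscKernel, U.norm_map]
  choose C hC using hpiece
  refine ⟨∑ j, C j, fun lam hlam c hc => ?_⟩
  have h1 : ∀ s, oscKernel (fun x : EuclideanSpace ℝ (Fin (m + 1)) => χ ‖x‖) lam s * c s =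
      ∑ j, oscKernel (A j) lam s * c s := by
    intro s
    rw [← Finset.sum_mul]
    congr 1
    simp only [oscKernel, hsum, Complex.ofReal_sum, Finset.mul_sum]
  simp only [h1]
  rw [integral_finsetSum, Finset.sum_mul]
  · exact norm_sum_le_of_le _ fun j _ => hC j lam hlam c hc
  · intro j _
    exact (integrable_oscKernel (hAs j).continuous (hAc j) lam).mul_bdd (c := 1) (hmeas c hc)
      (Filter.Eventually.of_forall (hbd c hc))

/-- Passing from frequencies `2πλ`, `λ ≥ 1`, to all real frequencies. -/
theorem exists_osc_bound (hχ : IsRadialBump χ) {α : ℝ} (hα : 0 ≤ α)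
    {𝒞 : Set (EuclideanSpace ℝ (Fin n) → ℂ)} (hbd : ∀ c ∈ 𝒞, ∀ x, ‖c x‖ ≤ 1)
    (hconj : ∀ c ∈ 𝒞, (fun x => star (c x)) ∈ 𝒞)
    (hrad : ∃ C : ℝ, ∀ lam : ℝ, 1 ≤ lam → ∀ c ∈ 𝒞,
      ‖∫ s, oscKernel (fun x : EuclideanSpace ℝ (Fin n) => χ ‖x‖) lam s * c s‖ ≤
        C * lam ^ (-α)) :
    ∃ C₀ : ℝ, 0 ≤ C₀ ∧ ∀ c ∈ 𝒞, ∀ μ : ℝ,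
      ‖∫ x, Complex.exp ((μ * ‖x‖ : ℝ) * Complex.I) * χ ‖x‖ * c x‖ ≤ C₀ * (1 + |μ|) ^ (-α) := by
  obtain ⟨C, hC⟩ := hrad
  set I : ℝ := ∫ x : EuclideanSpace ℝ (Fin n), χ ‖x‖ with hI
  have hI0 : 0 ≤ I := integral_nonneg fun x => hχ.nonneg _
  have hπ := Real.pi_pos
  -- C serves frequencies μ ≥ 2π, and the trivial bound I serves smaller ones; the last factor
  -- converts powers of μ/(2π) into powers of 1+μ.
  set D : ℝ := max C I * (1 + 2 * Real.pi) ^ α with hD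
  have hD0 : 0 ≤ D := mul_nonneg (hI0.trans (le_max_right _ _)) (by positivity)
  have hnn : ∀ c ∈ 𝒞, ∀ μ : ℝ, 0 ≤ μ →
      ‖∫ x, Complex.exp ((μ * ‖x‖ : ℝ) * Complex.I) * χ ‖x‖ * c x‖ ≤ D * (1 + μ) ^ (-α) := by
    intro c hc μ hμ
    rcases le_or_gt (2 * Real.pi) μ with h | h
    · have h1 : 1 ≤ μ / (2 * Real.pi) := (one_le_div (by positivity)).mpr h
      have h2 := hC _ h1 c hc
      have h3 : (μ / (2 * Real.pi)) ^ (-α) ≤ (1 + 2 * Real.pi) ^ α * (1 + μ) ^ (-α) := by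
        have h4 : (1 + μ) / (1 + 2 * Real.pi) ≤ μ / (2 * Real.pi) := by
          rw [div_le_div_iff₀ (by positivity) (by positivity)]
          nlinarith
        refine (Real.rpow_le_rpow_of_nonpos (by positivity) h4 (by linarith)).trans_eq ?_
        rw [Real.div_rpow (by positivity) (by positivity), Real.rpow_neg (by positivity) α,
          Real.rpow_neg (by positivity) α]
        field_simp
      calc _ = ‖∫ s, oscKernel (fun x : EuclideanSpace ℝ (Fin n) => χ ‖x‖)
            (μ / (2 * Real.pi)) s * c s‖ := by
            congr 2
            funext s
            rw [oscKernel]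
            congr 3
            push_cast
            field_simp
        _ ≤ C * (μ / (2 * Real.pi)) ^ (-α) := h2
        _ ≤ max C I * ((1 + 2 * Real.pi) ^ α * (1 + μ) ^ (-α)) := by
            refine mul_le_mul (le_max_left _ _) h3 (by positivity)
              (hI0.trans (le_max_right _ _))
        _ = _ := by rw [hD]; ring
    · have h1 : ‖∫ x, Complex.exp ((μ * ‖x‖ : ℝ) * Complex.I) * χ ‖x‖ * c x‖ ≤ I := by
        refine norm_integral_le_of_norm_le hχ.integrable_norm
          (Filter.Eventually.of_forall fun x => ?_)
        rw [norm_mul, norm_mul, Complex.norm_exp_ofReal_mul_I, one_mul, Complex.norm_real,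
          Real.norm_of_nonneg (hχ.nonneg _)]
        exact mul_le_of_le_one_right (hχ.nonneg _) (hbd c hc x)
      refine h1.trans ?_
      rw [hD, mul_assoc]
      have h2 : 1 ≤ (1 + 2 * Real.pi) ^ α * (1 + μ) ^ (-α) := by
        rw [Real.rpow_neg (by positivity), ← div_eq_mul_inv, one_le_div (by positivity)]
        exact Real.rpow_le_rpow (by positivity) (by linarith) hα
      exact (le_max_right C I).trans
        (le_mul_of_one_le_right (hI0.trans (le_max_right _ _)) h2)
  refine ⟨D, hD0, fun c hc μ => ?_⟩
  rcases le_or_gt 0 μ with h | h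
  · rw [abs_of_nonneg h]
    exact hnn c hc μ h
  · rw [abs_of_neg h]
    have h1 := hnn _ (hconj c hc) (-μ) (by linarith)
    refine le_of_eq_of_le ?_ h1
    rw [← RCLike.norm_conj, ← integral_conj]
    congr 2
    funext x
    rw [map_mul, map_mul, ← Complex.exp_conj, map_mul, Complex.conj_I, Complex.conj_ofReal,
      Complex.conj_ofReal, starRingEnd_apply, mul_neg, ← neg_mul, ← Complex.ofReal_neg, neg_mul]

end Radial

/-! ### Convolution with an integrable kernel on `L^p` -/

section Conv

variable {n : ℕ} {k f g : EuclideanSpace ℝ (Fin n) → ℂ}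

/-- The convolution `x ↦ ∫ k(s) f(x - s) ds`. -/
def conv (k f : EuclideanSpace ℝ (Fin n) → ℂ) (x : EuclideanSpace ℝ (Fin n)) : ℂ :=
  ∫ s, k s * f (x - s)

theorem comp_sub_left_ae_eq (h : f =ᵐ[volume] g) (x : EuclideanSpace ℝ (Fin n)) :
    (fun s => f (x - s)) =ᵐ[volume] fun s => g (x - s) :=
  (Measure.measurePreserving_sub_left volume x).quasiMeasurePreserving.ae_eq_comp h

theorem conv_congr_ae (h : f =ᵐ[volume] g) : conv k f = conv k g := by
  funext x
  refine integral_congr_ae ?_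
  filter_upwards [comp_sub_left_ae_eq h x] with s hs
  rw [hs]

theorem stronglyMeasurable_conv (hk : StronglyMeasurable k) (hf : StronglyMeasurable f) :
    StronglyMeasurable (conv k f) :=
  StronglyMeasurable.integral_prod_right (f := fun x s => k s * f (x - s))
    ((hk.comp_measurable measurable_snd).mul
      (hf.comp_measurable (measurable_fst.sub measurable_snd)))

/-- Hölder for the measure |k(s)| ds, followed by Tonelli and translation invariance. -/
theorem lintegral_rpow_conv_le {P : ℝ} (hP : 1 ≤ P) (hk : StronglyMeasurable k)
    (hf : StronglyMeasurable f) :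
    ∫⁻ x, (∫⁻ s, ‖k s * f (x - s)‖ₑ) ^ P ≤ (∫⁻ s, ‖k s‖ₑ) ^ P * ∫⁻ x, ‖f x‖ₑ ^ P := by
  have hP0 : 0 < P := by linarith
  have hfs : ∀ x, Measurable fun s => ‖f (x - s)‖ₑ := fun x =>
    (hf.comp_measurable (measurable_id.const_sub x)).enorm
  have h1 : ∀ x, (∫⁻ s, ‖k s * f (x - s)‖ₑ) ^ P ≤
      (∫⁻ s, ‖k s‖ₑ) ^ (P - 1) * ∫⁻ s, ‖k s‖ₑ * ‖f (x - s)‖ₑ ^ P := by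
    intro x
    have h2 := rpow_lintegral_le (volume.withDensity fun s => ‖k s‖ₑ) hP (hfs x).aemeasurable
    rw [withDensity_apply _ MeasurableSet.univ, setLIntegral_univ,
      lintegral_withDensity_eq_lintegral_mul _ hk.enorm (hfs x),
      lintegral_withDensity_eq_lintegral_mul _ hk.enorm ((hfs x).pow_const P)] at h2
    simpa only [enorm_mul, Pi.mul_apply] using h2
  have hm : Measurable (Function.uncurry fun (x s : EuclideanSpace ℝ (Fin n)) =>
      ‖k s‖ₑ * ‖f (x - s)‖ₑ ^ P) :=
    (hk.comp_measurable measurable_snd).enorm.mul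
      ((hf.comp_measurable (measurable_fst.sub measurable_snd)).enorm.pow_const P)
  calc _ ≤ ∫⁻ x, (∫⁻ s, ‖k s‖ₑ) ^ (P - 1) * ∫⁻ s, ‖k s‖ₑ * ‖f (x - s)‖ₑ ^ P :=
        lintegral_mono h1
    _ = (∫⁻ s, ‖k s‖ₑ) ^ (P - 1) * ∫⁻ s, ∫⁻ x, ‖k s‖ₑ * ‖f (x - s)‖ₑ ^ P := by
        rw [lintegral_const_mul _ (Measurable.lintegral_prod_right hm),
          lintegral_lintegral_swap hm.aemeasurable]
    _ = (∫⁻ s, ‖k s‖ₑ) ^ (P - 1) * ((∫⁻ s, ‖k s‖ₑ) * ∫⁻ x, ‖f x‖ₑ ^ P) := by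
        congr 1
        rw [← lintegral_mul_const _ hk.enorm]
        congr 1
        funext s
        rw [lintegral_const_mul' _ _ enorm_ne_top,
          lintegral_sub_right_eq_self (fun x => ‖f x‖ₑ ^ P)]
    _ = _ := by
        rw [← mul_assoc]
        congr 1
        nth_rewrite 2 [← ENNReal.rpow_one (∫⁻ s, ‖k s‖ₑ)]
        rw [← ENNReal.rpow_add_of_nonneg _ _ (by linarith) zero_le_one, sub_add_cancel]

/-- Young's inequality `‖k * f‖_p ≤ ‖k‖_1 ‖f‖_p`. -/
theorem young_one {p : ℝ≥0∞} (hp : 1 ≤ p) (hk : StronglyMeasurable k) (hki : Integrable k)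
    (hf : StronglyMeasurable f) (hfp : MemLp f p) :
    (∀ᵐ x, Integrable fun s => k s * f (x - s)) ∧
      eLpNorm (conv k f) p ≤ (∫⁻ s, ‖k s‖ₑ) * eLpNorm f p := by
  have hK : ∫⁻ s, ‖k s‖ₑ ≠ ⊤ := hki.2.ne
  have hp0 : p ≠ 0 := (zero_lt_one.trans_le hp).ne'
  have hm : ∀ x, StronglyMeasurable fun s => k s * f (x - s) := fun x =>
    hk.mul (hf.comp_measurable (measurable_id.const_sub x))
  have hle : ∀ x, ‖conv k f x‖ₑ ≤ ∫⁻ s, ‖k s * f (x - s)‖ₑ := fun x =>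
    enorm_integral_le_lintegral_enorm _
  by_cases hpt : p = ⊤
  · subst hpt
    rw [eLpNorm_exponent_top, eLpNorm_exponent_top]
    have h1 : ∀ x, ∫⁻ s, ‖k s * f (x - s)‖ₑ ≤ (∫⁻ s, ‖k s‖ₑ) * eLpNormEssSup f volume := by
      intro x
      rw [← lintegral_mul_const _ hk.enorm]
      refine lintegral_mono_ae ?_
      have h2 := (Measure.measurePreserving_sub_left volume x).quasiMeasurePreserving.ae
        (enorm_ae_le_eLpNormEssSup f volume)
      filter_upwards [h2] with s hs
      rw [enorm_mul]
      gcongr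
    refine ⟨Filter.Eventually.of_forall fun x => ⟨(hm x).aestronglyMeasurable,
      (h1 x).trans_lt (ENNReal.mul_lt_top hK.lt_top ?_)⟩, ?_⟩
    · have := hfp.2
      rwa [eLpNorm_exponent_top] at this
    · exact eLpNormEssSup_le_of_ae_enorm_bound
        (Filter.Eventually.of_forall fun x => (hle x).trans (h1 x))
  · have hP1 : 1 ≤ p.toReal := by
      rwa [← ENNReal.toReal_one, ENNReal.toReal_le_toReal ENNReal.one_ne_top hpt]
    have hP0 : 0 < p.toReal := by linarith
    have h1 := lintegral_rpow_conv_le hP1 hk hf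
    have hfin : ∫⁻ x, ‖f x‖ₑ ^ p.toReal < ⊤ :=
      (eLpNorm_lt_top_iff_lintegral_rpow_enorm_lt_top hp0 hpt).mp hfp.2
    have hNm : Measurable fun x => ∫⁻ s, ‖k s * f (x - s)‖ₑ :=
      Measurable.lintegral_prod_right (f := fun x s => ‖k s * f (x - s)‖ₑ)
        ((hk.comp_measurable measurable_snd).mul
          (hf.comp_measurable (measurable_fst.sub measurable_snd))).enorm
    constructor
    · have h2 := ae_lt_top (hNm.pow_const p.toReal) (h1.trans_lt (ENNReal.mul_lt_top
        (ENNReal.rpow_lt_top_of_nonneg hP0.le hK) hfin)).ne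
      filter_upwards [h2] with x hx
      exact ⟨(hm x).aestronglyMeasurable, (ENNReal.rpow_lt_top_iff_of_pos hP0).mp hx⟩
    · rw [eLpNorm_eq_lintegral_rpow_enorm_toReal hp0 hpt,
        eLpNorm_eq_lintegral_rpow_enorm_toReal hp0 hpt]
      have h2 : ∫⁻ x, ‖conv k f x‖ₑ ^ p.toReal ≤
          (∫⁻ s, ‖k s‖ₑ) ^ p.toReal * ∫⁻ x, ‖f x‖ₑ ^ p.toReal :=
        (lintegral_mono fun x => ENNReal.rpow_le_rpow (hle x) hP0.le).trans h1
      refine (ENNReal.rpow_le_rpow h2 (by positivity : 0 ≤ 1 / p.toReal)).trans_eq ?_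
      rw [ENNReal.mul_rpow_of_nonneg _ _ (by positivity), one_div,
        ENNReal.rpow_rpow_inv hP0.ne']

theorem memLp_conv {p : ℝ≥0∞} (hp : 1 ≤ p) (hk : StronglyMeasurable k) (hki : Integrable k)
    (hf : StronglyMeasurable f) (hfp : MemLp f p) : MemLp (conv k f) p :=
  ⟨(stronglyMeasurable_conv hk hf).aestronglyMeasurable,
    (young_one hp hk hki hf hfp).2.trans_lt (ENNReal.mul_lt_top hki.2 hfp.2)⟩

theorem exists_conv_clm (p : ℝ≥0∞) [Fact (1 ≤ p)] (hk : StronglyMeasurable k)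
    (hki : Integrable k) :
    ∃ R : Lp ℂ p (volume : Measure (EuclideanSpace ℝ (Fin n))) →L[ℂ]
        Lp ℂ p (volume : Measure (EuclideanSpace ℝ (Fin n))),
      ∀ f, R f =ᵐ[volume] conv k f := by
  have hp : 1 ≤ p := Fact.out
  have hm : ∀ f : Lp ℂ p (volume : Measure (EuclideanSpace ℝ (Fin n))), MemLp (conv k f) p :=
    fun f => memLp_conv hp hk hki (Lp.stronglyMeasurable f) (Lp.memLp f)
  have hi : ∀ f : Lp ℂ p (volume : Measure (EuclideanSpace ℝ (Fin n))),
      ∀ᵐ x, Integrable fun s => k s * f (x - s) :=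
    fun f => (young_one hp hk hki (Lp.stronglyMeasurable f) (Lp.memLp f)).1
  let R : Lp ℂ p (volume : Measure (EuclideanSpace ℝ (Fin n))) →ₗ[ℂ]
      Lp ℂ p (volume : Measure (EuclideanSpace ℝ (Fin n))) :=
    { toFun := fun f => (hm f).toLp
      map_add' := fun f g => by
        ext1
        filter_upwards [(hm (f + g)).coeFn_toLp, (hm f).coeFn_toLp, (hm g).coeFn_toLp,
          Lp.coeFn_add (hm f).toLp (hm g).toLp, hi f, hi g] with x h1 h2 h3 h4 h5 h6
        rw [h1, h4, Pi.add_apply, h2, h3, conv_congr_ae (Lp.coeFn_add f g), conv, conv, conv,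
          ← integral_add h5 h6]
        simp only [Pi.add_apply, mul_add]
      map_smul' := fun a f => by
        ext1
        filter_upwards [(hm (a • f)).coeFn_toLp, (hm f).coeFn_toLp,
          Lp.coeFn_smul a (hm f).toLp] with x h1 h2 h4
        rw [h1, RingHom.id_apply, h4, Pi.smul_apply, h2, conv_congr_ae (Lp.coeFn_smul a f), conv,
          conv, smul_eq_mul, ← integral_const_mul]
        simp only [Pi.smul_apply, smul_eq_mul, mul_left_comm] }
  refine ⟨R.mkContinuous (∫⁻ s, ‖k s‖ₑ).toReal fun f => ?_, fun f => (hm f).coeFn_toLp⟩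
  change ‖(hm f).toLp‖ ≤ _
  rw [Lp.norm_toLp, Lp.norm_def, ← ENNReal.toReal_mul]
  exact ENNReal.toReal_mono (ENNReal.mul_ne_top hki.2.ne (Lp.memLp f).2.ne)
    (young_one hp hk hki (Lp.stronglyMeasurable f) (Lp.memLp f)).2

/-! ### Bounds by duality -/

/-- Test on the extremizer of Hölder's inequality, |u|^{P-2} times the conjugate of u, divided by
σ^{1/Q}, where σ is the integral of |u|^P. Finiteness of σ is what permits this normalization; the
pairing then equals σ^{1/P}. -/
theorem lintegral_rpow_le_of_forall_pairing {P Q : ℝ} (hPQ : P.HolderConjugate Q)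
    {u : EuclideanSpace ℝ (Fin n) → ℂ} (hu : StronglyMeasurable u)
    (hfin : ∫⁻ x, ‖u x‖ₑ ^ P ≠ ⊤) {N : ℝ}
    (hpair : ∀ g : EuclideanSpace ℝ (Fin n) → ℂ, StronglyMeasurable g →
      ∫⁻ x, ‖g x‖ₑ ^ Q ≤ 1 → ‖∫ x, u x * g x‖ ≤ N) :
    ∫⁻ x, ‖u x‖ₑ ^ P ≤ ENNReal.ofReal (N ^ P) := by
  have hP := hPQ.pos
  have hQ := hPQ.symm.pos
  have hnn : ∀ x, 0 ≤ ‖u x‖ ^ P := fun x => by positivity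
  have henorm : ∀ x, ‖u x‖ₑ ^ P = ENNReal.ofReal (‖u x‖ ^ P) := fun x => by
    rw [← ofReal_norm, ENNReal.ofReal_rpow_of_nonneg (norm_nonneg _) hP.le]
  have hmeas : AEStronglyMeasurable (fun x => ‖u x‖ ^ P) :=
    (hu.norm.measurable.pow_const P).aestronglyMeasurable
  set σ : ℝ := ∫ x, ‖u x‖ ^ P with hσ
  have hσl : ∫⁻ x, ‖u x‖ₑ ^ P = ENNReal.ofReal σ := by
    simp only [henorm] at hfin ⊢
    rw [hσ, integral_eq_lintegral_of_nonneg_ae (Filter.Eventually.of_forall hnn) hmeas,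
      ENNReal.ofReal_toReal hfin]
  have hσ0 : 0 ≤ σ := integral_nonneg hnn
  clear_value σ
  rcases hσ0.eq_or_lt with h0 | h0
  · rw [hσl, ← h0, ENNReal.ofReal_zero]
    exact zero_le
  set g : EuclideanSpace ℝ (Fin n) → ℂ := fun x =>
    ((σ ^ (-Q⁻¹) * ‖u x‖ ^ (P - 2) : ℝ) : ℂ) * star (u x) with hg
  have hgm : StronglyMeasurable g := by
    refine StronglyMeasurable.mul ?_ hu.star
    exact (Complex.measurable_ofReal.comp
      ((hu.norm.measurable.pow_const (P - 2)).const_mul _)).stronglyMeasurable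
  have hgn : ∀ x, ‖g x‖ = σ ^ (-Q⁻¹) * ‖u x‖ ^ (P - 1) := by
    intro x
    rw [hg]
    simp only
    rw [norm_mul, Complex.norm_real, Real.norm_of_nonneg (by positivity), norm_star, mul_assoc]
    congr 1
    rcases (norm_nonneg (u x)).eq_or_lt with h | h
    · rw [← h, mul_zero, Real.zero_rpow (by linarith [hPQ.lt])]
    · rw [← Real.rpow_add_one h.ne']
      congr 1
      ring
  have hgQ : ∫⁻ x, ‖g x‖ₑ ^ Q ≤ 1 := by
    have h1 : ∀ x, ‖g x‖ₑ ^ Q = ENNReal.ofReal σ⁻¹ * ‖u x‖ₑ ^ P := by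
      intro x
      rw [henorm, ← ofReal_norm, ENNReal.ofReal_rpow_of_nonneg (norm_nonneg _) hQ.le, hgn,
        Real.mul_rpow (by positivity) (by positivity), ← Real.rpow_mul h0.le,
        ← Real.rpow_mul (norm_nonneg _), hPQ.sub_one_mul_conj,
        neg_mul, inv_mul_cancel₀ hQ.ne', Real.rpow_neg_one, ENNReal.ofReal_mul (by positivity)]
    simp only [h1]
    rw [lintegral_const_mul' _ _ ENNReal.ofReal_ne_top, hσl,
      ← ENNReal.ofReal_mul (by positivity), inv_mul_cancel₀ h0.ne', ENNReal.ofReal_one]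
  have h2 := hpair g hgm hgQ
  have h3 : ∀ x, u x * g x = ((σ ^ (-Q⁻¹) * ‖u x‖ ^ P : ℝ) : ℂ) := by
    intro x
    rw [hg]
    simp only
    have h4 : u x * star (u x) = ((‖u x‖ ^ 2 : ℝ) : ℂ) := by
      rw [← starRingEnd_apply, Complex.mul_conj, Complex.normSq_eq_norm_sq]
    rw [mul_left_comm, h4, ← Complex.ofReal_mul, mul_assoc]
    congr 2
    rcases (norm_nonneg (u x)).eq_or_lt with h | h
    · rw [← h, Real.zero_rpow hP.ne']
      simp
    · rw [← Real.rpow_natCast ‖u x‖ 2, ← Real.rpow_add h]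
      congr 1
      push_cast
      ring
  simp only [h3] at h2
  rw [integral_complex_ofReal, Complex.norm_real, integral_const_mul, ← hσ,
    Real.norm_of_nonneg (by positivity)] at h2
  have h5 : σ ^ P⁻¹ ≤ N := by
    refine le_of_eq_of_le ?_ h2
    nth_rewrite 3 [← Real.rpow_one σ]
    rw [← Real.rpow_add h0]
    congr 1
    have := hPQ.inv_add_inv_eq_one
    linarith
  rw [hσl]
  refine ENNReal.ofReal_le_ofReal ?_
  have h6 := Real.rpow_le_rpow (by positivity) h5 hP.le
  rwa [Real.rpow_inv_rpow h0.le hP.ne'] at h6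

end Conv

/-! ### The resolvent as a convolution operator -/

section Multiplier

variable {n : ℕ} {k : EuclideanSpace ℝ (Fin n) → ℂ}

open scoped FourierTransform

/-- On test functions, the transpose of the multiplier `𝓕 k` is correlation with `k`. -/
theorem fourier_smulLeft_fourierInv_apply (hki : Integrable k)
    {μ : EuclideanSpace ℝ (Fin n) → ℂ} (hμ : μ.HasTemperateGrowth) (hkμ : ∀ ξ, 𝓕 k ξ = μ ξ)
    (φ : 𝓢(EuclideanSpace ℝ (Fin n), ℂ)) (y : EuclideanSpace ℝ (Fin n)) :
    (𝓕 (SchwartzMap.smulLeftCLM ℂ μ (𝓕⁻ φ))) y = ∫ s, k s * φ (y + s) := by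
  set ψ : 𝓢(EuclideanSpace ℝ (Fin n), ℂ) := 𝓕⁻ φ with hψ
  have hφψ : 𝓕 ψ = φ := by simp [hψ]
  have hφ : ∀ v, φ v = ∫ ξ, Complex.exp (((-2 * Real.pi * inner ℝ ξ v : ℝ) : ℂ) * Complex.I) *
      ψ ξ := by
    intro v
    rw [← hφψ, SchwartzMap.fourier_coe, Real.fourier_eq']
    simp only [smul_eq_mul]
  set F : EuclideanSpace ℝ (Fin n) → EuclideanSpace ℝ (Fin n) → ℂ := fun ξ s =>
    Complex.exp (((-2 * Real.pi * inner ℝ ξ (y + s) : ℝ) : ℂ) * Complex.I) * (ψ ξ * k s) with hF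
  have hint : Integrable (Function.uncurry F) (volume.prod volume) := by
    refine (ψ.integrable.mul_prod hki).bdd_mul (c := 1) ?_ ?_
    · have : Continuous fun q : EuclideanSpace ℝ (Fin n) × EuclideanSpace ℝ (Fin n) =>
        Complex.exp (((-2 * Real.pi * inner ℝ q.1 (y + q.2) : ℝ) : ℂ) * Complex.I) := by fun_prop
      exact this.aestronglyMeasurable
    · exact Filter.Eventually.of_forall fun q => (Complex.norm_exp_ofReal_mul_I _).le
  rw [SchwartzMap.fourier_coe, Real.fourier_eq']
  calc _ = ∫ ξ, ∫ s, F ξ s := by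
        refine integral_congr_ae (Filter.Eventually.of_forall fun ξ => ?_)
        simp only [hF]
        rw [SchwartzMap.smulLeftCLM_apply_apply hμ, ← hkμ, Real.fourier_eq', smul_eq_mul,
          smul_eq_mul, mul_comm (∫ v, _) (ψ ξ), ← integral_const_mul, ← integral_const_mul]
        refine integral_congr_ae (Filter.Eventually.of_forall fun s => ?_)
        simp only [smul_eq_mul]
        rw [inner_add_right, mul_add, Complex.ofReal_add, add_mul, Complex.exp_add,
          real_inner_comm s ξ]
        ring
    _ = ∫ s, ∫ ξ, F ξ s := integral_integral_swap hint
    _ = _ := by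
        refine integral_congr_ae (Filter.Eventually.of_forall fun s => ?_)
        simp only [hF, hφ (y + s)]
        rw [← integral_const_mul]
        refine integral_congr_ae (Filter.Eventually.of_forall fun ξ => ?_)
        simp only
        ring

/-- For fixed s, Hölder between φ and the translate of f gives a bound independent of s, which is
integrable against |k|. -/
theorem integrable_mul_mul_comp_sub {p : ℝ≥0∞} (hp : 1 ≤ p) (hk : StronglyMeasurable k)
    (hki : Integrable k) {f : EuclideanSpace ℝ (Fin n) → ℂ} (hf : StronglyMeasurable f)
    (hfp : MemLp f p) (φ : 𝓢(EuclideanSpace ℝ (Fin n), ℂ)) :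
    Integrable (Function.uncurry fun x s => φ x * (k s * f (x - s))) (volume.prod volume) := by
  have hm : StronglyMeasurable (Function.uncurry fun x s => φ x * (k s * f (x - s))) :=
    (φ.continuous.stronglyMeasurable.comp_measurable measurable_fst).mul
      ((hk.comp_measurable measurable_snd).mul
        (hf.comp_measurable (measurable_fst.sub measurable_snd)))
  refine ⟨hm.aestronglyMeasurable, ?_⟩
  rw [HasFiniteIntegral, lintegral_prod_symm' _ hm.enorm]
  have := ENNReal.HolderConjugate.conjExponent hp
  set q := ENNReal.conjExponent p with hq
  have : q.HolderConjugate p := .symm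
  have hφ : MemLp φ q := φ.memLp q volume
  have h1 : ∀ s, ∫⁻ x, ‖Function.uncurry (fun x s => φ x * (k s * f (x - s))) (x, s)‖ₑ ≤
      ‖k s‖ₑ * (eLpNorm φ q * eLpNorm f p) := by
    intro s
    have h2 : MemLp (fun x => f (x - s)) p :=
      hfp.comp_measurePreserving (measurePreserving_sub_right volume s)
    have h3 := eLpNorm_smul_le_mul_eLpNorm (p := q) (q := p) (r := 1) h2.1 hφ.1
    rw [eLpNorm_one_eq_lintegral_enorm] at h3
    have h4 : eLpNorm (fun x => f (x - s)) p = eLpNorm f p :=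
      eLpNorm_comp_measurePreserving hfp.1 (measurePreserving_sub_right volume s)
    rw [h4] at h3
    calc _ = ∫⁻ x, ‖k s‖ₑ * ‖(⇑φ • fun x => f (x - s)) x‖ₑ := by
          refine lintegral_congr fun x => ?_
          simp only [Function.uncurry_apply_pair, Pi.smul_apply', smul_eq_mul, enorm_mul]
          ring
      _ = ‖k s‖ₑ * ∫⁻ x, ‖(⇑φ • fun x => f (x - s)) x‖ₑ := lintegral_const_mul' _ _ enorm_ne_top
      _ ≤ _ := by gcongr
  refine (lintegral_mono h1).trans_lt ?_
  rw [lintegral_mul_const _ hk.enorm]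
  exact ENNReal.mul_lt_top hki.2 (ENNReal.mul_lt_top hφ.2 hfp.2)

/-- Convolution with `k` is the Fourier multiplier with symbol `𝓕 k`. -/
theorem toTemperedDistribution_conv {p : ℝ≥0∞} [Fact (1 ≤ p)] (hk : StronglyMeasurable k)
    (hki : Integrable k) {μ : EuclideanSpace ℝ (Fin n) → ℂ} (hμ : μ.HasTemperateGrowth)
    (hkμ : ∀ ξ, 𝓕 k ξ = μ ξ) {f g : Lp ℂ p (volume : Measure (EuclideanSpace ℝ (Fin n)))}
    (hg : g =ᵐ[volume] conv k f) :
    Lp.toTemperedDistribution g =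
      TemperedDistribution.fourierMultiplierCLM ℂ μ (Lp.toTemperedDistribution f) := by
  ext φ
  have hint := integrable_mul_mul_comp_sub Fact.out hk hki (Lp.stronglyMeasurable f)
    (Lp.memLp f) φ
  have h1 : (TemperedDistribution.fourierMultiplierCLM ℂ μ (Lp.toTemperedDistribution f)) φ =
      (Lp.toTemperedDistribution f) (𝓕 (SchwartzMap.smulLeftCLM ℂ μ (𝓕⁻ φ))) := rfl
  rw [h1, Lp.toTemperedDistribution_apply, Lp.toTemperedDistribution_apply]
  calc ∫ x, φ x • g x = ∫ x, ∫ s, φ x * (k s * f (x - s)) := by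
        refine integral_congr_ae ?_
        filter_upwards [hg] with x hx
        rw [hx, conv, smul_eq_mul, integral_const_mul]
    _ = ∫ s, ∫ x, φ x * (k s * f (x - s)) := integral_integral_swap hint
    _ = ∫ s, ∫ y, φ (y + s) * (k s * f y) := by
        refine integral_congr_ae (Filter.Eventually.of_forall fun s => ?_)
        simp only
        rw [← integral_add_right_eq_self _ s]
        simp only [add_sub_cancel_right]
    _ = ∫ y, ∫ s, φ (y + s) * (k s * f y) := by
        refine (integral_integral_swap (f := fun y s => φ (y + s) * (k s * f y)) ?_).symm
        have h2 : MeasurePreserving (fun q : EuclideanSpace ℝ (Fin n) × EuclideanSpace ℝ (Fin n) =>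
            (q.1 + q.2, q.2)) (volume.prod volume) (volume.prod volume) :=
          measurePreserving_add_prod volume volume
        have h3 := h2.integrable_comp_of_integrable hint
        refine h3.congr (Filter.Eventually.of_forall fun q => ?_)
        simp [Function.uncurry]
    _ = _ := by
        refine integral_congr_ae (Filter.Eventually.of_forall fun y => ?_)
        simp only
        rw [fourier_smulLeft_fourierInv_apply hki hμ hkμ, smul_eq_mul, ← integral_mul_const]
        refine integral_congr_ae (Filter.Eventually.of_forall fun s => ?_)
        simp only
        ring

end Multiplier

/-! ### The kernels of the resolvents -/

section Kernel

variable {n : ℕ}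

theorem stronglyMeasurable_resolventKernel (z : ℂ) : StronglyMeasurable (resolventKernel n z) :=
  StronglyMeasurable.integral_prod_right' (measurable_resolventKernel_integrand
    (n := n) (z := z)).stronglyMeasurable

theorem image_conj_posHalfLine : (starRingEnd ℂ) '' posHalfLine = posHalfLine := by
  rw [posHalfLine, ← Set.image_comp]
  refine Set.image_congr fun t _ => ?_
  simp

theorem infDist_conj_posHalfLine (z : ℂ) :
    infDist ((starRingEnd ℂ) z) posHalfLine = infDist z posHalfLine := by
  conv_lhs => rw [← image_conj_posHalfLine]
  exact infDist_image Complex.isometry_conj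

theorem fourier_conj (k : EuclideanSpace ℝ (Fin n) → ℂ) (ξ : EuclideanSpace ℝ (Fin n)) :
    FourierTransform.fourier (fun x => (starRingEnd ℂ) (k x)) ξ =
      (starRingEnd ℂ) (FourierTransform.fourier k (-ξ)) := by
  rw [Real.fourier_eq', Real.fourier_eq', ← integral_conj]
  refine integral_congr_ae (Filter.Eventually.of_forall fun x => ?_)
  simp only [smul_eq_mul, map_mul, ← Complex.exp_conj, Complex.conj_I, Complex.conj_ofReal,
    inner_neg_right]
  congr 2
  push_cast
  ring

/-- For Im z ≥ 0 the kernel is a constant multiple of `resolventKernel`. For Im z < 0 one conjugates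
the kernel belonging to the conjugate of z: the symbol is even in ξ, the class is closed under
conjugation, and |z| and the distance to the half-line are unchanged. -/
theorem exists_resolvent_kernel (hn : 2 ≤ n) {α M : ℝ} (hα0 : 0 ≤ α)
    (hα : α ≤ ((n : ℝ) - 1) / 2) {𝒞 : Set (EuclideanSpace ℝ (Fin n) → ℂ)}
    (hmeas : ∀ c ∈ 𝒞, AEStronglyMeasurable c) (hbd : ∀ c ∈ 𝒞, ∀ x, ‖c x‖ ≤ 1)
    (hconj : ∀ c ∈ 𝒞, (fun x => star (c x)) ∈ 𝒞) (hM0 : 0 ≤ M)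
    (hM : ∀ c ∈ 𝒞, ∀ β : ℂ, 0 < β.re → ‖∫ x, Complex.exp (-β * ‖x‖) * c x‖ ≤
      M * (‖β‖ ^ (-α) * β.re ^ (α - n))) :
    ∃ C : ℝ, 0 < C ∧ ∀ z : ℂ, z ∉ posHalfLine →
      ∃ k : EuclideanSpace ℝ (Fin n) → ℂ, StronglyMeasurable k ∧ Integrable k ∧
        (∀ ξ, FourierTransform.fourier k ξ = resolventSymbol n z ξ) ∧
        ∀ c ∈ 𝒞, ‖∫ x, k x * c x‖ ≤ C * (‖z‖ ^ (((n : ℝ) - 1) / 2 - α) *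
          infDist z posHalfLine ^ (α - ((n : ℝ) + 1) / 2)) := by
  obtain ⟨b, hb, hbF⟩ := exists_fourier_resolventKernel hn
  have hn' : (2 : ℝ) ≤ n := by exact_mod_cast hn
  set D : ℝ := M * (4 ^ (n : ℝ) * (2 / ((n : ℝ) - 1))) with hD
  have hD0 : 0 ≤ D := mul_nonneg hM0 (mul_nonneg (by positivity)
    (div_nonneg (by norm_num) (by linarith)))
  have hupper : ∀ z : ℂ, z ∉ posHalfLine → 0 ≤ z.im →
      ∃ k : EuclideanSpace ℝ (Fin n) → ℂ, StronglyMeasurable k ∧ Integrable k ∧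
        (∀ ξ, FourierTransform.fourier k ξ = resolventSymbol n z ξ) ∧
        ∀ c ∈ 𝒞, ‖∫ x, k x * c x‖ ≤ (‖b‖⁻¹ * D + 1) * (‖z‖ ^ (((n : ℝ) - 1) / 2 - α) *
          infDist z posHalfLine ^ (α - ((n : ℝ) + 1) / 2)) := by
    intro z hz him
    refine ⟨fun x => b⁻¹ * resolventKernel n z x,
      (stronglyMeasurable_resolventKernel z).const_mul _,
      (integrable_resolventKernel hn hz him).const_mul _, fun ξ => ?_, fun c hc => ?_⟩
    · have h1 := hbF z hz him ξ
      rw [Real.fourier_eq'] at h1 ⊢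
      have h2 : resolventSymbol n z ξ = b⁻¹ * (b * resolventSymbol n z ξ) :=
        (inv_mul_cancel_left₀ hb _).symm
      rw [h2, ← h1, ← integral_const_mul]
      refine integral_congr_ae (Filter.Eventually.of_forall fun x => ?_)
      simp only [smul_eq_mul]
      ring
    · have h1 := norm_integral_resolventKernel_mul_le hn hz him hα0 hα (hmeas c hc) (hbd c hc)
        hM0 (hM c hc)
      simp only [mul_assoc b⁻¹]
      rw [integral_const_mul, norm_mul, norm_inv]
      have h3 : 0 ≤ ‖z‖ ^ (((n : ℝ) - 1) / 2 - α) *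
          infDist z posHalfLine ^ (α - ((n : ℝ) + 1) / 2) := by
        have : 0 ≤ infDist z posHalfLine := infDist_nonneg
        positivity
      calc _ ≤ ‖b‖⁻¹ * (D * _) := mul_le_mul_of_nonneg_left h1 (by positivity)
        _ = (‖b‖⁻¹ * D) * _ := (mul_assoc _ _ _).symm
        _ ≤ _ := mul_le_mul_of_nonneg_right (by linarith) h3
  -- The summand 1 makes the constant strictly positive.
  refine ⟨‖b‖⁻¹ * D + 1, by positivity, fun z hz => ?_⟩
  rcases le_or_gt 0 z.im with him | him
  · exact hupper z hz him
  · have hz' : (starRingEnd ℂ) z ∉ posHalfLine := by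
      intro h
      rw [← image_conj_posHalfLine] at h
      obtain ⟨w, hw, hwz⟩ := h
      rw [(starRingEnd ℂ).injective hwz] at hw
      exact hz hw
    obtain ⟨k, hk, hki, hkF, hkc⟩ := hupper _ hz' (by rw [Complex.conj_im]; linarith)
    refine ⟨fun x => (starRingEnd ℂ) (k x), hk.star, ?_, fun ξ => ?_, fun c hc => ?_⟩
    · refine ⟨hk.star.aestronglyMeasurable, hki.2.congr' ?_⟩
      exact Filter.Eventually.of_forall fun x => (RCLike.norm_conj (k x)).symm
    · rw [fourier_conj, hkF, resolventSymbol, resolventSymbol, norm_neg, map_inv₀, map_sub,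
        Complex.conj_ofReal, Complex.conj_conj]
    · have h1 := hkc _ (hconj c hc)
      rw [RCLike.norm_conj, infDist_conj_posHalfLine] at h1
      refine le_of_eq_of_le ?_ h1
      rw [← RCLike.norm_conj, ← integral_conj]
      congr 2
      funext x
      rw [map_mul, starRingEnd_self_apply, starRingEnd_apply (R := ℂ) (c x)]

end Kernel

/-! ### The resolvent estimate -/

theorem exists_isRadialBump : ∃ χ : ℝ → ℝ, IsRadialBump χ ∧ ContDiff ℝ ∞ χ := by
  let w : ContDiffBump (3 / 2 : ℝ) := ⟨1 / 4, 1 / 2, by norm_num, by norm_num⟩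
  refine ⟨w, ⟨w.continuous, fun _ => w.nonneg, fun s hs => ?_, 3 / 2, ?_⟩, w.contDiff⟩
  · refine w.zero_of_le_dist ?_
    change (1 / 2 : ℝ) ≤ dist s (3 / 2)
    rw [Real.dist_eq]
    by_contra! h
    rw [abs_lt] at h
    exact hs ⟨by linarith, by linarith⟩
  · rw [w.one_of_mem_closedBall (mem_closedBall_self (by norm_num))]
    exact one_ne_zero

/-! ### Arithmetic of the exponents -/

section Exponents

variable {n : ℕ} {p : ℝ≥0∞}

/-- The threshold p > 2n/(n-1) in the form α < (n-1)/2, as needed in `weight_le`. -/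
theorem inv_toReal_lt (hn : 2 ≤ n) (hp : ENNReal.ofReal (2 * (n : ℝ) / ((n : ℝ) - 1)) < p) :
    n * p⁻¹.toReal < ((n : ℝ) - 1) / 2 := by
  have hn' : (2 : ℝ) ≤ n := by exact_mod_cast hn
  by_cases hpt : p = ⊤
  · simp only [hpt, ENNReal.inv_top, ENNReal.toReal_zero, mul_zero]
    linarith
  · have h0 : 0 < 2 * (n : ℝ) / ((n : ℝ) - 1) := div_pos (by linarith) (by linarith)
    have h1 := (ENNReal.ofReal_lt_iff_lt_toReal h0.le hpt).mp hp
    rw [ENNReal.toReal_inv, ← div_eq_mul_inv, div_lt_div_iff₀ (h0.trans h1) two_pos]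
    rw [div_lt_iff₀ (by linarith)] at h1
    linarith

/-- For q = p the second term is 1. Since n/p < (n-1)/2, the third term exceeds 1 and the fourth is
negative. -/
theorem gammaExp_eq (hn : 2 ≤ n) (hp : ENNReal.ofReal (2 * (n : ℝ) / ((n : ℝ) - 1)) < p) :
    gammaExp n p p = ((n : ℝ) + 1) / 2 - n * p⁻¹.toReal := by
  have h := inv_toReal_lt hn hp
  have hn' : (2 : ℝ) ≤ n := by exact_mod_cast hn
  rw [gammaExp, sub_self, mul_zero, sub_zero, max_eq_right (zero_le_one' ℝ),
    max_eq_left (by linarith : (n : ℝ) * p⁻¹.toReal - ((n : ℝ) - 1) / 2 ≤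
      ((n : ℝ) + 1) / 2 - n * p⁻¹.toReal)]
  exact max_eq_right (by linarith)

end Exponents

section Estimate

variable {n : ℕ} {p : ℝ≥0∞} [Fact (1 ≤ p)]

/-- The resolvent estimate, from an oscillatory bound for a class of functions which is norming
for convolution operators. -/
theorem resolvent_bound_of_class (hn : 2 ≤ n)
    (hp : ENNReal.ofReal (2 * (n : ℝ) / ((n : ℝ) - 1)) < p) {χ : ℝ → ℝ} (hχ : IsRadialBump χ)
    {𝒞 : Set (EuclideanSpace ℝ (Fin n) → ℂ)}
    (hmeas : ∀ c ∈ 𝒞, AEStronglyMeasurable c) (hbd : ∀ c ∈ 𝒞, ∀ x, ‖c x‖ ≤ 1)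
    (hdil : ∀ c ∈ 𝒞, ∀ R : ℝ, 0 < R → (fun x => c (R • x)) ∈ 𝒞)
    (hconj : ∀ c ∈ 𝒞, (fun x => star (c x)) ∈ 𝒞)
    (hrad : ∃ C : ℝ, ∀ lam : ℝ, 1 ≤ lam → ∀ c ∈ 𝒞,
      ‖∫ s, oscKernel (fun x : EuclideanSpace ℝ (Fin n) => χ ‖x‖) lam s * c s‖ ≤
        C * lam ^ (-(n * p⁻¹.toReal)))
    (hnorm : ∀ k : EuclideanSpace ℝ (Fin n) → ℂ, StronglyMeasurable k → Integrable k →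
      ∀ N : ℝ, 0 ≤ N → (∀ c ∈ 𝒞, ‖∫ x, k x * c x‖ ≤ N) →
      ∀ f : Lp ℂ p (volume : Measure (EuclideanSpace ℝ (Fin n))), ‖f‖ = 1 →
        eLpNorm (conv k f) p ≤ ENNReal.ofReal N) :
    ∃ C : ℝ, 0 < C ∧ ∀ z : ℂ, z ∉ posHalfLine →
      ∃ R : Lp ℂ p (volume : Measure (EuclideanSpace ℝ (Fin n))) →L[ℂ]
          Lp ℂ p (volume : Measure (EuclideanSpace ℝ (Fin n))),
        (∀ f, Lp.toTemperedDistribution (R f) =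
          resolvent n z (Lp.toTemperedDistribution f)) ∧
        ‖R‖ ≤ C * ‖z‖ ^ (-1 + gammaExp n p p) *
          Metric.infDist z posHalfLine ^ (-gammaExp n p p) := by
  have hn' : (2 : ℝ) ≤ n := by exact_mod_cast hn
  have hα := inv_toReal_lt hn hp
  have hα0 : 0 ≤ n * p⁻¹.toReal := by positivity
  obtain ⟨C₀, hC₀, hosc⟩ := exists_osc_bound hχ hα0 hbd hconj hrad
  obtain ⟨M, hM0, hM⟩ := exists_exp_kernel_bound hχ (by omega) hα0 (by linarith) hmeas hbd hdil
    hC₀ hosc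
  obtain ⟨C, hC, hker⟩ := exists_resolvent_kernel hn hα0 hα.le hmeas hbd hconj hM0 hM
  refine ⟨C, hC, fun z hz => ?_⟩
  obtain ⟨k, hk, hki, hkF, hkc⟩ := hker z hz
  obtain ⟨R, hR⟩ := exists_conv_clm p hk hki
  refine ⟨R, fun f => ?_, ?_⟩
  · exact toTemperedDistribution_conv hk hki (resolventSymbol_hasTemperateGrowth n hz) hkF (hR f)
  · have he1 : -1 + gammaExp n p p = ((n : ℝ) - 1) / 2 - n * p⁻¹.toReal := by
      rw [gammaExp_eq hn hp]
      ring
    have he2 : -gammaExp n p p = n * p⁻¹.toReal - ((n : ℝ) + 1) / 2 := by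
      rw [gammaExp_eq hn hp]
      ring
    rw [he1, he2, mul_assoc]
    have hd : 0 ≤ infDist z posHalfLine := infDist_nonneg
    have hN : 0 ≤ C * (‖z‖ ^ (((n : ℝ) - 1) / 2 - n * p⁻¹.toReal) *
        infDist z posHalfLine ^ (n * p⁻¹.toReal - ((n : ℝ) + 1) / 2)) := by positivity
    refine ContinuousLinearMap.opNorm_le_of_unit_norm hN fun f hf => ?_
    have h1 := hnorm k hk hki _ hN hkc f hf
    rw [Lp.norm_def, eLpNorm_congr_ae (hR f)]
    exact ENNReal.toReal_le_of_le_ofReal hN h1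

end Estimate

/-- The measurable functions bounded by `1` are norming for convolution operators on `L^∞`. -/
theorem eLpNorm_top_conv_le {n : ℕ} {k : EuclideanSpace ℝ (Fin n) → ℂ} {N : ℝ}
    (hkc : ∀ c : EuclideanSpace ℝ (Fin n) → ℂ, AEStronglyMeasurable c → (∀ x, ‖c x‖ ≤ 1) →
      ‖∫ x, k x * c x‖ ≤ N)
    (f : Lp ℂ ⊤ (volume : Measure (EuclideanSpace ℝ (Fin n)))) (hf : ‖f‖ = 1) :
    eLpNorm (conv k f) ⊤ ≤ ENNReal.ofReal N := by
  have hfm := Lp.stronglyMeasurable f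
  -- Truncation gives a representative of f bounded by 1 everywhere, since the class asks for a
  -- pointwise bound.
  set g : EuclideanSpace ℝ (Fin n) → ℂ := Set.indicator {x | ‖f x‖ ≤ 1} f with hg
  have hgm : StronglyMeasurable g :=
    hfm.indicator (measurableSet_le hfm.norm.measurable measurable_const)
  have hfg : f =ᵐ[volume] g := by
    filter_upwards [ae_le_eLpNormEssSup (f := f)
      (μ := (volume : Measure (EuclideanSpace ℝ (Fin n))))] with x hx
    have h1 : eLpNormEssSup f (volume : Measure (EuclideanSpace ℝ (Fin n))) = 1 := by
      rw [Lp.norm_def, eLpNorm_exponent_top] at hf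
      rw [← ENNReal.ofReal_toReal (a := eLpNormEssSup f volume), hf, ENNReal.ofReal_one]
      intro h
      simp [h] at hf
    rw [h1, ← ofReal_norm, ENNReal.ofReal_le_one] at hx
    exact (Set.indicator_of_mem (s := {x | ‖f x‖ ≤ 1}) hx f).symm
  have hg1 : ∀ x, ‖g x‖ ≤ 1 := by
    intro x
    by_cases hx : x ∈ {x | ‖f x‖ ≤ 1}
    · rw [hg, Set.indicator_of_mem hx]
      exact hx
    · rw [hg, Set.indicator_of_notMem hx, norm_zero]
      exact zero_le_one
  rw [conv_congr_ae hfg, eLpNorm_exponent_top]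
  refine eLpNormEssSup_le_of_ae_bound (Filter.Eventually.of_forall fun x => ?_)
  exact hkc (fun s => g (x - s))
    (hgm.comp_measurable (measurable_id.const_sub x)).aestronglyMeasurable fun s => hg1 _

/-- Correlations are norming for convolution operators on `L^p`, `p < ∞`. -/
theorem eLpNorm_conv_le_of_corr {n : ℕ} {p : ℝ≥0∞} [Fact (1 ≤ p)] (hpt : p ≠ ⊤) {Q : ℝ}
    (hPQ : p.toReal.HolderConjugate Q) {k : EuclideanSpace ℝ (Fin n) → ℂ}
    (hk : StronglyMeasurable k) (hki : Integrable k) {N : ℝ} (hN : 0 ≤ N)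
    (hkc : ∀ c ∈ corrClass n p.toReal Q, ‖∫ x, k x * c x‖ ≤ N)
    (f : Lp ℂ p (volume : Measure (EuclideanSpace ℝ (Fin n)))) (hf : ‖f‖ = 1) :
    eLpNorm (conv k f) p ≤ ENNReal.ofReal N := by
  have hp : 1 ≤ p := Fact.out
  have hp0 : p ≠ 0 := (zero_lt_one.trans_le hp).ne'
  have hP := hPQ.pos
  have hfm := Lp.stronglyMeasurable f
  have hf1 : ∫⁻ x, ‖f x‖ₑ ^ p.toReal ≤ 1 := by
    have h1 : eLpNorm f p (volume : Measure (EuclideanSpace ℝ (Fin n))) = 1 := by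
      rw [Lp.norm_def] at hf
      rw [← ENNReal.ofReal_toReal (Lp.memLp f).2.ne, hf, ENNReal.ofReal_one]
    rw [eLpNorm_eq_lintegral_rpow_enorm_toReal hp0 hpt, one_div] at h1
    have h2 := congrArg (fun t : ℝ≥0∞ => t ^ p.toReal) h1
    simp only [ENNReal.rpow_inv_rpow hP.ne', ENNReal.one_rpow] at h2
    exact h2.le
  have hu := stronglyMeasurable_conv hk hfm
  have hfin := (eLpNorm_lt_top_iff_lintegral_rpow_enorm_lt_top hp0 hpt).mp
    (memLp_conv hp hk hki hfm (Lp.memLp f)).2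
  have h2 := lintegral_rpow_le_of_forall_pairing hPQ hu hfin.ne (N := N) fun g hg hg1 => by
    have h3 := hkc _ ⟨f, g, hfm, hg, hf1, hg1, rfl⟩
    rwa [integral_mul_corr hPQ hki hfm hg hf1 hg1] at h3
  rw [eLpNorm_eq_lintegral_rpow_enorm_toReal hp0 hpt, one_div, ENNReal.rpow_inv_le_iff hP,
    ENNReal.ofReal_rpow_of_nonneg hN hP.le]
  exact h2

/-- Taking p-th roots turns the factor λ^{-n} in the integral estimate into λ^{-n/p}. -/
theorem exists_half_space_bound {m : ℕ} {p : ℝ≥0∞} (hp1 : 1 ≤ p) (hpt : p ≠ ⊤) {Q : ℝ}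
    (hPQ : p.toReal.HolderConjugate Q)
    (hT : ∀ φ a : EuclideanSpace ℝ (Fin (m + 1)) → EuclideanSpace ℝ (Fin (m + 1 - 1)) → ℝ,
      IsAmplitude a → CarlesonSjolin φ a → ConvexCondition φ a → StraightCondition φ →
      UniformLpBound p φ a)
    {A : EuclideanSpace ℝ (Fin (m + 1)) → ℝ} {c ρ : ℝ} (hAs : ContDiff ℝ ∞ A)
    (hA0 : ∀ x, 0 ≤ A x) (hc : 0 < c) (hρ : c ≤ ρ)
    (hA : ∀ x, A x ≠ 0 → c ≤ x (Fin.last m) ∧ ‖x‖ ≤ ρ) :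
    ∃ C : ℝ, ∀ lam : ℝ, 1 ≤ lam → ∀ c ∈ corrClass (m + 1) p.toReal Q,
      ‖∫ s, oscKernel A lam s * c s‖ ≤ C * lam ^ (-(((m + 1 : ℕ) : ℝ) * p⁻¹.toReal)) := by
  obtain ⟨C, hC⟩ := exists_convolution_bound hp1 hpt hT hAs hA0 hc hρ hA
  have hP := hPQ.pos
  refine ⟨(C : ℝ) ^ p.toReal⁻¹, fun lam hlam => ?_⟩
  have hlam0 : 0 < lam := by linarith
  have hAc : HasCompactSupport A := HasCompactSupport.intro (isCompact_closedBall 0 ρ)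
    fun x hx => by
      by_contra h
      exact hx (mem_closedBall_zero_iff.mpr (hA x h).2)
  refine norm_integral_mul_corr_le hPQ (integrable_oscKernel hAs.continuous hAc lam)
    (continuous_oscKernel hAs.continuous lam) (by positivity) fun f hf => ?_
  refine (hC lam hlam f hf).trans_eq ?_
  congr 1
  rw [Real.mul_rpow (by positivity) (by positivity), Real.rpow_inv_rpow C.coe_nonneg hP.ne',
    ← Real.rpow_mul hlam0.le, ENNReal.toReal_inv,
    show -(((m + 1 : ℕ) : ℝ) * p.toReal⁻¹) * p.toReal = -((m + 1 : ℕ) : ℝ) by field_simp,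
    Real.rpow_neg hlam0.le, Real.rpow_natCast, ENNReal.ofReal_mul C.coe_nonneg, ENNReal.ofReal_coe_nnreal]

end HormanderResolvent

end

theorem theorem2p5 (n : ℕ) (hn : 2 ≤ n) (p : ℝ≥0∞) [Fact (1 ≤ p)]
    (hp : ENNReal.ofReal (2 * (n : ℝ) / ((n : ℝ) - 1)) < p)
    (hT : ∀ φ a : EuclideanSpace ℝ (Fin n) → EuclideanSpace ℝ (Fin (n - 1)) → ℝ,
      HormanderResolvent.IsAmplitude a → HormanderResolvent.CarlesonSjolin φ a →
      HormanderResolvent.ConvexCondition φ a → HormanderResolvent.StraightCondition φ →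
      HormanderResolvent.UniformLpBound p φ a) :
    ∃ C : ℝ, 0 < C ∧ ∀ z : ℂ, z ∉ HormanderResolvent.posHalfLine →
      ∃ R : Lp ℂ p (volume : Measure (EuclideanSpace ℝ (Fin n))) →L[ℂ]
          Lp ℂ p (volume : Measure (EuclideanSpace ℝ (Fin n))),
        (∀ f, Lp.toTemperedDistribution (R f) =
          HormanderResolvent.resolvent n z (Lp.toTemperedDistribution f)) ∧
        ‖R‖ ≤ C * ‖z‖ ^ (-1 + HormanderResolvent.gammaExp n p p) *
          Metric.infDist z HormanderResolvent.posHalfLine ^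
            (-HormanderResolvent.gammaExp n p p) := by
  open HormanderResolvent in
  obtain ⟨χ, hχ, hχs⟩ := exists_isRadialBump
  have hn' : (2 : ℝ) ≤ n := by exact_mod_cast hn
  by_cases hpt : p = ⊤
  -- Here n/p = 0, so no decay in λ is asked for and the integral of χ(|x|) bounds all pairings with
  -- functions bounded by 1.
  · subst hpt
    refine resolvent_bound_of_class (𝒞 := {c | AEStronglyMeasurable c ∧ ∀ x, ‖c x‖ ≤ 1}) hn hp hχ
      (fun c hc => hc.1) (fun c hc => hc.2) (fun c hc R hR => ⟨?_, fun x => hc.2 _⟩)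
      (fun c hc => ⟨?_, fun x => (norm_star _).trans_le (hc.2 x)⟩) ?_
      (fun k hk hki N hN hkc f hf => eLpNorm_top_conv_le (fun c hc hc1 => hkc c ⟨hc, hc1⟩) f hf)
    · refine hc.1.comp_quasiMeasurePreserving ⟨measurable_const_smul R, ?_⟩
      rw [Measure.map_addHaar_smul _ hR.ne']
      exact Measure.smul_absolutelyContinuous
    · exact continuous_star.comp_aestronglyMeasurable hc.1
    · refine ⟨∫ x : EuclideanSpace ℝ (Fin n), χ ‖x‖, fun lam hlam c hc => ?_⟩
      rw [ENNReal.inv_top, ENNReal.toReal_zero, mul_zero, neg_zero, Real.rpow_zero, mul_one]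
      refine norm_integral_le_of_norm_le hχ.integrable_norm
        (Filter.Eventually.of_forall fun x => ?_)
      rw [norm_mul, norm_oscKernel, abs_of_nonneg (hχ.nonneg _)]
      exact mul_le_of_le_one_right (hχ.nonneg _) (hc.2 x)
  -- The threshold 2n/(n-1) exceeds 1, so p has a finite conjugate exponent and the correlation
  -- class is available.
  · have hP1 : 1 < p.toReal := by
      have h0 : 0 < 2 * (n : ℝ) / ((n : ℝ) - 1) := div_pos (by linarith) (by linarith)
      refine lt_trans ?_ ((ENNReal.ofReal_lt_iff_lt_toReal h0.le hpt).mp hp)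
      rw [one_lt_div (by linarith)]
      linarith
    have hPQ := Real.HolderConjugate.conjExponent hP1
    obtain ⟨m, rfl⟩ : ∃ m, n = m + 1 := ⟨n - 1, by omega⟩
    refine resolvent_bound_of_class hn hp hχ corrClass_aestronglyMeasurable
      (corrClass_norm_le hPQ) (corrClass_dilate hPQ) corrClass_conj ?_
      (fun k hk hki N hN hkc f hf => eLpNorm_conv_le_of_corr hpt hPQ hk hki hN hkc f hf)
    exact exists_radial_bound_of_halfSpace hχ hχs corrClass_aestronglyMeasurable
      (corrClass_norm_le hPQ) corrClass_isometry fun A c ρ hAs hA0 hc hρ hA =>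
        exists_half_space_bound Fact.out hpt hPQ hT hAs hA0 hc hρ hA
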